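/- Let $T>0$, and consider either the wave equation, with $d\in\{1,2,3\}$, or the heat equation, with $d\ge 1$. Let $G_t(dx)$, $t>0$, be the corresponding fundamental solution on $\mathbb{R}^d$, that is, $G_t(dx)=\frac12\mathbf 1_{\{|x|<t\}}dx$ (wave, $d=1$), $G_t(dx)=\frac{1}{2\pi}(t^2-|x|^2)^{-1/2}\mathbf 1_{\{|x|<t\}}dx$ (wave, $d=2$), $G_t(dx)=\frac1{4\pi t}\sigma_t(dx)$ with $\sigma_t$ the surface measure on the sphere of radius $t$ (wave, $d=3$), and $G_t(dx)=(2\pi t)^{-d/2}e^{-|x|^2/(2t)}dx$ (heat). Write $\mathcal F f(\xi)=\int_{\mathbb{R}^d}e^{-i\langle\xi,x\rangle}f(x)\,dx$ (and similarly for finite measures). For every $n\ge1$ let $\mu_n$ be a non-negative tempered measure on $\mathbb{R}^d$ and let $W^n=\{W^n(\varphi),\ \varphi\in C_0^\infty([0,\infty)\times\mathbb{R}^d)\}$ be a centered Gaussian process, all of them defined on one probability space, with $$\mathbb E[W^n(\varphi)W^n(\psi)]=\int_0^\infty\int_{\mathbb{R}^d}\mathcal F\varphi(t,\cdot)(\xi)\,\overline{\mathcal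 F\psi(t,\cdot)(\xi)}\,\mu_n(d\xi)\,dt .$$ For a measure-valued integrand $g$, the Wiener integral $\int_0^\infty\int_{\mathbb{R}^d} g(s,y)\,W^n(ds,dy)$ is the limit in $L^2(\Omega)$ of $W^n(\varphi_k)$ for any test functions $\varphi_k$ with $\int_0^\infty\int_{\mathbb{R}^d}|\mathcal F\varphi_k(s,\cdot)(\xi)-\mathcal F g(s)(\xi)|^2\mu_n(d\xi)\,ds\to0$, if such $\varphi_k$ exist. Assume that $q\in(0,2)$ satisfies $$\sup_{n\ge1}\int_{\mathbb{R}^d}\frac{\mu_n(d\xi)}{1+|\xi|^q}<\infty .\qquad\textbf{(H1)}$$ Then, for all $n\geq 1$, $t\in[0,T]$ and $x\in\mathbb{R}^d$, the Wiener integral $$v^n(t,x)=\int_0^t\int_{\mathbb{R}^d}G_{t-s}(x-y)\,W^n(ds,dy)$$ is well defined, and the following hold. (a) For any compact $K\subset\mathbb{R}^d$ there is a constant $C>0$ such that, for all $x,z\in K$, $$\sup_{n\ge1}\sup_{t\in[0,T]}\mathbb E\big[|v^n(t,x)-v^n(t,z)|^2\big]\le C|x-z|^{2-q}.$$ (b)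 There is a constant $C>0$ such that, for all $s,t\in[0,T]$, $$\sup_{n\ge1}\sup_{x\in\mathbb{R}^d}\mathbb E\big[|v^n(t,x)-v^n(s,x)|^2\big]\le\begin{cases}C|t-s|^{2-q}&\text{(wave equation)},\\ C|t-s|^{1-\frac q2}&\text{(heat equation)}.\end{cases}$$ Moreover, every $v^n$ has a version with continuous paths on $[0,T]\times\mathbb{R}^d$, and the laws of (such versions of) $\{v^n,\ n\ge1\}$ form a tight family in $\mathcal C([0,T]\times\mathbb{R}^d)$ with the topology of uniform convergence on compact sets. -/

import Mathlib

open MeasureTheory ProbabilityTheory Filter Topology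

noncomputable section

namespace SPDE

/-- Euclidean space `ℝ^d` with its Euclidean norm. -/
abbrev E (d : ℕ) : Type := EuclideanSpace ℝ (Fin d)

/-! ### Fourier transform, with the convention `ℱ f (ξ) = ∫ exp (-i ⟨ξ, x⟩) f x dx` -/

/-- Fourier transform of a function on `ℝ^d`. -/
def fourierFun {d : ℕ} (f : E d → ℝ) (ξ : E d) : ℂ :=
  ∫ x, Complex.exp (-(Complex.I * ((inner ℝ ξ x : ℝ) : ℂ))) * ((f x : ℝ) : ℂ)

/-- Fourier transform of a (finite) measure on `ℝ^d`. -/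
def fourierMeasure {d : ℕ} (ν : Measure (E d)) (ξ : E d) : ℂ :=
  ∫ x, Complex.exp (-(Complex.I * ((inner ℝ ξ x : ℝ) : ℂ))) ∂ν

/-! ### Spatially homogeneous Gaussian noise, white in time -/

/-- Real test functions in `C_0^∞([0,∞) × ℝ^d)`: smooth up to the boundary `t = 0` and with compact
support (not necessarily vanishing at `t = 0`). A function on `[0,∞) × ℝ^d` is represented by its
extension by zero to `t < 0`. -/
structure TestFunction (d : ℕ) where
  toFun : ℝ × E d → ℝ
  smooth : ContDiffOn ℝ ((⊤ : ℕ∞) : WithTop ℕ∞) toFun (Set.Ici 0 ×ˢ Set.univ)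
  compact_support : HasCompactSupport toFun
  eq_zero : ∀ (t : ℝ) (x : E d), t < 0 → toFun (t, x) = 0

/-- `ℱ φ(t,·)(ξ)`. -/
def TestFunction.fourier {d : ℕ} (φ : TestFunction d) (t : ℝ) (ξ : E d) : ℂ :=
  fourierFun (fun x => φ.toFun (t, x)) ξ

/-- `W` is a spatially homogeneous Gaussian noise, white in time, with spectral measure `μ`:
a centered Gaussian process indexed by the test functions, with covariance
`E[W(φ) W(ψ)] = ∫_0^∞ ∫ ℱφ(t,·)(ξ) conj (ℱψ(t,·)(ξ)) μ(dξ) dt`,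
where `μ` is a nonnegative tempered measure. -/
structure IsHomogeneousNoise {Ω : Type*} [MeasurableSpace Ω] (P : Measure Ω) {d : ℕ}
    (μ : Measure (E d)) (W : TestFunction d → Ω → ℝ) : Prop where
  tempered : μ.HasTemperateGrowth
  gaussian : IsGaussianProcess W P
  centered : ∀ φ, ∫ ω, W φ ω ∂P = 0
  covariance : ∀ φ ψ, ((∫ ω, W φ ω * W ψ ω ∂P : ℝ) : ℂ) =
    ∫ t in Set.Ici (0 : ℝ), ∫ ξ, φ.fourier t ξ * (starRingEnd ℂ) (ψ.fourier t ξ) ∂μ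

/-! ### Wiener integral

The Hilbert space of the noise is the completion of the test functions for the covariance inner
product. Through the Fourier transform in space it is the closure of the set of all `ℱφ` in
`L²([0,∞) × ℝ^d, dt ⊗ μ)`. -/

/-- The squared distance, in the Hilbert space of the noise, between a test function `φ` and a
measure-valued integrand `g`. -/
def noiseDistSq {d : ℕ} (μ : Measure (E d)) (φ : TestFunction d) (g : ℝ → Measure (E d)) :
    ENNReal :=
  ∫⁻ t in Set.Ici (0 : ℝ), ∫⁻ ξ, ‖φ.fourier t ξ - fourierMeasure (g t) ξ‖ₑ ^ 2 ∂μ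

/-- `X = ∫_0^∞ ∫_{ℝ^d} g(t,y) W(dt,dy)`: the integrand `g` is a limit, in the Hilbert space of
the noise, of test functions `φ k`, and `X` is the limit in `L²(Ω)` of `W (φ k)`.
By the isometry property, `X` is determined by `g` up to almost sure equality. -/
def IsWienerIntegral {Ω : Type*} [MeasurableSpace Ω] (P : Measure Ω) {d : ℕ}
    (μ : Measure (E d)) (W : TestFunction d → Ω → ℝ) (g : ℝ → Measure (E d)) (X : Ω → ℝ) : Prop :=
  MemLp X 2 P ∧ ∃ φ : ℕ → TestFunction d,
    Tendsto (fun k => noiseDistSq μ (φ k) g) atTop (𝓝 0) ∧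
    Tendsto (fun k => eLpNorm (fun ω => W (φ k) ω - X ω) 2 P) atTop (𝓝 0)

/-! ### Fundamental solutions -/

/-- The two equations `∂²u/∂t² - Δu = Ẇ` (wave) and `∂u/∂t - Δu/2 = Ẇ` (heat). -/
inductive Equation
  | wave
  | heat

/-- Heat equation, any `d ≥ 1`: the measure `(2πt)^{-d/2} exp(-|x|²/(2t)) dx`. -/
def heatSolution (d : ℕ) (t : ℝ) : Measure (E d) :=
  volume.withDensity fun x =>
    ENNReal.ofReal (1 / (2 * Real.pi * t) ^ ((d : ℝ) / 2) * Real.exp (-‖x‖ ^ 2 / (2 * t)))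

/-- The surface measure (of total mass `4πt²`) on the sphere of radius `t` in `ℝ^3`. -/
def sphereMeasure (t : ℝ) : Measure (E 3) :=
  ENNReal.ofReal (t ^ 2) •
    ((volume : Measure (E 3)).toSphere.map fun y : Metric.sphere (0 : E 3) 1 => t • (y : E 3))

/-- Wave equation, `d ∈ {1, 2, 3}` (the zero measure, unused, for other `d`):
`(1/2) 1_{|x|<t} dx`, `(2π)^{-1} (t²-|x|²)^{-1/2} 1_{|x|<t} dx` and `(4πt)^{-1} σ_t(dx)`. -/
def waveSolution : (d : ℕ) → ℝ → Measure (E d)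
  | 1, t => volume.withDensity
      ((Metric.ball 0 t).indicator fun _ => ENNReal.ofReal (1 / 2))
  | 2, t => volume.withDensity
      ((Metric.ball 0 t).indicator fun x =>
        ENNReal.ofReal (1 / (2 * Real.pi) * (1 / √(t ^ 2 - ‖x‖ ^ 2))))
  | 3, t => ENNReal.ofReal (1 / (4 * Real.pi * t)) • sphereMeasure t
  | _, _ => 0

namespace Equation

/-- Fundamental solution `G_t(dx)`, `t > 0`. -/
def fundamentalSolution : Equation → (d : ℕ) → ℝ → Measure (E d)
  | wave => waveSolution
  | heat => heatSolution

/-- The dimensions considered: `d ∈ {1, 2, 3}` for the wave and `d ≥ 1` for the heat equation. -/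
def AdmissibleDim : Equation → ℕ → Prop
  | wave, d => d = 1 ∨ d = 2 ∨ d = 3
  | heat, d => 1 ≤ d

/-- Exponent of the time increments: `2 - q` (wave), `1 - q/2` (heat). -/
def timeExponent : Equation → ℝ → ℝ
  | wave, q => 2 - q
  | heat, q => 1 - q / 2

/-- The integrand `s ↦ 1_{s < t} G_{t-s}(x - dy)` of the stochastic convolution. -/
def kernel (eq : Equation) (d : ℕ) (t : ℝ) (x : E d) (s : ℝ) : Measure (E d) :=
  if s < t then (eq.fundamentalSolution d (t - s)).map (fun z => x - z) else 0

end Equation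

/-- `X = ∫_0^t ∫_{ℝ^d} G_{t-s}(x-y) W(ds,dy)`. -/
def IsStochConv {Ω : Type*} [MeasurableSpace Ω] (P : Measure Ω) (eq : Equation) {d : ℕ}
    (μ : Measure (E d)) (W : TestFunction d → Ω → ℝ) (t : ℝ) (x : E d) (X : Ω → ℝ) : Prop :=
  IsWienerIntegral P μ W (eq.kernel d t x) X

/-! ### Path space -/

/-- `C([0,T] × ℝ^d)` with the topology of uniform convergence on compact sets
(the compact-open topology). -/
abbrev PathSpace (d : ℕ) (T : ℝ) : Type := C(Set.Icc (0 : ℝ) T × E d, ℝ)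

/-- The Borel σ-algebra of the path space. -/
instance instMeasurableSpacePathSpace (d : ℕ) (T : ℝ) : MeasurableSpace (PathSpace d T) :=
  borel _

instance instBorelSpacePathSpace (d : ℕ) (T : ℝ) : BorelSpace (PathSpace d T) := ⟨rfl⟩

/-- `V` is a version of the random field `v` on `[0,T] × ℝ^d` with continuous paths, as a random
element of the path space. -/
def IsContinuousVersion {Ω : Type*} [MeasurableSpace Ω] (P : Measure Ω) {d : ℕ} {T : ℝ}
    (v : ℝ → E d → Ω → ℝ) (V : Ω → PathSpace d T) : Prop :=
  Measurable V ∧ ∀ p : Set.Icc (0 : ℝ) T × E d, ∀ᵐ ω ∂P, V ω p = v p.1 p.2 ω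

end SPDE

end

namespace SPDE

/-! ### Fourier transforms of radial measures -/

/-! Everything rests on the isometry between `W φ` and the Fourier transform of `φ` in L²(dt ⊗ μ).
On that side the integrand of v(t,x) is the explicit function 1_{s<t} e^{-i⟨ξ,x⟩} g_{t-s}(|ξ|)
(`Equation.kernelFourier`), where g_τ(ρ) = sin(τρ)/ρ for waves and g_τ(ρ) = e^{-τρ²/2} for heat,
whatever the admissible dimension. Increments of v are thus controlled by L² norms of differences of
such functions, which are estimated for each fixed ξ after integration in time.

In space, the time integral of g² is O(1/(1+|ξ|²)), the squared difference of the exponentials is at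
most 4(|ξ||x-z|)^{2-q}, and |ξ|^{2-q}/(1+|ξ|²) ≤ 2/(1+|ξ|^q), which is the weight in (H1). In time,
the wave increment |g_a - g_b| is at most |a-b| and at most 2/ρ, and one interpolates; for heat, the
interval [0,s] is handled by the semigroup factor and [s,t] by direct integration. No constant
depends on μ, so uniformity in n is exactly (H1).

The Wiener integral exists because the kernel lies in the L² closure of the Fourier transforms of
test functions (`approximable_kernelFourier`): smooth in space, freeze time on a grid, truncate the
frozen measures and smooth the time indicators. Completeness of L²(Ω) does the rest.

Since the approximating increments are Gaussian, moments of every order are bounded by powers of the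
L² distance (`IsHomogeneousNoise.lintegral_sub_pow_le`), and a large even order meets Kolmogorov's
condition in dimension d+1. Continuity and tightness follow from dyadic chaining on ℝ^{d+1}, of
which [0,T] × ℝ^d is a retract by clamping time. The compact sets come from Arzelà–Ascoli, and
v(0,·) = 0 pins the fields at the origin. -/

/-- The coordinates of a vector of `ℝ^{n+1}`: the first one, and the remaining ones. -/
def splitFirst (n : ℕ) (x : E (n + 1)) : ℝ × E n :=
  (x 0, WithLp.toLp 2 fun j => x j.succ)

theorem measurePreserving_splitFirst (n : ℕ) : MeasurePreserving (splitFirst n) := by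
  have h1 := PiLp.volume_preserving_ofLp (Fin (n + 1))
  have h2 := volume_preserving_piFinSuccAbove (fun _ : Fin (n + 1) => ℝ) 0
  have h3 := (MeasurePreserving.id (volume : Measure ℝ)).prod (PiLp.volume_preserving_toLp (Fin n))
  exact h3.comp (h2.comp h1)

theorem norm_sq_splitFirst {n : ℕ} (x : E (n + 1)) :
    ‖x‖ ^ 2 = (splitFirst n x).1 ^ 2 + ‖(splitFirst n x).2‖ ^ 2 := by
  simp [splitFirst, EuclideanSpace.norm_sq_eq, Fin.sum_univ_succ]

/-- The reflection in the hyperplane orthogonal to ξ - ‖ξ‖e₀ exchanges ξ and ‖ξ‖e₀, because both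
have the same norm. When they coincide it is the identity. -/
theorem exists_isometry_map_first {n : ℕ} (ξ : E (n + 1)) :
    ∃ L : E (n + 1) ≃ₗᵢ[ℝ] E (n + 1), ∀ x, inner ℝ ξ (L x) = ‖ξ‖ * x 0 := by
  have h : ‖ξ‖ = ‖EuclideanSpace.single (0 : Fin (n + 1)) ‖ξ‖‖ := by simp
  refine ⟨(Submodule.reflection (Submodule.span ℝ
    {ξ - EuclideanSpace.single (0 : Fin (n + 1)) ‖ξ‖})ᗮ), fun x => ?_⟩
  set L := Submodule.reflection (Submodule.span ℝ
    {ξ - EuclideanSpace.single (0 : Fin (n + 1)) ‖ξ‖})ᗮ with hL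
  have h2 : L ξ = EuclideanSpace.single (0 : Fin (n + 1)) ‖ξ‖ := Submodule.reflection_sub h
  have h3 : inner ℝ ξ (L x) = inner ℝ (L ξ) (L (L x)) := (L.inner_map_map _ _).symm
  rw [h3, h2, Submodule.reflection_reflection, EuclideanSpace.inner_single_left]
  simp

theorem map_first_withDensity_norm {n : ℕ} {f : ℝ → ENNReal} (hf : Measurable f) :
    ((volume : Measure (E (n + 1))).withDensity fun x => f ‖x‖).map (fun x => x 0) =
      volume.withDensity fun a => ∫⁻ y : E n, f (√(a ^ 2 + ‖y‖ ^ 2)) := by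
  ext A hA
  have hm : Measurable fun x : E (n + 1) => x 0 := by fun_prop
  have hF : Measurable fun p : ℝ × E n =>
      A.indicator (fun _ => (1 : ENNReal)) p.1 * f (√(p.1 ^ 2 + ‖p.2‖ ^ 2)) :=
    ((measurable_const.indicator hA).comp measurable_fst).mul (hf.comp (by fun_prop))
  rw [Measure.map_apply hm hA, withDensity_apply _ (hm hA), withDensity_apply _ hA,
    ← lintegral_indicator (hm hA), ← lintegral_indicator hA]
  calc ∫⁻ x : E (n + 1), ((fun x : E (n + 1) => x 0) ⁻¹' A).indicator (fun x => f ‖x‖) x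
      = ∫⁻ x : E (n + 1), (fun p : ℝ × E n => A.indicator (fun _ => (1 : ENNReal)) p.1 *
          f (√(p.1 ^ 2 + ‖p.2‖ ^ 2))) (splitFirst n x) := by
        refine lintegral_congr fun x => ?_
        simp only [← norm_sq_splitFirst, Real.sqrt_sq (norm_nonneg x)]
        by_cases hx : x 0 ∈ A <;> simp [splitFirst, hx]
    _ = ∫⁻ p : ℝ × E n, A.indicator (fun _ => (1 : ENNReal)) p.1 *
          f (√(p.1 ^ 2 + ‖p.2‖ ^ 2)) := (measurePreserving_splitFirst n).lintegral_comp hF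
    _ = ∫⁻ a, ∫⁻ y : E n, A.indicator (fun _ => (1 : ENNReal)) a * f (√(a ^ 2 + ‖y‖ ^ 2)) :=
        lintegral_prod _ hF.aemeasurable
    _ = _ := by
        refine lintegral_congr fun a => ?_
        by_cases ha : a ∈ A <;> simp [ha]

/-- A radial measure is rotation invariant, so ξ may be turned onto the first axis; only the
marginal of the first coordinate then matters. No integrability is required, as both sides are the
same Bochner integral after a change of variables. -/
theorem fourierMeasure_withDensity_norm {n : ℕ} {f : ℝ → ENNReal} (hf : Measurable f)
    (ξ : E (n + 1)) :
    fourierMeasure (volume.withDensity fun x => f ‖x‖) ξ =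
      ∫ a, Complex.exp (-(Complex.I * ((‖ξ‖ * a : ℝ) : ℂ)))
        ∂(volume.withDensity fun a => ∫⁻ y : E n, f (√(a ^ 2 + ‖y‖ ^ 2))) := by
  obtain ⟨L, hL⟩ := exists_isometry_map_first ξ
  have hmap : (volume.withDensity fun x : E (n + 1) => f ‖x‖).map L =
      volume.withDensity fun x => f ‖x‖ := by
    ext A hA
    have hLm : Measurable L := L.continuous.measurable
    have h := L.measurePreserving.setLIntegral_comp_preimage hA (hf.comp measurable_norm)
    simp only [Function.comp_apply, LinearIsometryEquiv.norm_map] at h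
    rw [Measure.map_apply hLm hA, withDensity_apply _ (hLm hA), withDensity_apply _ hA, h]
  rw [← map_first_withDensity_norm hf, integral_map (by fun_prop)
    (Continuous.aestronglyMeasurable (by fun_prop)), fourierMeasure, ← hmap,
    integral_map L.continuous.aemeasurable (Continuous.aestronglyMeasurable (by fun_prop)), hmap]
  simp only [hL]

/-- `∫_{-t}^t e^{-iρa} da = 2 sin(ρt)/ρ`. -/
theorem integral_exp_neg_I_mul (ρ t : ℝ) :
    ∫ a in (-t)..t, Complex.exp (-(Complex.I * ((ρ * a : ℝ) : ℂ))) =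
      ((2 * t * Real.sinc (t * ρ) : ℝ) : ℂ) := by
  rcases eq_or_ne ρ 0 with rfl | hρ
  · simp; ring
  · have h := integral_exp_mul_complex (a := -t) (b := t) (c := -(Complex.I * ρ)) (by simp [hρ])
    have e : ∀ a : ℝ, -(Complex.I * ((ρ * a : ℝ) : ℂ)) = -(Complex.I * ρ) * a := by
      intro a; push_cast; ring
    simp only [e]
    rw [h]
    rcases eq_or_ne t 0 with rfl | ht
    · simp
    · rw [Real.sinc_of_ne_zero (by positivity)]
      have hρ' : (ρ : ℂ) ≠ 0 := by exact_mod_cast hρ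
      have ht' : (t : ℂ) ≠ 0 := by exact_mod_cast ht
      push_cast
      have h1 : -(Complex.I * ρ) * t = -(t * ρ * Complex.I) := by ring
      have h2 : -(Complex.I * ρ) * -t = t * ρ * Complex.I := by ring
      rw [h1, h2, Complex.sin]
      field_simp
      ring_nf
      simp only [Complex.I_sq]
      ring

/-- In dimension one the fibre left after splitting off the first coordinate is the one-point space
`E 0`. -/
theorem volume_E_zero : (volume : Measure (E 0)) = Measure.dirac 0 := by
  rw [← (PiLp.volume_preserving_toLp (Fin 0)).map_eq, Measure.volume_pi_eq_dirac 0]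
  rw [Measure.map_dirac' (by fun_prop)]; rfl

theorem indicator_ball_zero_apply {d : ℕ} {β : Type*} [Zero β] (R : ℝ) (f : E d → β) (x : E d) :
    (Metric.ball (0 : E d) R).indicator f x = if ‖x‖ < R then f x else 0 := by
  by_cases h : ‖x‖ < R
  · rw [Set.indicator_of_mem (by simpa using h), if_pos h]
  · rw [Set.indicator_of_notMem (by simpa using h), if_neg h]

/-! ### The wave equation in dimension one -/

theorem withDensity_indicator_ball_const (t c : ℝ) :
    volume.withDensity (fun a => if |a| < t then ENNReal.ofReal c else 0) =
      ENNReal.ofReal c • (volume : Measure ℝ).restrict (Set.Ioo (-t) t) := by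
  have h : (fun a : ℝ => if |a| < t then ENNReal.ofReal c else 0) =
      (Set.Ioo (-t) t).indicator fun _ => ENNReal.ofReal c := by
    ext a
    simp only [Set.indicator_apply, Set.mem_Ioo, ← abs_lt]
  rw [h, withDensity_indicator measurableSet_Ioo, withDensity_const]

theorem integral_exp_withDensity_ball_const {t c : ℝ} (ht : 0 ≤ t) (hc : 0 ≤ c) (ρ : ℝ) :
    ∫ a, Complex.exp (-(Complex.I * ((ρ * a : ℝ) : ℂ)))
      ∂(volume.withDensity (fun a => if |a| < t then ENNReal.ofReal c else 0)) =
      ((2 * c * t * Real.sinc (t * ρ) : ℝ) : ℂ) := by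
  rw [withDensity_indicator_ball_const, integral_smul_measure, ← integral_Ioc_eq_integral_Ioo,
    ← intervalIntegral.integral_of_le (by linarith), integral_exp_neg_I_mul,
    ENNReal.toReal_ofReal hc]
  rw [Complex.real_smul]
  push_cast; ring

theorem fourierMeasure_waveSolution_one {t : ℝ} (ht : 0 < t) (ξ : E 1) :
    fourierMeasure (waveSolution 1 t) ξ = ((t * Real.sinc (t * ‖ξ‖) : ℝ) : ℂ) := by
  have h : waveSolution 1 t = volume.withDensity fun x =>
      (fun r : ℝ => if r < t then ENNReal.ofReal (1 / 2) else 0) ‖x‖ := by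
    simp only [waveSolution]
    congr 1
    ext x
    exact indicator_ball_zero_apply _ _ _
  rw [h, fourierMeasure_withDensity_norm
    (Measurable.ite measurableSet_Iio measurable_const measurable_const)]
  have h2 : (fun a : ℝ => ∫⁻ y : E 0, (fun r : ℝ => if r < t then ENNReal.ofReal (1 / 2) else 0)
      (√(a ^ 2 + ‖y‖ ^ 2))) = fun a => if |a| < t then ENNReal.ofReal (1 / 2) else 0 := by
    ext a
    simp [volume_E_zero, Real.sqrt_sq_eq_abs]
  rw [h2, integral_exp_withDensity_ball_const ht.le (by norm_num)]
  push_cast; ring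

/-! ### The wave equation in dimension two -/

/-- The primitive is arcsin(b/c). The integrand blows up at ±c; its integrability comes for free
from being the nonnegative derivative of a function continuous on the closed interval. -/
theorem lintegral_ball_inv_sqrt {c : ℝ} (hc : 0 < c) :
    ∫⁻ b : ℝ, (if |b| < c then ENNReal.ofReal (1 / √(c ^ 2 - b ^ 2)) else 0) =
      ENNReal.ofReal Real.pi := by
  have hcont : ContinuousOn (fun b => Real.arcsin (b / c)) (Set.Icc (-c) c) := by fun_prop
  have hderiv : ∀ b ∈ Set.Ioo (-c) c,
      HasDerivAt (fun b => Real.arcsin (b / c)) (1 / √(c ^ 2 - b ^ 2)) b := by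
    intro b hb
    have h1 : b / c ≠ -1 := by
      rw [ne_eq, div_eq_iff hc.ne']; intro h; linarith [hb.1]
    have h2 : b / c ≠ 1 := by
      rw [ne_eq, div_eq_iff hc.ne']; intro h; linarith [hb.2]
    have h := (Real.hasDerivAt_arcsin h1 h2).comp b ((hasDerivAt_id b).div_const c)
    convert! h using 1
    have : 1 - (b / c) ^ 2 = (c ^ 2 - b ^ 2) / c ^ 2 := by field_simp
    simp only [this]
    rw [Real.sqrt_div' _ (by positivity), Real.sqrt_sq hc.le]
    field_simp
  have hpos : ∀ b ∈ Set.Ioo (-c) c, 0 ≤ 1 / √(c ^ 2 - b ^ 2) := fun b _ => by positivity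
  have hint := intervalIntegral.integrableOn_deriv_of_nonneg hcont hderiv hpos
  have hval := intervalIntegral.integral_eq_sub_of_hasDerivAt_of_le (by linarith) hcont hderiv
    ((intervalIntegrable_iff_integrableOn_Ioc_of_le (by linarith)).2 hint)
  have h1 : (fun b : ℝ => if |b| < c then ENNReal.ofReal (1 / √(c ^ 2 - b ^ 2)) else 0) =
      (Set.Ioo (-c) c).indicator fun b => ENNReal.ofReal (1 / √(c ^ 2 - b ^ 2)) := by
    ext b
    simp only [Set.indicator_apply, Set.mem_Ioo, ← abs_lt]
  rw [h1, lintegral_indicator measurableSet_Ioo,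
    ← ofReal_integral_eq_lintegral_ofReal (hint.mono_set Set.Ioo_subset_Ioc_self)
      (ae_of_all _ fun b => by positivity), ← integral_Ioc_eq_integral_Ioo,
    ← intervalIntegral.integral_of_le (by linarith), hval]
  congr 1
  rw [neg_div, div_self hc.ne', Real.arcsin_neg, Real.arcsin_one]
  ring

theorem fourierMeasure_waveSolution_two {t : ℝ} (ht : 0 < t) (ξ : E 2) :
    fourierMeasure (waveSolution 2 t) ξ = ((t * Real.sinc (t * ‖ξ‖) : ℝ) : ℂ) := by
  set f : ℝ → ENNReal := fun r =>
    if r < t then ENNReal.ofReal (1 / (2 * Real.pi) * (1 / √(t ^ 2 - r ^ 2))) else 0 with hf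
  have hfm : Measurable f :=
    Measurable.ite measurableSet_Iio (by fun_prop) measurable_const
  have h : waveSolution 2 t = volume.withDensity fun x => f ‖x‖ := by
    simp only [waveSolution]
    congr 1
    ext x
    exact indicator_ball_zero_apply _ _ _
  rw [h, fourierMeasure_withDensity_norm hfm]
  -- Descent: the marginal of the planar density on a line is the one-dimensional wave density (1/2)
  -- 1_{|a|<t}, so the transform is the same as for d = 1.
  have h2 : (fun a : ℝ => ∫⁻ y : E 1, f (√(a ^ 2 + ‖y‖ ^ 2))) =
      fun a => if |a| < t then ENNReal.ofReal (1 / 2) else 0 := by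
    ext a
    have hm : Measurable fun p : ℝ × E 0 => f (√(a ^ 2 + p.1 ^ 2)) := hfm.comp (by fun_prop)
    have e1 : ∫⁻ y : E 1, f (√(a ^ 2 + ‖y‖ ^ 2)) = ∫⁻ b : ℝ, f (√(a ^ 2 + b ^ 2)) := by
      calc ∫⁻ y : E 1, f (√(a ^ 2 + ‖y‖ ^ 2))
          = ∫⁻ y : E 1, (fun p : ℝ × E 0 => f (√(a ^ 2 + p.1 ^ 2))) (splitFirst 0 y) := by
            refine lintegral_congr fun y => ?_
            rw [norm_sq_splitFirst, Subsingleton.elim (splitFirst 0 y).2 0]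
            simp
        _ = _ := by
            rw [(measurePreserving_splitFirst 0).lintegral_comp hm, Measure.volume_eq_prod,
              lintegral_prod _ hm.aemeasurable]
            simp [volume_E_zero]
    rw [e1]
    split_ifs with ha
    · have hc : 0 < t ^ 2 - a ^ 2 := by
        have := sq_lt_sq' (abs_lt.1 ha).1 (abs_lt.1 ha).2
        linarith
      have e2 : ∀ b : ℝ, f (√(a ^ 2 + b ^ 2)) = ENNReal.ofReal (1 / (2 * Real.pi)) *
          (if |b| < √(t ^ 2 - a ^ 2) then
            ENNReal.ofReal (1 / √(√(t ^ 2 - a ^ 2) ^ 2 - b ^ 2)) else 0) := by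
        intro b
        have hiff : √(a ^ 2 + b ^ 2) < t ↔ |b| < √(t ^ 2 - a ^ 2) := by
          rw [Real.sqrt_lt' ht, Real.lt_sqrt (abs_nonneg b), sq_abs]
          constructor <;> intro h <;> linarith
        simp only [hf, hiff, Real.sq_sqrt hc.le, Real.sq_sqrt (show 0 ≤ a ^ 2 + b ^ 2 by positivity)]
        split_ifs
        · rw [← ENNReal.ofReal_mul (by positivity)]
          congr 4
          ring
        · simp
      simp only [e2]
      rw [lintegral_const_mul' _ _ ENNReal.ofReal_ne_top, lintegral_ball_inv_sqrt
        (Real.sqrt_pos.2 hc), ← ENNReal.ofReal_mul (by positivity)]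
      congr 1
      field_simp
    · have e3 : ∀ b : ℝ, f (√(a ^ 2 + b ^ 2)) = 0 := by
        intro b
        have : ¬ √(a ^ 2 + b ^ 2) < t := by
          rw [not_lt] at ha ⊢
          refine ha.trans ?_
          rw [← Real.sqrt_sq_eq_abs]
          exact Real.sqrt_le_sqrt (by nlinarith [sq_nonneg b])
        simp [hf, this]
      simp [e3]
  rw [h2, integral_exp_withDensity_ball_const ht.le (by norm_num)]
  push_cast; ring

/-! ### The wave equation in dimension three -/

/-- Polar coordinates on a ball of `ℝ^3`. -/
theorem integral_ball_polar (u : E 3) {R : ℝ} (hR : 0 < R) :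
    ∫ x in Metric.ball (0 : E 3) R, Complex.exp (-(Complex.I * ((inner ℝ u x : ℝ) : ℂ))) =
      ∫ r in (0 : ℝ)..R, (r ^ 2 : ℝ) • ∫ y : Metric.sphere (0 : E 3) 1,
        Complex.exp (-(Complex.I * ((r * inner ℝ u (y : E 3) : ℝ) : ℂ)))
          ∂(volume : Measure (E 3)).toSphere := by
  set F : E 3 → ℂ := (Metric.ball (0 : E 3) R).indicator
    fun x => Complex.exp (-(Complex.I * ((inner ℝ u x : ℝ) : ℂ))) with hF
  have hFi : Integrable F := by
    rw [hF, integrable_indicator_iff measurableSet_ball]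
    exact (Continuous.continuousOn (by fun_prop)).integrableOn_compact
      (isCompact_closedBall (0 : E 3) R) |>.mono_set Metric.ball_subset_closedBall
  have hdim : Module.finrank ℝ (E 3) - 1 = 2 := by simp
  have hmp := (volume : Measure (E 3)).measurePreserving_homeomorphUnitSphereProd
  rw [hdim] at hmp
  set G : Metric.sphere (0 : E 3) 1 × Set.Ioi (0 : ℝ) → ℂ := fun p => F ((p.2 : ℝ) • (p.1 : E 3))
    with hG
  have hcomp : ∀ x : ({0}ᶜ : Set (E 3)), G (homeomorphUnitSphereProd (E 3) x) = F x := by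
    intro x
    have := congrArg Subtype.val ((homeomorphUnitSphereProd (E 3)).symm_apply_apply x)
    rw [homeomorphUnitSphereProd_symm_apply_coe] at this
    rw [hG, ← this]
  have hGi : Integrable G ((volume : Measure (E 3)).toSphere.prod (Measure.volumeIoiPow 2)) := by
    rw [← hmp.integrable_comp_emb (Homeomorph.measurableEmbedding _)]
    have : G ∘ homeomorphUnitSphereProd (E 3) = F ∘ Subtype.val := funext hcomp
    rw [this]
    rw [← (MeasurableEmbedding.subtype_coe (measurableSet_singleton (0 : E 3)).compl
      ).integrable_map_iff, (MeasurableEmbedding.subtype_coe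
        (measurableSet_singleton (0 : E 3)).compl).map_comap]
    exact hFi.mono_measure Measure.restrict_le_self
  rw [← integral_indicator measurableSet_ball, ← hF]
  calc ∫ x, F x = ∫ x : ({0}ᶜ : Set (E 3)), F x ∂(Measure.comap Subtype.val volume) := by
        rw [integral_subtype_comap (measurableSet_singleton _).compl F,
          restrict_compl_singleton]
    _ = ∫ x : ({0}ᶜ : Set (E 3)), G (homeomorphUnitSphereProd (E 3) x)
          ∂(Measure.comap Subtype.val volume) := by simp only [hcomp]
    _ = ∫ p, G p ∂((volume : Measure (E 3)).toSphere.prod (Measure.volumeIoiPow 2)) :=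
        hmp.integral_comp (Homeomorph.measurableEmbedding _) G
    _ = ∫ r : Set.Ioi (0 : ℝ), ∫ y, G (y, r) ∂(volume : Measure (E 3)).toSphere
          ∂(Measure.volumeIoiPow 2) := integral_prod_symm _ hGi
    _ = ∫ r : Set.Ioi (0 : ℝ), (Set.Iio R).indicator (fun r : ℝ =>
          ∫ y : Metric.sphere (0 : E 3) 1,
          Complex.exp (-(Complex.I * ((r * inner ℝ u (y : E 3) : ℝ) : ℂ)))
          ∂(volume : Measure (E 3)).toSphere) r ∂(Measure.volumeIoiPow 2) := by
        refine integral_congr_ae (ae_of_all _ fun r => ?_)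
        have hr : (0 : ℝ) < r := r.2
        have hn : ∀ y : Metric.sphere (0 : E 3) 1, ‖(r : ℝ) • (y : E 3)‖ = r := by
          intro y
          rw [norm_smul, mem_sphere_zero_iff_norm.1 y.2, Real.norm_of_nonneg hr.le, mul_one]
        by_cases hrR : (r : ℝ) < R
        · simp only [hG, hF, indicator_ball_zero_apply, hn, Set.indicator_apply, hrR,
            Set.mem_Iio, if_true, inner_smul_right]
        · simp only [hG, hF, indicator_ball_zero_apply, hn, Set.indicator_apply, hrR,
            Set.mem_Iio, if_false, integral_zero]
    _ = ∫ r in Set.Ioi (0 : ℝ), (r ^ 2).toNNReal • (Set.Iio R).indicator (fun r : ℝ =>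
          ∫ y : Metric.sphere (0 : E 3) 1,
          Complex.exp (-(Complex.I * ((r * inner ℝ u (y : E 3) : ℝ) : ℂ)))
          ∂(volume : Measure (E 3)).toSphere) r := by
        simp only [Measure.volumeIoiPow, ENNReal.ofReal]
        rw [integral_withDensity_eq_integral_smul
          (measurable_subtype_coe.pow_const _).real_toNNReal,
          ← integral_subtype_comap measurableSet_Ioi]
    _ = ∫ r in Set.Ioi (0 : ℝ), (Set.Iio R).indicator (fun r : ℝ => (r ^ 2 : ℝ) •
          ∫ y : Metric.sphere (0 : E 3) 1,
          Complex.exp (-(Complex.I * ((r * inner ℝ u (y : E 3) : ℝ) : ℂ)))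
          ∂(volume : Measure (E 3)).toSphere) r := by
        refine integral_congr_ae (ae_of_all _ fun r => ?_)
        simp only [Set.indicator_apply, NNReal.smul_def, Real.coe_toNNReal _ (sq_nonneg r)]
        split_ifs <;> simp
    _ = _ := by
        rw [setIntegral_indicator measurableSet_Iio, Set.Ioi_inter_Iio,
          ← integral_Ioc_eq_integral_Ioo, ← intervalIntegral.integral_of_le hR.le]

/-- The marginal of the ball at height a is the area π(R² - a²) of a disc, which leaves a polynomial
times an exponential to integrate on [-R, R]. -/
theorem fourier_ball_three {u : E 3} (hu : ‖u‖ = 1) {R : ℝ} (hR : 0 < R) :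
    ∫ x in Metric.ball (0 : E 3) R, Complex.exp (-(Complex.I * ((inner ℝ u x : ℝ) : ℂ))) =
      ((4 * Real.pi * (Real.sin R - R * Real.cos R) : ℝ) : ℂ) := by
  have hball : (volume : Measure (E 3)).restrict (Metric.ball 0 R) =
      volume.withDensity fun x => (fun r : ℝ => if r < R then (1 : ENNReal) else 0) ‖x‖ := by
    rw [← withDensity_indicator_one measurableSet_ball]
    congr 1
    ext x
    exact indicator_ball_zero_apply _ _ _
  rw [hball]
  have h := fourierMeasure_withDensity_norm (n := 2)
    (f := fun r : ℝ => if r < R then (1 : ENNReal) else 0)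
    (Measurable.ite measurableSet_Iio measurable_const measurable_const) u
  rw [fourierMeasure] at h
  rw [h, hu]
  have h2 : (fun a : ℝ => ∫⁻ y : E 2, (fun r : ℝ => if r < R then (1 : ENNReal) else 0)
      (√(a ^ 2 + ‖y‖ ^ 2))) =
      (Set.Ioo (-R) R).indicator fun a => ENNReal.ofReal (Real.pi * (R ^ 2 - a ^ 2)) := by
    ext a
    by_cases ha : |a| < R
    · have hc : 0 < R ^ 2 - a ^ 2 := by
        have := sq_lt_sq' (abs_lt.1 ha).1 (abs_lt.1 ha).2
        linarith
      have e : (fun y : E 2 => (fun r : ℝ => if r < R then (1 : ENNReal) else 0)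
          (√(a ^ 2 + ‖y‖ ^ 2))) = (Metric.ball (0 : E 2) √(R ^ 2 - a ^ 2)).indicator 1 := by
        ext y
        have hiff : √(a ^ 2 + ‖y‖ ^ 2) < R ↔ ‖y‖ < √(R ^ 2 - a ^ 2) := by
          rw [Real.sqrt_lt' hR, Real.lt_sqrt (norm_nonneg y)]
          constructor <;> intro h <;> linarith
        rw [indicator_ball_zero_apply]
        simp only [hiff, Pi.one_apply]
      rw [e, lintegral_indicator_one measurableSet_ball, EuclideanSpace.volume_ball,
        Set.indicator_of_mem (by simpa [abs_lt] using ha)]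
      rw [← ENNReal.ofReal_pow (Real.sqrt_nonneg _), ← ENNReal.ofReal_mul (by positivity)]
      congr 1
      simp only [Fintype.card_fin, Real.sq_sqrt hc.le, Real.sq_sqrt Real.pi_pos.le]
      norm_num
      ring
    · rw [Set.indicator_of_notMem (by simpa [abs_lt] using ha)]
      have e3 : ∀ y : E 2, ¬ √(a ^ 2 + ‖y‖ ^ 2) < R := by
        intro y
        rw [not_lt] at ha ⊢
        refine ha.trans ?_
        rw [← Real.sqrt_sq_eq_abs]
        exact Real.sqrt_le_sqrt (by nlinarith [sq_nonneg ‖y‖])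
      simp [e3]
  rw [h2, withDensity_indicator measurableSet_Ioo,
    integral_withDensity_eq_integral_toReal_smul (by fun_prop) (by simp)]
  have h3 : ∫ a in Set.Ioo (-R) R, (ENNReal.ofReal (Real.pi * (R ^ 2 - a ^ 2))).toReal •
      Complex.exp (-(Complex.I * ((1 * a : ℝ) : ℂ))) =
      ∫ a in (-R)..R, (Real.pi : ℂ) * ((R : ℂ) ^ 2 - (a : ℂ) ^ 2) *
        Complex.exp (-(Complex.I * a)) := by
    rw [intervalIntegral.integral_of_le (by linarith), integral_Ioc_eq_integral_Ioo]
    refine setIntegral_congr_fun measurableSet_Ioo fun a ha => ?_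
    have : 0 ≤ R ^ 2 - a ^ 2 := by nlinarith [ha.1, ha.2]
    simp only [ENNReal.toReal_ofReal (mul_nonneg Real.pi_pos.le this), Complex.real_smul]
    push_cast
    simp
  rw [h3]
  have hI := Complex.I_sq
  -- This primitive results from integrating by parts twice.
  have hderiv : ∀ a : ℝ, HasDerivAt (fun a : ℝ => (Real.pi : ℂ) * (Complex.I * ((R : ℂ) ^ 2 -
      (a : ℂ) ^ 2) - 2 * a + 2 * Complex.I) * Complex.exp (-(Complex.I * a)))
      ((Real.pi : ℂ) * ((R : ℂ) ^ 2 - (a : ℂ) ^ 2) * Complex.exp (-(Complex.I * a))) a := by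
    intro a
    have hid : HasDerivAt (fun z : ℂ => z) 1 (a : ℂ) := hasDerivAt_id _
    have h1 : HasDerivAt (fun z : ℂ => (Real.pi : ℂ) * (Complex.I * ((R : ℂ) ^ 2 -
      z ^ 2) - 2 * z + 2 * Complex.I)) ((Real.pi : ℂ) * (Complex.I * (- (2 * a)) - 2)) (a : ℂ) := by
      have := ((((hid.pow 2).const_sub ((R : ℂ) ^ 2)).const_mul Complex.I).sub
        (hid.const_mul 2)).add_const (2 * Complex.I) |>.const_mul (Real.pi : ℂ)
      convert! this using 1
      simp
    have h2 : HasDerivAt (fun z : ℂ => Complex.exp (-(Complex.I * z)))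
        (Complex.exp (-(Complex.I * a)) * (-(Complex.I * 1))) (a : ℂ) :=
      ((hid.const_mul Complex.I).neg).cexp
    convert! (h1.mul h2).comp_ofReal using 1
    linear_combination ((Real.pi : ℂ) * ((R : ℂ) ^ 2 - (a : ℂ) ^ 2) + 2 * (Real.pi : ℂ)) *
      Complex.exp (-(Complex.I * a)) * hI
  rw [intervalIntegral.integral_eq_sub_of_hasDerivAt (fun a _ => hderiv a)
    (Continuous.intervalIntegrable (by fun_prop) _ _)]
  push_cast
  have e1 : Complex.exp (-(Complex.I * R)) = Complex.cos R - Complex.sin R * Complex.I := by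
    rw [show -(Complex.I * (R : ℂ)) = (-(R : ℂ)) * Complex.I by ring, Complex.exp_mul_I]
    simp [sub_eq_add_neg]
  have e2 : Complex.exp (-(Complex.I * -R)) = Complex.cos R + Complex.sin R * Complex.I := by
    rw [show -(Complex.I * -(R : ℂ)) = (R : ℂ) * Complex.I by ring, Complex.exp_mul_I]
  rw [e1, e2]
  linear_combination (-4 * (Real.pi : ℂ) * Complex.sin R) * hI

/-- The transform of the sphere is recovered by differentiating that of the ball in its radius:
polar coordinates give the derivative r²Φ(r), and the closed form gives 4π r sin r. -/
theorem fourier_unitSphere {u : E 3} (hu : ‖u‖ = 1) {r : ℝ} (hr : 0 < r) :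
    ∫ y : Metric.sphere (0 : E 3) 1,
        Complex.exp (-(Complex.I * ((r * inner ℝ u (y : E 3) : ℝ) : ℂ)))
          ∂(volume : Measure (E 3)).toSphere = ((4 * Real.pi * Real.sinc r : ℝ) : ℂ) := by
  set Φ : ℝ → ℂ := fun r => ∫ y : Metric.sphere (0 : E 3) 1,
        Complex.exp (-(Complex.I * ((r * inner ℝ u (y : E 3) : ℝ) : ℂ)))
          ∂(volume : Measure (E 3)).toSphere with hΦ
  have hcont : Continuous Φ := by
    refine continuous_of_dominated (bound := fun _ => 1) (fun r => ?_) (fun r => ?_) ?_ ?_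
    · exact Continuous.aestronglyMeasurable (by fun_prop)
    · refine ae_of_all _ fun y => le_of_eq ?_
      rw [Complex.norm_exp]
      simp
    · exact integrable_const _
    · exact ae_of_all _ fun y => by fun_prop
  have h1 : ∀ R : ℝ, 0 < R → ∫ s in (0 : ℝ)..R, (s ^ 2 : ℝ) • Φ s =
      ((4 * Real.pi * (Real.sin R - R * Real.cos R) : ℝ) : ℂ) := fun R hR => by
    rw [← fourier_ball_three hu hR, integral_ball_polar u hR]
  have hd1 : HasDerivAt (fun R => ∫ s in (0 : ℝ)..R, (s ^ 2 : ℝ) • Φ s) ((r ^ 2 : ℝ) • Φ r) r := by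
    have hc : Continuous fun s : ℝ => (s ^ 2 : ℝ) • Φ s := by fun_prop
    exact intervalIntegral.integral_hasDerivAt_right (hc.intervalIntegrable _ _)
      (hc.stronglyMeasurableAtFilter _ _) hc.continuousAt
  have hd2 : HasDerivAt (fun R : ℝ => ((4 * Real.pi * (Real.sin R - R * Real.cos R) : ℝ) : ℂ))
      ((4 * Real.pi * (r * Real.sin r) : ℝ) : ℂ) r := by
    have := ((Real.hasDerivAt_sin r).sub ((hasDerivAt_id r).mul (Real.hasDerivAt_cos r))).const_mul
      (4 * Real.pi)
    convert! this.ofReal_comp using 1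
    simp
  have heq : (fun R => ∫ s in (0 : ℝ)..R, (s ^ 2 : ℝ) • Φ s) =ᶠ[𝓝 r]
      fun R : ℝ => ((4 * Real.pi * (Real.sin R - R * Real.cos R) : ℝ) : ℂ) := by
    filter_upwards [lt_mem_nhds hr] with R hR using h1 R hR
  have := (hd1.congr_of_eventuallyEq heq.symm).unique hd2
  have hr' : (r : ℂ) ≠ 0 := by exact_mod_cast hr.ne'
  change Φ r = _
  rw [Complex.real_smul] at this
  rw [Real.sinc_of_ne_zero hr.ne']
  push_cast at this ⊢
  field_simp
  refine mul_left_cancel₀ hr' ?_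
  linear_combination this

theorem fourierMeasure_waveSolution_three {t : ℝ} (ht : 0 < t) (ξ : E 3) :
    fourierMeasure (waveSolution 3 t) ξ = ((t * Real.sinc (t * ‖ξ‖) : ℝ) : ℂ) := by
  have hπ : (Real.pi : ℂ) ≠ 0 := by exact_mod_cast Real.pi_pos.ne'
  have ht' : (t : ℂ) ≠ 0 := by exact_mod_cast ht.ne'
  rw [fourierMeasure, waveSolution, sphereMeasure, integral_smul_measure, integral_smul_measure,
    integral_map (Continuous.aemeasurable (by fun_prop))
      (Continuous.aestronglyMeasurable (by fun_prop)), ENNReal.toReal_ofReal (by positivity),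
    ENNReal.toReal_ofReal (by positivity)]
  -- At ξ = 0 there is no direction to normalise, and the value is the total mass of the unit
  -- sphere, obtained from Γ(5/2). Otherwise apply the unit sphere formula to u = ξ/‖ξ‖ and r =
  -- t‖ξ‖.
  rcases eq_or_ne ξ 0 with rfl | hξ
  · have hreal : (volume : Measure (E 3)).toSphere.real Set.univ = 4 * Real.pi := by
      rw [Measure.toSphere_real_apply_univ, Measure.real, EuclideanSpace.volume_ball]
      simp only [finrank_euclideanSpace, Fintype.card_fin, ENNReal.ofReal_one, one_pow, one_mul]
      have hG : Real.Gamma ((3 : ℕ) / 2 + 1) = 3 / 4 * √Real.pi := by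
        rw [Real.Gamma_add_one (by norm_num), show ((3 : ℕ) : ℝ) / 2 = 1 / 2 + 1 by norm_num,
          Real.Gamma_add_one (by norm_num), Real.Gamma_one_half_eq]
        ring
      have hs : 0 < √Real.pi := Real.sqrt_pos.2 Real.pi_pos
      have hs2 : √Real.pi ^ 2 = Real.pi := Real.sq_sqrt Real.pi_pos.le
      rw [hG, ENNReal.toReal_ofReal (by positivity)]
      rw [pow_succ, hs2]
      field_simp
      norm_num
    simp only [inner_zero_left, Complex.ofReal_zero, mul_zero, neg_zero, Complex.exp_zero,
      integral_const, hreal, norm_zero, Real.sinc_zero]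
    simp only [Complex.real_smul]
    push_cast
    field_simp
  · have hρ : 0 < ‖ξ‖ := norm_pos_iff.2 hξ
    have hu : ‖(‖ξ‖⁻¹ : ℝ) • ξ‖ = 1 := norm_smul_inv_norm hξ
    have h := fourier_unitSphere hu (mul_pos ht hρ)
    have e : ∀ y : Metric.sphere (0 : E 3) 1, (t * ‖ξ‖ * inner ℝ ((‖ξ‖⁻¹ : ℝ) • ξ) (y : E 3) : ℝ) =
        inner ℝ ξ (t • (y : E 3)) := by
      intro y
      rw [inner_smul_left, inner_smul_right]
      simp
      field_simp
    simp only [e] at h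
    rw [h]
    simp only [Complex.real_smul]
    push_cast
    field_simp

/-! ### The heat equation -/

theorem fourierMeasure_heatSolution {d : ℕ} {t : ℝ} (ht : 0 < t) (ξ : E d) :
    fourierMeasure (heatSolution d t) ξ = ((Real.exp (-(t * ‖ξ‖ ^ 2 / 2)) : ℝ) : ℂ) := by
  rw [fourierMeasure, heatSolution, integral_withDensity_eq_integral_toReal_smul (by fun_prop)
    (by simp)]
  have hb : 0 < ((1 / (2 * t) : ℝ) : ℂ).re := by
    rw [Complex.ofReal_re]; positivity
  have h := GaussianFourier.integral_cexp_neg_mul_sq_norm_add hb (-Complex.I) ξ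
  have e : ∀ x : E d, (ENNReal.ofReal (1 / (2 * Real.pi * t) ^ ((d : ℝ) / 2) *
      Real.exp (-‖x‖ ^ 2 / (2 * t)))).toReal •
      Complex.exp (-(Complex.I * ((inner ℝ ξ x : ℝ) : ℂ))) =
      ((1 / (2 * Real.pi * t) ^ ((d : ℝ) / 2) : ℝ) : ℂ) *
        Complex.exp (-((1 / (2 * t) : ℝ) : ℂ) * (‖x‖ : ℂ) ^ 2 +
          -Complex.I * ((inner ℝ ξ x : ℝ) : ℂ)) := by
    intro x
    rw [ENNReal.toReal_ofReal (by positivity), Complex.real_smul, Complex.exp_add]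
    push_cast
    rw [mul_assoc]
    congr 3
    · ring
    · ring
  simp only [e]
  rw [integral_const_mul, h, finrank_euclideanSpace, Fintype.card_fin]
  have hp : (Real.pi / ((1 / (2 * t) : ℝ) : ℂ)) ^ ((d : ℂ) / 2) =
      (((2 * Real.pi * t) ^ ((d : ℝ) / 2) : ℝ) : ℂ) := by
    rw [Complex.ofReal_cpow (by positivity)]
    push_cast
    congr 1
    field_simp
  rw [hp, ← mul_assoc, ← Complex.ofReal_mul, one_div_mul_cancel (by positivity)]
  have ht' : (t : ℂ) ≠ 0 := by exact_mod_cast ht.ne'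
  push_cast
  rw [one_mul]
  congr 1
  rw [neg_sq, Complex.I_sq]
  field_simp
  ring

/-! ### The symbol -/

/-- The Fourier transform of the fundamental solution at time `τ`, as a function of `‖ξ‖`. -/
noncomputable def Equation.symbol : Equation → ℝ → ℝ → ℝ
  | .wave, τ, r => τ * Real.sinc (τ * r)
  | .heat, τ, r => Real.exp (-(τ * r ^ 2 / 2))

theorem Equation.continuous_symbol (eq : Equation) :
    Continuous fun p : ℝ × ℝ => eq.symbol p.1 p.2 := by
  cases eq
  · exact continuous_fst.mul (Real.continuous_sinc.comp (by fun_prop))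
  · simp only [Equation.symbol]; fun_prop

theorem Equation.fourierMeasure_fundamentalSolution {eq : Equation} {d : ℕ}
    (hd : eq.AdmissibleDim d) {τ : ℝ} (hτ : 0 < τ) (ξ : E d) :
    fourierMeasure (eq.fundamentalSolution d τ) ξ = ((eq.symbol τ ‖ξ‖ : ℝ) : ℂ) := by
  cases eq
  · rcases hd with rfl | rfl | rfl
    · exact fourierMeasure_waveSolution_one hτ ξ
    · exact fourierMeasure_waveSolution_two hτ ξ
    · exact fourierMeasure_waveSolution_three hτ ξ
  · exact fourierMeasure_heatSolution hτ ξ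

/-- If the mass is infinite, the constant 1 is not integrable and its Bochner integral takes the
default value 0. A nonzero transform at the origin therefore certifies finiteness, with no separate
computation of the mass. -/
theorem isFiniteMeasure_of_fourierMeasure_zero_ne_zero {d : ℕ} {ν : Measure (E d)}
    (h : fourierMeasure ν 0 ≠ 0) : IsFiniteMeasure ν := by
  refine ⟨lt_top_iff_ne_top.2 fun htop => h ?_⟩
  simp [fourierMeasure, Measure.real, htop]

theorem Equation.isFiniteMeasure_fundamentalSolution {eq : Equation} {d : ℕ}
    (hd : eq.AdmissibleDim d) {τ : ℝ} (hτ : 0 < τ) :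
    IsFiniteMeasure (eq.fundamentalSolution d τ) := by
  refine isFiniteMeasure_of_fourierMeasure_zero_ne_zero ?_
  rw [eq.fourierMeasure_fundamentalSolution hd hτ]
  cases eq <;> simp [Equation.symbol, hτ.ne']

theorem Equation.isFiniteMeasure_kernel {eq : Equation} {d : ℕ}
    (hd : eq.AdmissibleDim d) (t : ℝ) (x : E d) (s : ℝ) : IsFiniteMeasure (eq.kernel d t x s) := by
  unfold Equation.kernel
  split_ifs with h
  · have := eq.isFiniteMeasure_fundamentalSolution hd (sub_pos.2 h)
    infer_instance
  · infer_instance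

/-- The Fourier transform in space of the integrand of the stochastic convolution. -/
noncomputable def Equation.kernelFourier (eq : Equation) {d : ℕ} (t : ℝ) (x : E d)
    (p : ℝ × E d) : ℂ :=
  if p.1 < t then Complex.exp (-(Complex.I * ((inner ℝ p.2 x : ℝ) : ℂ))) *
    ((eq.symbol (t - p.1) ‖p.2‖ : ℝ) : ℂ) else 0

theorem Equation.fourierMeasure_kernel {eq : Equation} {d : ℕ} (hd : eq.AdmissibleDim d)
    (t : ℝ) (x : E d) (s : ℝ) (ξ : E d) :
    fourierMeasure (eq.kernel d t x s) ξ = eq.kernelFourier t x (s, ξ) := by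
  unfold Equation.kernel Equation.kernelFourier
  split_ifs with h
  -- The reflection z ↦ x - z replaces ξ by -ξ and produces the phase; the symbol sees only the
  -- norm.
  · have h2 := eq.fourierMeasure_fundamentalSolution hd (sub_pos.2 h) (-ξ)
    rw [norm_neg] at h2
    simp only
    rw [← h2, fourierMeasure, fourierMeasure, integral_map (by fun_prop)
      (Continuous.aestronglyMeasurable (by fun_prop)), ← integral_const_mul]
    congr 1
    ext z
    rw [← Complex.exp_add]
    congr 1
    simp only [inner_sub_right, inner_neg_left]
    push_cast
    ring
  · simp [fourierMeasure]

theorem Equation.measurable_kernelFourier (eq : Equation) {d : ℕ} (t : ℝ) (x : E d) :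
    Measurable (eq.kernelFourier t x) := by
  unfold Equation.kernelFourier
  refine Measurable.ite (measurableSet_lt measurable_fst measurable_const) ?_ measurable_const
  have h := eq.continuous_symbol.comp (g := fun p : ℝ × ℝ => eq.symbol p.1 p.2)
    (f := fun p : ℝ × E d => (t - p.1, ‖p.2‖)) (by fun_prop)
  have h' : Continuous fun p : ℝ × E d => eq.symbol (t - p.1) ‖p.2‖ := h
  exact Continuous.measurable (by fun_prop)

/-! ### Dominated convergence in `L²` -/

theorem eLpNorm_two_sq {α F : Type*} [MeasurableSpace α] [NormedAddCommGroup F] (f : α → F)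
    (μ : Measure α) : eLpNorm f 2 μ ^ 2 = ∫⁻ x, ‖f x‖ₑ ^ 2 ∂μ := by
  have h := eLpNorm_nnreal_pow_eq_lintegral (f := f) (μ := μ) (p := 2) (by norm_num)
  simpa using h

theorem tendsto_eLpNorm_two_iff {α F ι : Type*} [MeasurableSpace α] [NormedAddCommGroup F]
    {f : ι → α → F} {μ : Measure α} {l : Filter ι} :
    Tendsto (fun n => eLpNorm (f n) 2 μ) l (𝓝 0) ↔
      Tendsto (fun n => ∫⁻ x, ‖f n x‖ₑ ^ 2 ∂μ) l (𝓝 0) := by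
  simp only [← eLpNorm_two_sq]
  constructor
  · intro h
    have := ((ENNReal.continuous_pow 2).tendsto 0).comp h
    simpa [Function.comp_def] using this
  · intro h
    have := ((ENNReal.continuous_rpow_const (y := (2⁻¹ : ℝ))).tendsto 0).comp h
    have e : ∀ x : ENNReal, (x ^ 2) ^ (2⁻¹ : ℝ) = x := fun x => by
      rw [← ENNReal.rpow_natCast, ← ENNReal.rpow_mul]; norm_num
    simpa [Function.comp_def, e] using this

theorem tendsto_eLpNorm_two_of_dominated {α F : Type*} [MeasurableSpace α] [NormedAddCommGroup F]
    {μ : Measure α} {u : ℕ → α → F} {f : α → F} {g : α → ℝ}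
    (hu : ∀ n, AEStronglyMeasurable (u n) μ) (hf : AEStronglyMeasurable f μ)
    (hg : eLpNorm g 2 μ ≠ ⊤) (hb : ∀ n, ∀ᵐ x ∂μ, ‖u n x‖ ≤ g x)
    (hlim : ∀ᵐ x ∂μ, Tendsto (fun n => u n x) atTop (𝓝 (f x))) :
    Tendsto (fun n => eLpNorm (fun x => u n x - f x) 2 μ) atTop (𝓝 0) := by
  rw [tendsto_eLpNorm_two_iff]
  have hfb : ∀ᵐ x ∂μ, ‖f x‖ ≤ g x := by
    filter_upwards [hlim, ae_all_iff.2 hb] with x hx hbx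
    exact le_of_tendsto hx.norm (Eventually.of_forall hbx)
  have hbound : ∀ n, (fun x => ‖u n x - f x‖ₑ ^ 2) ≤ᵐ[μ] fun x => 4 * ‖g x‖ₑ ^ 2 := by
    intro n
    filter_upwards [hfb, hb n] with x h1 h2
    have h3 : ‖u n x - f x‖ₑ ≤ 2 * ‖g x‖ₑ := by
      have h4 : ‖u n x‖ₑ ≤ ‖g x‖ₑ :=
        enorm_le_iff_norm_le.2 (h2.trans (le_abs_self _))
      have h5 : ‖f x‖ₑ ≤ ‖g x‖ₑ :=
        enorm_le_iff_norm_le.2 (h1.trans (le_abs_self _))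
      calc ‖u n x - f x‖ₑ ≤ ‖u n x‖ₑ + ‖f x‖ₑ := enorm_sub_le
        _ ≤ ‖g x‖ₑ + ‖g x‖ₑ := add_le_add h4 h5
        _ = _ := by ring
    calc ‖u n x - f x‖ₑ ^ 2 ≤ (2 * ‖g x‖ₑ) ^ 2 := by gcongr
      _ = _ := by ring
  have := tendsto_lintegral_of_dominated_convergence' (μ := μ)
    (F := fun n x => ‖u n x - f x‖ₑ ^ 2) (f := fun _ => 0)
    (fun x => 4 * ‖g x‖ₑ ^ 2) (fun n => ((hu n).sub hf).enorm.pow_const 2) hbound ?_ ?_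
  · simpa using this
  · rw [lintegral_const_mul' _ _ (by simp), ← eLpNorm_two_sq]
    exact ENNReal.mul_ne_top (by simp) (ENNReal.pow_ne_top hg)
  · filter_upwards [hlim] with x hx
    have h1 : Tendsto (fun n => u n x - f x) atTop (𝓝 0) := by
      simpa using hx.sub_const (f x)
    have h2 := h1.enorm
    have := ((ENNReal.continuous_pow 2).tendsto _).comp h2
    simpa [Function.comp_def] using this

/-! ### Decay of Fourier transforms -/

theorem norm_exp_neg_I_mul_ofReal (a : ℝ) : ‖Complex.exp (-(Complex.I * (a : ℂ)))‖ = 1 := by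
  rw [Complex.norm_exp]; simp

theorem norm_fourierMeasure_le {d : ℕ} (ν : Measure (E d)) (ξ : E d) :
    ‖fourierMeasure ν ξ‖ ≤ ν.real Set.univ := by
  refine (norm_integral_le_integral_norm _).trans ?_
  simp [norm_exp_neg_I_mul_ofReal]

/-- The Fourier transform of a Lipschitz function with compact support is `O(1/|ξ|)`, with
constants that only depend on the supremum, the Lipschitz constant and the support. -/
theorem exists_norm_fourierFun_sq_le (d : ℕ) (A L R : ℝ) : ∃ C : ℝ, 0 ≤ C ∧ ∀ f : E d → ℝ,
    Continuous f → (∀ x, |f x| ≤ A) → (∀ x y, ‖x - y‖ ≤ Real.pi → |f x - f y| ≤ L * ‖x - y‖) →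
    (∀ x, R < ‖x‖ → f x = 0) → ∀ ξ, ‖fourierFun f ξ‖ ^ 2 ≤ C / (1 + ‖ξ‖ ^ 2) := by
  set V : ℝ := (volume : Measure (E d)).real (Metric.closedBall 0 (R + Real.pi)) with hV
  have hV0 : 0 ≤ V := measureReal_nonneg
  refine ⟨2 * (A * V) ^ 2 + 2 * (L * Real.pi * V) ^ 2, by positivity,
    fun f hf hA hL hR ξ => ?_⟩
  have hA0 : 0 ≤ A := (abs_nonneg _).trans (hA 0)
  have hcs : HasCompactSupport f := HasCompactSupport.intro (isCompact_closedBall (0 : E d) R)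
    fun x hx => hR x (by simpa using hx)
  have hfi : Integrable fun x => Complex.exp (-(Complex.I * ((inner ℝ ξ x : ℝ) : ℂ))) *
      ((f x : ℝ) : ℂ) := by
    refine Continuous.integrable_of_hasCompactSupport (by fun_prop) ?_
    exact HasCompactSupport.mul_left (hcs.comp_left (g := fun r : ℝ => (r : ℂ)) (by simp))
  have hpi := Real.pi_pos
  -- The radius R + π also contains the support of the translates of f used below, by vectors of
  -- norm at most π.
  have hball : ∀ (g : E d → ℂ) (B : ℝ), (∀ x, ‖g x‖ ≤ B) → (∀ x, R + Real.pi < ‖x‖ → g x = 0) →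
      ‖∫ x, g x‖ ≤ B * V := by
    intro g B hB hg
    rw [← setIntegral_eq_integral_of_forall_compl_eq_zero (s := Metric.closedBall 0 (R + Real.pi))
      (fun x hx => hg x (by simpa using hx))]
    exact norm_setIntegral_le_of_norm_le_const measure_closedBall_lt_top (fun x _ => hB x)
  have h1 : ‖fourierFun f ξ‖ ≤ A * V := by
    refine hball _ _ (fun x => ?_) (fun x hx => ?_)
    · rw [norm_mul, norm_exp_neg_I_mul_ofReal, one_mul, Complex.norm_real]
      exact hA x
    · simp [hR x (by linarith)]
  rw [le_div_iff₀ (by positivity)]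
  rcases le_total ‖ξ‖ 1 with hξ | hξ
  · have h2 : ‖fourierFun f ξ‖ ^ 2 ≤ (A * V) ^ 2 := by gcongr
    have h3 : ‖fourierFun f ξ‖ ^ 2 * (1 + ‖ξ‖ ^ 2) ≤ (A * V) ^ 2 * (1 + 1 ^ 2) := by gcongr
    linarith [sq_nonneg (L * Real.pi * V)]
  · have hξ0 : 0 < ‖ξ‖ := by linarith
    -- With ⟨ξ, h⟩ = π, translation by h changes the sign of the transform. Hence twice the
    -- transform of f is that of f - f(· - h), which is small by the Lipschitz bound since ‖h‖ =
    -- π/‖ξ‖.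
    set h : E d := (Real.pi / ‖ξ‖ ^ 2) • ξ with hh
    have hin : inner ℝ ξ h = Real.pi := by
      rw [hh, inner_smul_right, real_inner_self_eq_norm_sq]
      field_simp
    have hnh : ‖h‖ = Real.pi / ‖ξ‖ := by
      rw [hh, norm_smul, Real.norm_of_nonneg (by positivity)]
      field_simp
    have hnh' : ‖h‖ ≤ Real.pi := by
      rw [hnh]; exact div_le_self hpi.le hξ
    have hshift : ∫ x, Complex.exp (-(Complex.I * ((inner ℝ ξ x : ℝ) : ℂ))) *
        ((f (x - h) : ℝ) : ℂ) = - fourierFun f ξ := by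
      rw [← integral_add_right_eq_self _ h, fourierFun, ← integral_neg]
      congr 1
      ext x
      rw [inner_add_right, hin, add_sub_cancel_right]
      push_cast
      rw [mul_add, neg_add, Complex.exp_add]
      have : Complex.exp (-(Complex.I * (Real.pi : ℂ))) = -1 := by
        rw [mul_comm, Complex.exp_neg, Complex.exp_pi_mul_I]; norm_num
      rw [this]; ring
    have hfi2 : Integrable fun x => Complex.exp (-(Complex.I * ((inner ℝ ξ x : ℝ) : ℂ))) *
        ((f (x - h) : ℝ) : ℂ) := by
      refine Continuous.integrable_of_hasCompactSupport (by fun_prop) ?_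
      refine HasCompactSupport.mul_left ?_
      exact (hcs.comp_homeomorph (Homeomorph.subRight h)).comp_left
        (g := fun r : ℝ => (r : ℂ)) (by simp)
    have h2 : ‖2 * fourierFun f ξ‖ ≤ (L * ‖h‖) * V := by
      have e : 2 * fourierFun f ξ = ∫ x, (Complex.exp (-(Complex.I * ((inner ℝ ξ x : ℝ) : ℂ))) *
          ((f x : ℝ) : ℂ) - Complex.exp (-(Complex.I * ((inner ℝ ξ x : ℝ) : ℂ))) *
        ((f (x - h) : ℝ) : ℂ)) := by
        rw [integral_sub hfi hfi2, hshift, fourierFun]; ring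
      rw [e]
      refine hball _ _ (fun x => ?_) (fun x hx => ?_)
      · rw [← mul_sub, norm_mul, norm_exp_neg_I_mul_ofReal, one_mul, ← Complex.ofReal_sub,
          Complex.norm_real]
        have := hL x (x - h) (by simpa using hnh')
        simpa using this
      · rw [hR x (by linarith), hR (x - h) ?_]
        · simp
        · have := norm_sub_norm_le x h
          linarith
    rw [norm_mul, Complex.norm_ofNat, hnh] at h2
    have h3 : ‖fourierFun f ξ‖ * ‖ξ‖ ≤ L * Real.pi * V := by
      have h4 : 2 * ‖fourierFun f ξ‖ * ‖ξ‖ ≤ L * (Real.pi / ‖ξ‖) * V * ‖ξ‖ := by gcongr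
      have h5 : L * (Real.pi / ‖ξ‖) * V * ‖ξ‖ = L * Real.pi * V := by field_simp
      nlinarith [mul_nonneg (norm_nonneg (fourierFun f ξ)) hξ0.le]
    have h4 : (‖fourierFun f ξ‖ * ‖ξ‖) ^ 2 ≤ (L * Real.pi * V) ^ 2 := by gcongr
    have h5 : ‖fourierFun f ξ‖ ^ 2 ≤ (A * V) ^ 2 := by gcongr
    have h6 : ‖fourierFun f ξ‖ ^ 2 * (1 + ‖ξ‖ ^ 2) =
        ‖fourierFun f ξ‖ ^ 2 + (‖fourierFun f ξ‖ * ‖ξ‖) ^ 2 := by ring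
    linarith [sq_nonneg (A * V), sq_nonneg (L * Real.pi * V)]

/-! ### Test functions in `L²(dt ⊗ μ)` -/

theorem TestFunction.continuous_slice {d : ℕ} (φ : TestFunction d) (t : ℝ) :
    Continuous fun x => φ.toFun (t, x) := by
  rcases lt_or_ge t 0 with ht | ht
  · simp only [φ.eq_zero t _ ht]; exact continuous_const
  · exact φ.smooth.continuousOn.comp_continuous (by fun_prop) fun x => ⟨ht, Set.mem_univ _⟩

theorem TestFunction.exists_bound {d : ℕ} (φ : TestFunction d) : ∃ R : ℝ, 0 ≤ R ∧
    ∀ t x, R < |t| ∨ R < ‖x‖ → φ.toFun (t, x) = 0 := by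
  obtain ⟨R, hR⟩ := φ.compact_support.isCompact.isBounded.subset_closedBall (0 : ℝ × E d)
  refine ⟨max R 0, le_max_right _ _, fun t x h => ?_⟩
  by_contra hne
  have h1 := hR (subset_tsupport _ (Function.mem_support.2 hne))
  rw [mem_closedBall_zero_iff, Prod.norm_def, Real.norm_eq_abs] at h1
  have h2 : |t| ≤ R := (le_max_left _ _).trans h1
  have h3 : ‖x‖ ≤ R := (le_max_right _ _).trans h1
  rcases h with h | h
  · exact absurd (h2.trans (le_max_left R 0)) (not_le.2 h)
  · exact absurd (h3.trans (le_max_left R 0)) (not_le.2 h)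

/-- The extension by zero may jump at t = 0, so measurability is obtained by gluing two continuous
pieces. -/
theorem TestFunction.measurable {d : ℕ} (φ : TestFunction d) : Measurable φ.toFun := by
  classical
  have h : φ.toFun = (Set.Ici (0 : ℝ) ×ˢ (Set.univ : Set (E d))).piecewise φ.toFun
      (fun _ => 0) := by
    ext ⟨t, x⟩
    by_cases ht : 0 ≤ t
    · rw [Set.piecewise_eq_of_mem]; exact ⟨ht, Set.mem_univ _⟩
    · rw [Set.piecewise_eq_of_notMem _ _ _ (by simpa using ht), φ.eq_zero t x (not_le.1 ht)]
  rw [h]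
  exact φ.smooth.continuousOn.measurable_piecewise continuousOn_const
    (measurableSet_Ici.prod MeasurableSet.univ)

theorem TestFunction.measurable_fourier {d : ℕ} (φ : TestFunction d) :
    Measurable fun p : ℝ × E d => φ.fourier p.1 p.2 := by
  refine StronglyMeasurable.measurable ?_
  unfold TestFunction.fourier fourierFun
  refine StronglyMeasurable.integral_prod_right' (ν := (volume : Measure (E d)))
    (f := fun z : (ℝ × E d) × E d => Complex.exp (-(Complex.I * ((inner ℝ z.1.2 z.2 : ℝ) : ℂ))) *
      ((φ.toFun (z.1.1, z.2) : ℝ) : ℂ)) ?_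
  refine Measurable.stronglyMeasurable ?_
  have h1 : Continuous fun z : (ℝ × E d) × E d =>
    Complex.exp (-(Complex.I * ((inner ℝ z.1.2 z.2 : ℝ) : ℂ))) := by fun_prop
  exact h1.measurable.mul (Complex.measurable_ofReal.comp (φ.measurable.comp (by fun_prop)))

/-- Smoothness in space uniformly in time gives the weight 1/(1+|ξ|²), which is what makes the
transform square integrable for dt ⊗ μ. -/
theorem TestFunction.exists_norm_fourier_sq_le {d : ℕ} (φ : TestFunction d) : ∃ C M : ℝ,
    0 ≤ C ∧ ∀ t ξ, ‖φ.fourier t ξ‖ ^ 2 ≤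
      (Set.Icc 0 M).indicator (fun _ => C / (1 + ‖ξ‖ ^ 2)) t := by
  obtain ⟨R, hR0, hR⟩ := φ.exists_bound
  -- The radius R + 2π suffices for pairs at distance at most π: if one point is within R + π, both
  -- lie in this ball; otherwise both lie outside the support.
  obtain ⟨L, hL⟩ := (φ.smooth.mono (Set.prod_mono (Set.Icc_subset_Ici_self : Set.Icc (0 : ℝ) R ⊆ _)
    (Set.subset_univ (Metric.closedBall (0 : E d) (R + 2 * Real.pi))))).exists_lipschitzOnWith (by simp)
    ((convex_Icc 0 R).prod (convex_closedBall (0 : E d) (R + 2 * Real.pi)))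
    (isCompact_Icc.prod (isCompact_closedBall _ _))
  obtain ⟨A, hA⟩ := (isCompact_Icc.prod (isCompact_closedBall (0 : E d) R)).exists_bound_of_continuousOn
    (φ.smooth.continuousOn.mono (Set.prod_mono (Set.Icc_subset_Ici_self : Set.Icc (0 : ℝ) R ⊆ _) (Set.subset_univ _)))
  obtain ⟨C, hC0, hC⟩ := exists_norm_fourierFun_sq_le d (max A 0) L R
  have hpi := Real.pi_pos
  refine ⟨C, R, hC0, fun t ξ => ?_⟩
  by_cases ht : t ∈ Set.Icc 0 R
  · rw [Set.indicator_of_mem ht]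
    refine hC _ (φ.continuous_slice t) (fun x => ?_) (fun x y hxy => ?_)
      (fun x hx => hR t x (Or.inr hx)) ξ
    · by_cases hx : ‖x‖ ≤ R
      · exact (hA (t, x) ⟨ht, by simpa using hx⟩).trans (le_max_left _ _)
      · rw [hR t x (Or.inr (not_le.1 hx))]; simp
    · have hn1 := norm_sub_norm_le x y
      have hn2 := norm_sub_norm_le y x
      rw [norm_sub_rev] at hn2
      by_cases hx : ‖x‖ ≤ R + Real.pi
      · have := hL.dist_le_mul (t, x) ⟨ht, by simp; linarith⟩ (t, y) ⟨ht, by simp; linarith⟩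
        rw [Real.dist_eq, Prod.dist_eq, dist_self, dist_eq_norm] at this
        simpa using this
      · rw [hR t x (Or.inr (by linarith)), hR t y (Or.inr (by linarith))]
        simp only [sub_self, abs_zero]
        positivity
  · rw [Set.indicator_of_notMem ht]
    have : ∀ x, φ.toFun (t, x) = 0 := by
      intro x
      rcases lt_or_ge t 0 with h | h
      · exact φ.eq_zero t x h
      · refine hR t x (Or.inl ?_)
        rw [abs_of_nonneg h]
        by_contra h'
        exact ht ⟨h, not_lt.1 h'⟩
    simp [TestFunction.fourier, fourierFun, this]

/-- Markov's inequality, the weight being bounded below on compact sets. This makes μ s-finite, so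
that Tonelli's theorem applies to dt ⊗ μ. -/
theorem isFiniteMeasureOnCompacts_of_lintegral_ne_top {d : ℕ} {μ : Measure (E d)}
    (hμ : ∫⁻ ξ, ENNReal.ofReal (1 / (1 + ‖ξ‖ ^ 2)) ∂μ ≠ ⊤) : IsFiniteMeasureOnCompacts μ := by
  refine ⟨fun K hK => ?_⟩
  obtain ⟨R, hR⟩ := hK.isBounded.subset_closedBall (0 : E d)
  have hsub : K ⊆ {ξ | ENNReal.ofReal (1 / (1 + R ^ 2)) ≤ ENNReal.ofReal (1 / (1 + ‖ξ‖ ^ 2))} := by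
    intro ξ hξ
    have : ‖ξ‖ ≤ R := by simpa using hR hξ
    simp only [Set.mem_ofPred_eq]
    gcongr
  refine (measure_mono hsub).trans_lt ?_
  refine (meas_ge_le_lintegral_div (by fun_prop) (by simp; positivity)
    ENNReal.ofReal_ne_top).trans_lt ?_
  exact ENNReal.div_lt_top hμ (by simp; positivity)

/-- The measure `dt ⊗ μ` on `[0,∞) × ℝ^d`. -/
noncomputable def noiseMeasure {d : ℕ} (μ : Measure (E d)) : Measure (ℝ × E d) :=
  (volume.restrict (Set.Ici 0)).prod μ

theorem ae_noiseMeasure_nonneg {d : ℕ} (μ : Measure (E d)) [SFinite μ] :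
    ∀ᵐ p ∂(noiseMeasure μ), 0 ≤ p.1 := by
  have h : ∀ᵐ t ∂((volume : Measure ℝ).restrict (Set.Ici 0)), 0 ≤ t :=
    ae_restrict_mem measurableSet_Ici
  exact Measure.quasiMeasurePreserving_fst.ae h

theorem lintegral_noiseMeasure {d : ℕ} (μ : Measure (E d)) [SFinite μ] {f : ℝ × E d → ENNReal}
    (hf : Measurable f) :
    ∫⁻ p, f p ∂(noiseMeasure μ) = ∫⁻ t in Set.Ici (0 : ℝ), ∫⁻ ξ, f (t, ξ) ∂μ :=
  lintegral_prod _ hf.aemeasurable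

theorem eLpNorm_noiseMeasure_ne_top {d : ℕ} {μ : Measure (E d)} [SFinite μ]
    (hμ : ∫⁻ ξ, ENNReal.ofReal (1 / (1 + ‖ξ‖ ^ 2)) ∂μ ≠ ⊤) {F : Type*} [NormedAddCommGroup F]
    {h : ℝ × E d → F} {C a b : ℝ} (hC : 0 ≤ C)
    (hb : ∀ p, ‖h p‖ ^ 2 ≤ (Set.Icc a b).indicator (fun _ => C / (1 + ‖p.2‖ ^ 2)) p.1) :
    eLpNorm h 2 (noiseMeasure μ) ≠ ⊤ := by
  have : ∫⁻ p, ‖h p‖ₑ ^ 2 ∂(noiseMeasure μ) ≤ ∫⁻ p : ℝ × E d, (Set.Icc a b).indicator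
      (fun _ => ENNReal.ofReal C) p.1 * ENNReal.ofReal (1 / (1 + ‖p.2‖ ^ 2)) ∂(noiseMeasure μ) := by
    refine lintegral_mono fun p => ?_
    have h1 : ‖h p‖ₑ ^ 2 = ENNReal.ofReal (‖h p‖ ^ 2) := by
      rw [← ofReal_norm, ENNReal.ofReal_pow (norm_nonneg _)]
    rw [h1]
    refine (ENNReal.ofReal_le_ofReal (hb p)).trans ?_
    by_cases hp : p.1 ∈ Set.Icc a b
    · simp only [Set.indicator_of_mem hp]
      rw [← ENNReal.ofReal_mul hC, mul_one_div]
    · simp [Set.indicator_of_notMem hp]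
  have h2 : ∫⁻ p : ℝ × E d, (Set.Icc a b).indicator
      (fun _ => ENNReal.ofReal C) p.1 * ENNReal.ofReal (1 / (1 + ‖p.2‖ ^ 2)) ∂(noiseMeasure μ) ≠ ⊤ := by
    rw [noiseMeasure, lintegral_prod_mul
      (f := (Set.Icc a b).indicator fun _ => ENNReal.ofReal C)
      (g := fun ξ : E d => ENNReal.ofReal (1 / (1 + ‖ξ‖ ^ 2))) ((measurable_const.indicator measurableSet_Icc).aemeasurable) (by fun_prop)]
    refine ENNReal.mul_ne_top ?_ hμ
    rw [lintegral_indicator measurableSet_Icc, setLIntegral_const]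
    refine ENNReal.mul_ne_top ENNReal.ofReal_ne_top ?_
    exact ((Measure.restrict_apply_le _ _).trans_lt (by simp)).ne
  have h3 : eLpNorm h 2 (noiseMeasure μ) ^ 2 ≠ ⊤ := by
    rw [eLpNorm_two_sq]; exact ne_top_of_le_ne_top h2 this
  intro htop
  rw [htop] at h3
  exact h3 (by simp)

theorem TestFunction.memLp_fourier {d : ℕ} (φ : TestFunction d) {μ : Measure (E d)} [SFinite μ]
    (hμ : ∫⁻ ξ, ENNReal.ofReal (1 / (1 + ‖ξ‖ ^ 2)) ∂μ ≠ ⊤) :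
    MemLp (fun p : ℝ × E d => φ.fourier p.1 p.2) 2 (noiseMeasure μ) := by
  obtain ⟨C, M, hC, h⟩ := φ.exists_norm_fourier_sq_le
  exact ⟨φ.measurable_fourier.aestronglyMeasurable,
    (eLpNorm_noiseMeasure_ne_top hμ hC fun p => h p.1 p.2).lt_top⟩

theorem noiseDistSq_eq_eLpNorm_sq {eq : Equation} {d : ℕ} (hd : eq.AdmissibleDim d)
    (μ : Measure (E d)) [SFinite μ] (φ : TestFunction d) (t : ℝ) (x : E d) :
    noiseDistSq μ φ (eq.kernel d t x) =
      eLpNorm (fun p => φ.fourier p.1 p.2 - eq.kernelFourier t x p) 2 (noiseMeasure μ) ^ 2 := by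
  rw [eLpNorm_two_sq, lintegral_noiseMeasure, noiseDistSq]
  · simp only [eq.fourierMeasure_kernel hd]
  · exact (φ.measurable_fourier.sub (eq.measurable_kernelFourier t x)).enorm.pow_const 2

/-! ### Operations on test functions -/

/-- The sum of two test functions. -/
def TestFunction.add {d : ℕ} (φ ψ : TestFunction d) : TestFunction d where
  toFun p := φ.toFun p + ψ.toFun p
  smooth := φ.smooth.add ψ.smooth
  compact_support := φ.compact_support.add ψ.compact_support
  eq_zero t x ht := by rw [φ.eq_zero t x ht, ψ.eq_zero t x ht, add_zero]

theorem integrable_exp_mul_of_hasCompactSupport {d : ℕ} {f : E d → ℝ} (hf : Continuous f)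
    (hc : HasCompactSupport f) (ξ : E d) :
    Integrable fun x => Complex.exp (-(Complex.I * ((inner ℝ ξ x : ℝ) : ℂ))) *
      ((f x : ℝ) : ℂ) := by
  refine Continuous.integrable_of_hasCompactSupport (by fun_prop) ?_
  exact HasCompactSupport.mul_left (hc.comp_left (g := fun r : ℝ => (r : ℂ)) (by simp))

theorem TestFunction.hasCompactSupport_slice {d : ℕ} (φ : TestFunction d) (t : ℝ) :
    HasCompactSupport fun x => φ.toFun (t, x) := by
  obtain ⟨R, -, hR⟩ := φ.exists_bound
  exact HasCompactSupport.intro (isCompact_closedBall (0 : E d) R)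
    fun x hx => hR t x (Or.inr (by simpa using hx))

theorem TestFunction.fourier_add {d : ℕ} (φ ψ : TestFunction d) (t : ℝ) (ξ : E d) :
    (φ.add ψ).fourier t ξ = φ.fourier t ξ + ψ.fourier t ξ := by
  have h1 := integrable_exp_mul_of_hasCompactSupport (φ.continuous_slice t)
    (φ.hasCompactSupport_slice t) ξ
  have h2 := integrable_exp_mul_of_hasCompactSupport (ψ.continuous_slice t)
    (ψ.hasCompactSupport_slice t) ξ
  simp only [TestFunction.fourier, fourierFun, TestFunction.add]
  rw [← integral_add h1 h2]
  congr 1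
  ext x
  push_cast
  ring

/-- The test function `(t, x) ↦ χ(t) ψ(x)`. -/
noncomputable def TestFunction.tensor {d : ℕ} {χ : ℝ → ℝ} {ψ : E d → ℝ}
    (hχ : ContDiff ℝ ((⊤ : ℕ∞) : WithTop ℕ∞) χ) (hχc : HasCompactSupport χ)
    (hψ : ContDiff ℝ ((⊤ : ℕ∞) : WithTop ℕ∞) ψ) (hψc : HasCompactSupport ψ) :
    TestFunction d where
  toFun p := if p.1 < 0 then 0 else χ p.1 * ψ p.2
  smooth := by
    refine ContDiffOn.congr (f := fun p : ℝ × E d => χ p.1 * ψ p.2)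
      (((hχ.comp contDiff_fst).mul (hψ.comp contDiff_snd)).contDiffOn) fun p hp => ?_
    rw [if_neg (not_lt.2 hp.1)]
  compact_support := by
    refine HasCompactSupport.intro (hχc.isCompact.prod hψc.isCompact) fun p hp => ?_
    split_ifs with h
    · rfl
    · rw [Set.mem_prod, not_and_or] at hp
      rcases hp with hp | hp
      · rw [image_eq_zero_of_notMem_tsupport hp, zero_mul]
      · rw [image_eq_zero_of_notMem_tsupport hp, mul_zero]
  eq_zero t x ht := by simp [ht]

theorem TestFunction.fourier_tensor {d : ℕ} {χ : ℝ → ℝ} {ψ : E d → ℝ}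
    (hχ : ContDiff ℝ ((⊤ : ℕ∞) : WithTop ℕ∞) χ) (hχc : HasCompactSupport χ)
    (hψ : ContDiff ℝ ((⊤ : ℕ∞) : WithTop ℕ∞) ψ) (hψc : HasCompactSupport ψ)
    {t : ℝ} (ht : 0 ≤ t) (ξ : E d) :
    (TestFunction.tensor hχ hχc hψ hψc).fourier t ξ = χ t * fourierFun ψ ξ := by
  simp only [TestFunction.fourier, fourierFun, TestFunction.tensor, not_lt.2 ht, if_false]
  rw [← integral_const_mul]
  congr 1
  ext x
  push_cast
  ring

/-! ### Integrands in the Hilbert space of the noise -/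

/-- `h` lies in the closure of the Fourier transforms of test functions in `L²(dt ⊗ μ)`. -/
def Approximable {d : ℕ} (μ : Measure (E d)) (h : ℝ × E d → ℂ) : Prop :=
  ∀ ε : ENNReal, 0 < ε → ∃ φ : TestFunction d,
    eLpNorm (fun p => φ.fourier p.1 p.2 - h p) 2 (noiseMeasure μ) ≤ ε

theorem Approximable.of_tendsto {d : ℕ} {μ : Measure (E d)} {h : ℝ × E d → ℂ}
    {u : ℕ → ℝ × E d → ℂ} (hu : ∀ n, Approximable μ (u n))
    (hum : ∀ n, AEStronglyMeasurable (u n) (noiseMeasure μ))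
    (hm : AEStronglyMeasurable h (noiseMeasure μ))
    (hlim : Tendsto (fun n => eLpNorm (fun p => u n p - h p) 2 (noiseMeasure μ)) atTop (𝓝 0)) :
    Approximable μ h := by
  intro ε hε
  have hε2 : 0 < ε / 2 := ENNReal.half_pos hε.ne'
  obtain ⟨n, hn⟩ := (hlim.eventually_le_const hε2).exists
  obtain ⟨φ, hφ⟩ := hu n (ε / 2) hε2
  refine ⟨φ, ?_⟩
  have e : (fun p : ℝ × E d => φ.fourier p.1 p.2 - h p) =
      (fun p => φ.fourier p.1 p.2 - u n p) + fun p => u n p - h p := by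
    ext p; simp
  rw [e]
  refine (eLpNorm_add_le (φ.measurable_fourier.aestronglyMeasurable.sub (hum n))
    ((hum n).sub hm) (by norm_num)).trans ?_
  exact (add_le_add hφ hn).trans (ENNReal.add_halves ε).le

theorem Approximable.add {d : ℕ} {μ : Measure (E d)} {h k : ℝ × E d → ℂ}
    (hh : Approximable μ h) (hk : Approximable μ k)
    (hhm : AEStronglyMeasurable h (noiseMeasure μ)) (hkm : AEStronglyMeasurable k (noiseMeasure μ)) :
    Approximable μ fun p => h p + k p := by
  intro ε hε
  have hε2 : 0 < ε / 2 := ENNReal.half_pos hε.ne'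
  obtain ⟨φ, hφ⟩ := hh (ε / 2) hε2
  obtain ⟨ψ, hψ⟩ := hk (ε / 2) hε2
  refine ⟨φ.add ψ, ?_⟩
  have e : (fun p : ℝ × E d => (φ.add ψ).fourier p.1 p.2 - (h p + k p)) =
      (fun p => φ.fourier p.1 p.2 - h p) + fun p => ψ.fourier p.1 p.2 - k p := by
    ext p; simp only [TestFunction.fourier_add, Pi.add_apply]; ring
  rw [e]
  refine (eLpNorm_add_le (φ.measurable_fourier.aestronglyMeasurable.sub hhm)
    (ψ.measurable_fourier.aestronglyMeasurable.sub hkm) (by norm_num)).trans ?_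
  exact (add_le_add hφ hψ).trans (ENNReal.add_halves ε).le

theorem approximable_zero {d : ℕ} (μ : Measure (E d)) [SFinite μ] :
    Approximable μ fun _ => (0 : ℂ) := by
  intro ε _
  refine ⟨TestFunction.tensor (χ := fun _ => 0) (ψ := fun _ => 0) contDiff_const
    HasCompactSupport.zero contDiff_const HasCompactSupport.zero, ?_⟩
  have : ∀ p : ℝ × E d, (TestFunction.tensor (χ := fun _ => 0) (ψ := fun _ : E d => 0)
      contDiff_const HasCompactSupport.zero contDiff_const HasCompactSupport.zero).fourier p.1 p.2
        = 0 := by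
    intro p
    simp [TestFunction.fourier, TestFunction.tensor, fourierFun]
  simp [this]

theorem approximable_sum {d : ℕ} {μ : Measure (E d)} [SFinite μ] {ι : Type*} (s : Finset ι)
    {h : ι → ℝ × E d → ℂ} (hh : ∀ i ∈ s, Approximable μ (h i))
    (hm : ∀ i ∈ s, Measurable (h i)) : Approximable μ fun p => ∑ i ∈ s, h i p := by
  classical
  induction s using Finset.induction_on with
  | empty => simpa using approximable_zero μ
  | insert i s hi ih =>
    simp only [Finset.sum_insert hi]
    refine (hh i (Finset.mem_insert_self i s)).add (ih (fun j hj => hh j (Finset.mem_insert_of_mem hj))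
      fun j hj => hm j (Finset.mem_insert_of_mem hj))
      (hm i (Finset.mem_insert_self i s)).aestronglyMeasurable ?_
    exact (Finset.measurable_fun_sum s fun j hj =>
      hm j (Finset.mem_insert_of_mem hj)).aestronglyMeasurable

/-! ### Mollification of measures -/

/-- The convolution of a measure with a function. -/
noncomputable def mollify {d : ℕ} (ν : Measure (E d)) (ρ : E d → ℝ) (x : E d) : ℝ :=
  ∫ z, ρ (x - z) ∂ν

/-- This is the convolution of the constant 1 with ρ, taken with respect to ν instead of Lebesgue
measure; all derivatives fall on ρ. -/
theorem contDiff_mollify {d : ℕ} (ν : Measure (E d)) [IsFiniteMeasure ν] {ρ : E d → ℝ}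
    (hρ : ContDiff ℝ ((⊤ : ℕ∞) : WithTop ℕ∞) ρ) (hρc : HasCompactSupport ρ) :
    ContDiff ℝ ((⊤ : ℕ∞) : WithTop ℕ∞) (mollify ν ρ) := by
  have h := hρc.contDiff_convolution_right (ContinuousLinearMap.lsmul ℝ ℝ)
    (f := fun _ : E d => (1 : ℝ)) (μ := ν) (integrable_const 1).locallyIntegrable hρ
  convert! h using 1
  ext x
  simp [mollify, convolution]

theorem hasCompactSupport_mollify_restrict {d : ℕ} (ν : Measure (E d)) {ρ : E d → ℝ}
    (hρc : HasCompactSupport ρ) (R : ℝ) :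
    HasCompactSupport (mollify (ν.restrict (Metric.closedBall 0 R)) ρ) := by
  obtain ⟨S, hS⟩ := hρc.isCompact.isBounded.subset_closedBall (0 : E d)
  refine HasCompactSupport.intro (isCompact_closedBall (0 : E d) (R + S)) fun x hx => ?_
  rw [mollify, ← integral_zero (α := E d) (G := ℝ) (μ := ν.restrict (Metric.closedBall 0 R))]
  refine setIntegral_congr_fun measurableSet_closedBall fun z hz => ?_
  refine image_eq_zero_of_notMem_tsupport fun hmem => hx ?_
  have h1 := hS hmem
  rw [mem_closedBall_zero_iff] at *
  calc ‖x‖ = ‖z + (x - z)‖ := by simp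
    _ ≤ ‖z‖ + ‖x - z‖ := norm_add_le _ _
    _ ≤ R + S := by gcongr

theorem fourierFun_mollify {d : ℕ} (ν : Measure (E d)) [IsFiniteMeasure ν] {ρ : E d → ℝ}
    (hρ : Continuous ρ) (hρc : HasCompactSupport ρ) (ξ : E d) :
    fourierFun (mollify ν ρ) ξ = fourierMeasure ν ξ * fourierFun ρ ξ := by
  have hi := integrable_exp_mul_of_hasCompactSupport hρ hρc ξ
  have hcont : Continuous fun p : E d × E d =>
      Complex.exp (-(Complex.I * ((inner ℝ ξ p.1 : ℝ) : ℂ))) * ((ρ (p.1 - p.2) : ℝ) : ℂ) := by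
    fun_prop
  have hint : Integrable (fun p : E d × E d =>
      Complex.exp (-(Complex.I * ((inner ℝ ξ p.1 : ℝ) : ℂ))) * ((ρ (p.1 - p.2) : ℝ) : ℂ))
      ((volume : Measure (E d)).prod ν) := by
    rw [integrable_prod_iff' hcont.aestronglyMeasurable]
    constructor
    · refine ae_of_all _ fun z => ?_
      exact integrable_exp_mul_of_hasCompactSupport (f := fun x => ρ (x - z)) (by fun_prop)
        (hρc.comp_homeomorph (Homeomorph.subRight z)) ξ
    · have : ∀ z : E d, ∫ x : E d, ‖Complex.exp (-(Complex.I * ((inner ℝ ξ x : ℝ) : ℂ))) *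
          ((ρ (x - z) : ℝ) : ℂ)‖ = ∫ x, ‖ρ x‖ := by
        intro z
        simp only [norm_mul, norm_exp_neg_I_mul_ofReal, one_mul, Complex.norm_real]
        exact integral_sub_right_eq_self (fun x => ‖ρ x‖) z
      simp only [this]
      exact integrable_const _
  calc fourierFun (mollify ν ρ) ξ
      = ∫ x : E d, ∫ z, Complex.exp (-(Complex.I * ((inner ℝ ξ x : ℝ) : ℂ))) *
          ((ρ (x - z) : ℝ) : ℂ) ∂ν := by
        simp only [fourierFun, mollify]
        congr 1
        ext x
        rw [integral_const_mul, integral_complex_ofReal]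
    _ = ∫ z, (∫ x : E d, Complex.exp (-(Complex.I * ((inner ℝ ξ x : ℝ) : ℂ))) *
          ((ρ (x - z) : ℝ) : ℂ)) ∂ν := integral_integral_swap hint
    _ = ∫ z, Complex.exp (-(Complex.I * ((inner ℝ ξ z : ℝ) : ℂ))) * fourierFun ρ ξ ∂ν := by
        congr 1
        ext z
        rw [← integral_add_right_eq_self _ z, fourierFun, ← integral_const_mul]
        congr 1
        ext x
        rw [inner_add_right, add_sub_cancel_right, ← mul_assoc, ← Complex.exp_add]
        push_cast
        congr 2
        ring
    _ = _ := by rw [integral_mul_const, fourierMeasure]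

theorem continuous_fourierMeasure {d : ℕ} (ν : Measure (E d)) [IsFiniteMeasure ν] :
    Continuous (fourierMeasure ν) := by
  refine continuous_of_dominated (bound := fun _ => 1) (fun ξ => ?_) (fun ξ => ?_)
    (integrable_const _) ?_
  · exact Continuous.aestronglyMeasurable (by fun_prop)
  · exact ae_of_all _ fun x => (norm_exp_neg_I_mul_ofReal _).le
  · exact ae_of_all _ fun x => by fun_prop

theorem measurable_fourierFun {d : ℕ} {f : E d → ℝ} (hf : Continuous f) :
    Measurable (fourierFun f) := by
  refine StronglyMeasurable.measurable ?_
  unfold fourierFun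
  refine StronglyMeasurable.integral_prod_right' (ν := (volume : Measure (E d)))
    (f := fun z : E d × E d => Complex.exp (-(Complex.I * ((inner ℝ z.1 z.2 : ℝ) : ℂ))) *
      ((f z.2 : ℝ) : ℂ)) ?_
  exact Continuous.stronglyMeasurable (by fun_prop)

theorem exists_norm_fourierFun_sq_le_of_contDiff {d : ℕ} {ρ : E d → ℝ}
    (hρ : ContDiff ℝ ((⊤ : ℕ∞) : WithTop ℕ∞) ρ) (hρc : HasCompactSupport ρ) :
    ∃ C : ℝ, 0 ≤ C ∧ ∀ ξ, ‖fourierFun ρ ξ‖ ^ 2 ≤ C / (1 + ‖ξ‖ ^ 2) := by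
  obtain ⟨A, hA⟩ := hρc.exists_bound_of_continuous hρ.continuous
  obtain ⟨L, hL⟩ := ContDiff.lipschitzWith_of_hasCompactSupport hρc hρ (by simp)
  obtain ⟨S, hS⟩ := hρc.isCompact.isBounded.subset_closedBall (0 : E d)
  obtain ⟨C, hC0, hC⟩ := exists_norm_fourierFun_sq_le d A L S
  refine ⟨C, hC0, hC ρ hρ.continuous hA (fun x y _ => ?_) fun x hx => ?_⟩
  · have := hL.dist_le_mul x y
    rwa [Real.dist_eq, dist_eq_norm] at this
  · refine image_eq_zero_of_notMem_tsupport fun h => ?_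
    have := hS h
    rw [mem_closedBall_zero_iff] at this
    linarith

/-- Smooth approximations of the indicator function of `[a, b)`. -/
noncomputable def smoothIndicator (a b : ℝ) (n : ℕ) (s : ℝ) : ℝ :=
  Real.smoothTransition (n * (s - a) + 1) * Real.smoothTransition (n * (b - s))

theorem contDiff_smoothIndicator (a b : ℝ) (n : ℕ) :
    ContDiff ℝ ((⊤ : ℕ∞) : WithTop ℕ∞) (smoothIndicator a b n) :=
  (Real.smoothTransition.contDiff.comp (by fun_prop)).mul
    (Real.smoothTransition.contDiff.comp (by fun_prop))

theorem smoothIndicator_nonneg (a b : ℝ) (n : ℕ) (s : ℝ) : 0 ≤ smoothIndicator a b n s :=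
  mul_nonneg (Real.smoothTransition.nonneg _) (Real.smoothTransition.nonneg _)

/-- The window [a-1, b] does not depend on n: it gives the compact support and the domination in the
limit. -/
theorem smoothIndicator_le (a b : ℝ) (n : ℕ) (s : ℝ) :
    smoothIndicator a b (n + 1) s ≤ (Set.Icc (a - 1) b).indicator (fun _ => 1) s := by
  have hn : (0 : ℝ) < (n + 1 : ℕ) := by positivity
  unfold smoothIndicator
  by_cases hs : s ∈ Set.Icc (a - 1) b
  · rw [Set.indicator_of_mem hs]
    exact mul_le_one₀ (Real.smoothTransition.le_one _) (Real.smoothTransition.nonneg _)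
      (Real.smoothTransition.le_one _)
  · rw [Set.indicator_of_notMem hs]
    rw [Set.mem_Icc, not_and_or, not_le, not_le] at hs
    rcases hs with h | h
    · rw [Real.smoothTransition.zero_of_nonpos, zero_mul]
      have : (1 : ℝ) ≤ (n + 1 : ℕ) := by push_cast; linarith [(Nat.cast_nonneg n : (0 : ℝ) ≤ n)]
      nlinarith
    · rw [Real.smoothTransition.zero_of_nonpos (x := _ * (b - s)), mul_zero]
      nlinarith

theorem hasCompactSupport_smoothIndicator (a b : ℝ) (n : ℕ) :
    HasCompactSupport (smoothIndicator a b (n + 1)) := by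
  refine HasCompactSupport.intro (isCompact_Icc (a := a - 1) (b := b)) fun s hs => ?_
  have h := smoothIndicator_le a b n s
  rw [Set.indicator_of_notMem hs] at h
  exact le_antisymm h (smoothIndicator_nonneg _ _ _ _)

/-- The `+ 1` in the first factor makes it equal to 1 from s = a onwards, while the second factor
vanishes from s = b onwards; hence convergence holds at every point to the half-open indicator. -/
theorem tendsto_smoothIndicator (a b s : ℝ) :
    Tendsto (fun n => smoothIndicator a b n s) atTop
      (𝓝 ((Set.Ico a b).indicator (fun _ => 1) s)) := by
  have key : ∀ c : ℝ, 0 < c → ∀ e : ℝ, ∀ᶠ n : ℕ in atTop, e ≤ n * c := fun c hc e =>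
    (tendsto_natCast_atTop_atTop.atTop_mul_const hc).eventually_ge_atTop e
  refine tendsto_const_nhds.congr' ?_
  by_cases hs : s ∈ Set.Ico a b
  · rw [Set.indicator_of_mem hs]
    filter_upwards [key (b - s) (by linarith [hs.2]) 1] with n hn
    rw [smoothIndicator, Real.smoothTransition.one_of_one_le,
      Real.smoothTransition.one_of_one_le hn, one_mul]
    have : 0 ≤ (n : ℝ) * (s - a) := mul_nonneg (Nat.cast_nonneg n) (by linarith [hs.1])
    linarith
  · rw [Set.indicator_of_notMem hs]
    rw [Set.mem_Ico, not_and_or, not_le, not_lt] at hs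
    rcases hs with h | h
    · filter_upwards [key (a - s) (by linarith) 1] with n hn
      rw [smoothIndicator, Real.smoothTransition.zero_of_nonpos, zero_mul]
      linarith
    · refine Eventually.of_forall fun n => ?_
      change (0 : ℝ) = Real.smoothTransition (n * (s - a) + 1) *
        Real.smoothTransition (n * (b - s))
      rw [Real.smoothTransition.zero_of_nonpos (x := n * (b - s)), mul_zero]
      exact mul_nonpos_of_nonneg_of_nonpos (Nat.cast_nonneg n) (by linarith)

theorem tendsto_fourierMeasure_restrict {d : ℕ} (ν : Measure (E d)) [IsFiniteMeasure ν]
    (ξ : E d) : Tendsto (fun n : ℕ =>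
      fourierMeasure (ν.restrict (Metric.closedBall 0 (n : ℝ))) ξ) atTop
      (𝓝 (fourierMeasure ν ξ)) := by
  have hU : (⋃ n : ℕ, Metric.closedBall (0 : E d) (n : ℝ)) = Set.univ :=
    Metric.iUnion_closedBall_nat 0
  have h := tendsto_setIntegral_of_monotone (μ := ν)
    (f := fun x => Complex.exp (-(Complex.I * ((inner ℝ ξ x : ℝ) : ℂ))))
    (s := fun n : ℕ => Metric.closedBall (0 : E d) (n : ℝ)) (fun n => measurableSet_closedBall)
    (fun m n hmn => Metric.closedBall_subset_closedBall (by exact_mod_cast hmn)) ?_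
  · rw [hU, Measure.restrict_univ] at h
    exact h
  · rw [hU]
    refine Integrable.integrableOn ?_
    exact Integrable.of_bound (Continuous.aestronglyMeasurable (by fun_prop)) 1
      (ae_of_all _ fun x => (norm_exp_neg_I_mul_ofReal _).le)

/-- The building block: a measure ν frozen on a time interval and smoothed by ρ. Restricting ν to
balls of radius n makes the mollification compactly supported, and smoothing the time indicator
gives test functions. The decay of the transform of ρ dominates them all. -/
theorem approximable_indicator_fourierMeasure_mul {d : ℕ} {μ : Measure (E d)} [SFinite μ]
    (hμ : ∫⁻ ξ, ENNReal.ofReal (1 / (1 + ‖ξ‖ ^ 2)) ∂μ ≠ ⊤) (ν : Measure (E d)) [IsFiniteMeasure ν]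
    {ρ : E d → ℝ} (hρ : ContDiff ℝ ((⊤ : ℕ∞) : WithTop ℕ∞) ρ) (hρc : HasCompactSupport ρ)
    (a b : ℝ) : Approximable μ fun p => (((Set.Ico a b).indicator (fun _ => 1) p.1 : ℝ) : ℂ) *
      (fourierMeasure ν p.2 * fourierFun ρ p.2) := by
  obtain ⟨C, hC0, hC⟩ := exists_norm_fourierFun_sq_le_of_contDiff hρ hρc
  set φ : ℕ → TestFunction d := fun n => TestFunction.tensor
    (contDiff_smoothIndicator a b (n + 1)) (hasCompactSupport_smoothIndicator a b n)
    (contDiff_mollify (ν.restrict (Metric.closedBall 0 (n : ℝ))) hρ hρc)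
    (hasCompactSupport_mollify_restrict ν hρc n) with hφ
  have hφF : ∀ n, ∀ p : ℝ × E d, 0 ≤ p.1 → (φ n).fourier p.1 p.2 =
      smoothIndicator a b (n + 1) p.1 * (fourierMeasure (ν.restrict (Metric.closedBall 0 (n : ℝ))) p.2
        * fourierFun ρ p.2) := by
    intro n p hp
    rw [hφ, TestFunction.fourier_tensor _ _ _ _ hp, fourierFun_mollify _ hρ.continuous hρc]
  have hlim := tendsto_eLpNorm_two_of_dominated (μ := noiseMeasure μ)
    (u := fun n p => (φ n).fourier p.1 p.2)
    (f := fun p => (((Set.Ico a b).indicator (fun _ => 1) p.1 : ℝ) : ℂ) *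
      (fourierMeasure ν p.2 * fourierFun ρ p.2))
    (g := fun p => (Set.Icc (a - 1) b).indicator (fun _ => 1) p.1 *
      (ν.real Set.univ * ‖fourierFun ρ p.2‖))
    (fun n => (φ n).measurable_fourier.aestronglyMeasurable) ?_ ?_ ?_ ?_
  · intro ε hε
    obtain ⟨n, hn⟩ := (hlim.eventually_le_const hε).exists
    exact ⟨φ n, hn⟩
  · refine Measurable.aestronglyMeasurable ?_
    have h1 := (continuous_fourierMeasure ν).measurable
    have h2 := measurable_fourierFun hρ.continuous
    have h3 : Measurable ((Set.Ico a b).indicator fun _ => (1 : ℝ)) :=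
      measurable_const.indicator measurableSet_Ico
    fun_prop
  · refine eLpNorm_noiseMeasure_ne_top hμ (C := ν.real Set.univ ^ 2 * C) (a := a - 1) (b := b)
      (by positivity) fun p => ?_
    by_cases hp : p.1 ∈ Set.Icc (a - 1) b
    · simp only [Set.indicator_of_mem hp, one_mul, norm_mul, norm_norm, mul_pow]
      rw [mul_div_assoc, Real.norm_of_nonneg measureReal_nonneg]
      exact mul_le_mul_of_nonneg_left (hC p.2) (by positivity)
    · simp [Set.indicator_of_notMem hp]
  · intro n
    filter_upwards [ae_noiseMeasure_nonneg μ] with p hp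
    rw [hφF n p hp, norm_mul, norm_mul, Complex.norm_real,
      Real.norm_of_nonneg (smoothIndicator_nonneg _ _ _ _)]
    refine mul_le_mul (smoothIndicator_le a b n p.1) ?_ (by positivity)
      (Set.indicator_nonneg (fun _ _ => zero_le_one) _)
    gcongr
    exact (norm_fourierMeasure_le _ _).trans
      (ENNReal.toReal_mono (measure_ne_top _ _) (Measure.restrict_apply_le _ _))
  · filter_upwards [ae_noiseMeasure_nonneg μ] with p hp
    simp only [fun n => hφF n p hp]
    refine Tendsto.mul ?_ ((tendsto_fourierMeasure_restrict ν p.2).mul_const _)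
    exact (Complex.continuous_ofReal.tendsto _).comp
      ((tendsto_smoothIndicator a b p.1).comp (tendsto_add_atTop_nat 1))


/-! ### The stochastic convolution kernel is approximable -/

theorem Equation.abs_symbol_le (eq : Equation) {τ T r : ℝ} (hτ : 0 ≤ τ) (hT : τ ≤ T) :
    |eq.symbol τ r| ≤ T + 1 := by
  cases eq
  · simp only [Equation.symbol, abs_mul, abs_of_nonneg hτ]
    have := Real.abs_sinc_le_one (τ * r)
    nlinarith [abs_nonneg (Real.sinc (τ * r))]
  · simp only [Equation.symbol, Real.abs_exp]
    have : Real.exp (-(τ * r ^ 2 / 2)) ≤ 1 := by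
      rw [Real.exp_le_one_iff, neg_nonpos]; positivity
    linarith

theorem Equation.norm_kernelFourier (eq : Equation) {d : ℕ} (t : ℝ) (x : E d) (p : ℝ × E d) :
    ‖eq.kernelFourier t x p‖ = if p.1 < t then |eq.symbol (t - p.1) ‖p.2‖| else 0 := by
  unfold Equation.kernelFourier
  split_ifs
  · rw [norm_mul, norm_exp_neg_I_mul_ofReal, one_mul, Complex.norm_real, Real.norm_eq_abs]
  · simp

/-- Only a right limit is available: at s = t the heat kernel jumps from 1 in modulus to 0. This is
why the time grid below is sampled at right end points. -/
theorem Equation.tendsto_kernelFourier (eq : Equation) {d : ℕ} (t : ℝ) (x : E d)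
    (s : ℝ) (ξ : E d) : Tendsto (fun r => eq.kernelFourier t x (r, ξ)) (𝓝[≥] s)
      (𝓝 (eq.kernelFourier t x (s, ξ))) := by
  rcases lt_or_ge s t with h | h
  · refine (ContinuousAt.tendsto ?_).mono_left nhdsWithin_le_nhds
    have hs := eq.continuous_symbol.comp (g := fun p : ℝ × ℝ => eq.symbol p.1 p.2)
      (f := fun r : ℝ => (t - r, ‖ξ‖)) (by fun_prop)
    have hs' : Continuous fun r : ℝ => eq.symbol (t - r) ‖ξ‖ := hs
    have hc : ContinuousAt (fun r : ℝ => Complex.exp (-(Complex.I * ((inner ℝ ξ x : ℝ) : ℂ))) *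
      ((eq.symbol (t - r) ‖ξ‖ : ℝ) : ℂ)) s :=
      (continuous_const.mul (Complex.continuous_ofReal.comp hs')).continuousAt
    refine hc.congr ?_
    filter_upwards [gt_mem_nhds h] with r hr
    simp [Equation.kernelFourier, hr]
  · refine tendsto_const_nhds.congr' ?_
    filter_upwards [self_mem_nhdsWithin] with r hr
    have hr' : s ≤ r := hr
    simp [Equation.kernelFourier, not_lt.2 h, not_lt.2 (h.trans hr')]

/-- The right end point of the interval of the grid `ℕ / (n + 1)` that contains `s`. -/
noncomputable def gridSucc (n : ℕ) (s : ℝ) : ℝ := (⌊s * (n + 1)⌋₊ + 1) / (n + 1)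

theorem lt_gridSucc (n : ℕ) (s : ℝ) : s < gridSucc n s := by
  have hn : (0 : ℝ) < n + 1 := by positivity
  rw [gridSucc, lt_div_iff₀ hn]
  exact Nat.lt_floor_add_one _

theorem gridSucc_le (n : ℕ) {s : ℝ} (hs : 0 ≤ s) : gridSucc n s ≤ s + 1 / (n + 1) := by
  have hn : (0 : ℝ) < n + 1 := by positivity
  rw [gridSucc, add_div]
  gcongr
  rw [div_le_iff₀ hn]
  exact Nat.floor_le (by positivity)

theorem tendsto_gridSucc {s : ℝ} (hs : 0 ≤ s) :
    Tendsto (fun n => gridSucc n s) atTop (𝓝[≥] s) := by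
  refine tendsto_nhdsWithin_iff.2 ⟨?_, Eventually.of_forall fun n => (lt_gridSucc n s).le⟩
  refine tendsto_of_tendsto_of_tendsto_of_le_of_le tendsto_const_nhds ?_
    (fun n => (lt_gridSucc n s).le) fun n => gridSucc_le n hs
  simpa using tendsto_const_nhds.add (tendsto_one_div_add_atTop_nhds_zero_nat (𝕜 := ℝ))

/-- Exactly one cell of the grid contains s. Finitely many cells suffice because c vanishes from t
onwards. -/
theorem sum_indicator_grid (n : ℕ) {t s : ℝ} (hs : 0 ≤ s) {c : ℝ → ℂ}
    (hc : ∀ r, t ≤ r → c r = 0) :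
    ∑ j ∈ Finset.range ⌈t * (n + 1)⌉₊, (((Set.Ico ((j : ℝ) / (n + 1)) ((j + 1 : ℝ) / (n + 1))).indicator
      (fun _ => 1) s : ℝ) : ℂ) * c ((j + 1 : ℝ) / (n + 1)) = c (gridSucc n s) := by
  have hn : (0 : ℝ) < n + 1 := by positivity
  have hmem : ∀ j : ℕ, s ∈ Set.Ico ((j : ℝ) / (n + 1)) ((j + 1 : ℝ) / (n + 1)) ↔
      j = ⌊s * (n + 1)⌋₊ := by
    intro j
    rw [Set.mem_Ico, div_le_iff₀ hn, lt_div_iff₀ hn, eq_comm,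
      Nat.floor_eq_iff (by positivity)]
  have hterm : ∀ j : ℕ, (((Set.Ico ((j : ℝ) / (n + 1)) ((j + 1 : ℝ) / (n + 1))).indicator
      (fun _ => 1) s : ℝ) : ℂ) * c ((j + 1 : ℝ) / (n + 1)) =
      if j = ⌊s * (n + 1)⌋₊ then c (gridSucc n s) else 0 := by
    intro j
    split_ifs with h
    · rw [Set.indicator_of_mem ((hmem j).2 h), h]
      simp [gridSucc]
    · rw [Set.indicator_of_notMem (fun h' => h ((hmem j).1 h'))]
      simp
  simp only [hterm, Finset.sum_ite_eq', Finset.mem_range]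
  split_ifs with h
  · rfl
  · refine (hc _ ?_).symm
    rw [not_lt] at h
    rw [gridSucc, le_div_iff₀ hn]
    have h1 : t * (n + 1) ≤ (⌈t * (n + 1)⌉₊ : ℝ) := Nat.le_ceil _
    have h2 : (⌈t * (n + 1)⌉₊ : ℝ) ≤ (⌊s * (n + 1)⌋₊ : ℝ) := by exact_mod_cast h
    linarith

/-- In each time cell the kernel is frozen at the right end point, which is a finite measure and so
falls under the previous case. The symbol is bounded, so the transform of ρ provides a dominating
function uniform in the grid. -/
theorem approximable_kernelFourier_mul {eq : Equation} {d : ℕ} (hd : eq.AdmissibleDim d)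
    {μ : Measure (E d)} [SFinite μ]
    (hμ : ∫⁻ ξ, ENNReal.ofReal (1 / (1 + ‖ξ‖ ^ 2)) ∂μ ≠ ⊤)
    {ρ : E d → ℝ} (hρ : ContDiff ℝ ((⊤ : ℕ∞) : WithTop ℕ∞) ρ) (hρc : HasCompactSupport ρ)
    (t : ℝ) (x : E d) :
    Approximable μ fun p => eq.kernelFourier t x p * fourierFun ρ p.2 := by
  obtain ⟨C, hC0, hC⟩ := exists_norm_fourierFun_sq_le_of_contDiff hρ hρc
  have hρm := measurable_fourierFun hρ.continuous
  set u : ℕ → ℝ × E d → ℂ := fun n p => ∑ j ∈ Finset.range ⌈t * (n + 1)⌉₊,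
    (((Set.Ico ((j : ℝ) / (n + 1)) ((j + 1 : ℝ) / (n + 1))).indicator (fun _ => 1) p.1 : ℝ) : ℂ) *
      (fourierMeasure (eq.kernel d t x ((j + 1 : ℝ) / (n + 1))) p.2 * fourierFun ρ p.2) with hu
  have hfin := fun s => eq.isFiniteMeasure_kernel hd t x s
  have hterm : ∀ (n j : ℕ), Measurable fun p : ℝ × E d =>
    (((Set.Ico ((j : ℝ) / (n + 1)) ((j + 1 : ℝ) / (n + 1))).indicator (fun _ => 1) p.1 : ℝ) : ℂ) *
      (fourierMeasure (eq.kernel d t x ((j + 1 : ℝ) / (n + 1))) p.2 * fourierFun ρ p.2) := by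
    intro n j
    have h1 := (continuous_fourierMeasure (eq.kernel d t x ((j + 1 : ℝ) / (n + 1)))).measurable
    have h3 : Measurable ((Set.Ico ((j : ℝ) / (n + 1)) ((j + 1 : ℝ) / (n + 1))).indicator
      fun _ => (1 : ℝ)) := measurable_const.indicator measurableSet_Ico
    fun_prop
  have huval : ∀ n, ∀ p : ℝ × E d, 0 ≤ p.1 →
      u n p = eq.kernelFourier t x (gridSucc n p.1, p.2) * fourierFun ρ p.2 := by
    intro n p hp
    rw [← sum_indicator_grid (t := t) n hp (c := fun r => eq.kernelFourier t x (r, p.2) *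
      fourierFun ρ p.2)]
    · simp only [hu, eq.fourierMeasure_kernel hd]
    · intro r hr
      simp [Equation.kernelFourier, not_lt.2 hr]
  have hum : ∀ n, AEStronglyMeasurable (u n) (noiseMeasure μ) := fun n =>
    (Finset.measurable_fun_sum _ fun j _ => hterm n j).aestronglyMeasurable
  have hm : AEStronglyMeasurable (fun p : ℝ × E d => eq.kernelFourier t x p * fourierFun ρ p.2)
      (noiseMeasure μ) :=
    ((eq.measurable_kernelFourier t x).mul (hρm.comp measurable_snd)).aestronglyMeasurable
  refine Approximable.of_tendsto (u := u)
    (fun n => approximable_sum _ (fun j _ => approximable_indicator_fourierMeasure_mul hμ _ hρ hρc _ _)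
      fun j _ => hterm n j) hum hm ?_
  refine tendsto_eLpNorm_two_of_dominated
    (g := fun p => (Set.Icc 0 t).indicator (fun _ => 1) p.1 * ((|t| + 1) * ‖fourierFun ρ p.2‖))
    hum hm ?_ ?_ ?_
  · refine eLpNorm_noiseMeasure_ne_top hμ (C := (|t| + 1) ^ 2 * C) (a := 0) (b := t)
      (by positivity) fun p => ?_
    by_cases hp : p.1 ∈ Set.Icc 0 t
    · simp only [Set.indicator_of_mem hp, one_mul, norm_mul, norm_norm, mul_pow]
      rw [mul_div_assoc, Real.norm_of_nonneg (by positivity)]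
      exact mul_le_mul_of_nonneg_left (hC p.2) (by positivity)
    · simp [Set.indicator_of_notMem hp]
  · intro n
    filter_upwards [ae_noiseMeasure_nonneg μ] with p hp
    rw [huval n p hp, norm_mul, eq.norm_kernelFourier, ← mul_assoc]
    refine mul_le_mul_of_nonneg_right ?_ (norm_nonneg _)
    have hlt := lt_gridSucc n p.1
    simp only
    split_ifs with h
    · rw [Set.indicator_of_mem (show p.1 ∈ Set.Icc 0 t from ⟨hp, (hlt.trans h).le⟩), one_mul]
      exact eq.abs_symbol_le (by linarith) (by linarith [le_abs_self t])
    · exact mul_nonneg (Set.indicator_nonneg (fun _ _ => zero_le_one) _) (by positivity)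
  · filter_upwards [ae_noiseMeasure_nonneg μ] with p hp
    simp only [fun n => huval n p hp]
    exact ((eq.tendsto_kernelFourier t x p.1 p.2).comp (tendsto_gridSucc hp)).mul_const _

/-- A standard mollifier supported in the ball of radius `1 / (n + 1)`. -/
noncomputable def mollifierBump (d n : ℕ) : ContDiffBump (0 : E d) where
  rIn := 1 / (2 * (n + 1))
  rOut := 1 / (n + 1)
  rIn_pos := by positivity
  rIn_lt_rOut := by
    rw [one_div_lt_one_div (by positivity) (by positivity)]
    linarith [(Nat.cast_nonneg n : (0 : ℝ) ≤ n)]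

theorem norm_fourierFun_mollifierBump_le (d n : ℕ) (ξ : E d) :
    ‖fourierFun ((mollifierBump d n).normed volume) ξ‖ ≤ 1 := by
  refine (norm_integral_le_integral_norm _).trans (le_of_eq ?_)
  rw [← (mollifierBump d n).integral_normed (μ := volume)]
  congr 1
  ext x
  rw [norm_mul, norm_exp_neg_I_mul_ofReal, one_mul, Complex.norm_real,
    Real.norm_of_nonneg ((mollifierBump d n).nonneg_normed x)]

/-- The transform at ξ is the convolution of the bump with e^{i⟨ξ,·⟩} evaluated at 0, and the bumps
form an approximate identity. -/
theorem tendsto_fourierFun_mollifierBump (d : ℕ) (ξ : E d) :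
    Tendsto (fun n => fourierFun ((mollifierBump d n).normed volume) ξ) atTop (𝓝 1) := by
  have hc : Continuous fun x : E d => Complex.exp (Complex.I * ((inner ℝ ξ x : ℝ) : ℂ)) := by
    fun_prop
  have h := ContDiffBump.convolution_tendsto_right_of_continuous (μ := volume)
    (φ := fun n => mollifierBump d n) (l := atTop)
    (tendsto_one_div_add_atTop_nhds_zero_nat (𝕜 := ℝ)) hc (0 : E d)
  simp only [inner_zero_right, Complex.ofReal_zero, mul_zero, Complex.exp_zero] at h
  refine h.congr fun n => ?_
  rw [convolution, fourierFun]
  congr 1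
  ext x
  simp [mul_comm]

/-- Remove the mollifier: its transform is bounded by 1 and tends to 1, so the square integrable
kernel dominates its own mollifications. -/
theorem approximable_kernelFourier {eq : Equation} {d : ℕ} (hd : eq.AdmissibleDim d)
    {μ : Measure (E d)} [SFinite μ]
    (hμ : ∫⁻ ξ, ENNReal.ofReal (1 / (1 + ‖ξ‖ ^ 2)) ∂μ ≠ ⊤) {t : ℝ} {x : E d}
    (hL : eLpNorm (eq.kernelFourier t x) 2 (noiseMeasure μ) ≠ ⊤) :
    Approximable μ (eq.kernelFourier t x) := by
  have hm := eq.measurable_kernelFourier t x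
  have hum : ∀ n, AEStronglyMeasurable (fun p : ℝ × E d => eq.kernelFourier t x p *
      fourierFun ((mollifierBump d n).normed volume) p.2) (noiseMeasure μ) := fun n =>
    (hm.mul ((measurable_fourierFun (mollifierBump d n).continuous_normed).comp
      measurable_snd)).aestronglyMeasurable
  refine Approximable.of_tendsto (fun n => approximable_kernelFourier_mul hd hμ
    (mollifierBump d n).contDiff_normed (mollifierBump d n).hasCompactSupport_normed t x)
    hum hm.aestronglyMeasurable ?_
  refine tendsto_eLpNorm_two_of_dominated (g := fun p => ‖eq.kernelFourier t x p‖)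
    hum hm.aestronglyMeasurable (by rwa [eLpNorm_norm]) (fun n => ae_of_all _ fun p => ?_)
    (ae_of_all _ fun p => ?_)
  · rw [norm_mul]
    exact mul_le_of_le_one_right (norm_nonneg _) (norm_fourierFun_mollifierBump_le d n p.2)
  · simpa using (tendsto_fourierFun_mollifierBump d p.2).const_mul (eq.kernelFourier t x p)

/-! ### Isometry property of the noise -/

theorem integral_sub_sub_sub {α F : Type*} [MeasurableSpace α] [NormedAddCommGroup F]
    [NormedSpace ℝ F] {μ : Measure α} {f g h k : α → F} (hf : Integrable f μ)
    (hg : Integrable g μ) (hh : Integrable h μ) (hk : Integrable k μ) :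
    ∫ x, (f x - g x - (h x - k x)) ∂μ =
      ∫ x, f x ∂μ - ∫ x, g x ∂μ - (∫ x, h x ∂μ - ∫ x, k x ∂μ) := by
  have := integral_sub (hf.sub hg) (hh.sub hk)
  simp only [Pi.sub_apply] at this
  rw [this, integral_sub hf hg, integral_sub hh hk]

section Isometry

variable {Ω : Type*} [MeasurableSpace Ω] {P : Measure Ω} {d : ℕ} {μ : Measure (E d)}
  {W : TestFunction d → Ω → ℝ}

theorem IsHomogeneousNoise.memLp (hW : IsHomogeneousNoise P μ W) (φ : TestFunction d) :
    MemLp (W φ) 2 P :=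
  (hW.gaussian.hasGaussianLaw_eval φ).memLp_two

theorem IsHomogeneousNoise.covariance_eq [SFinite μ] (hW : IsHomogeneousNoise P μ W)
    (hμ : ∫⁻ ξ, ENNReal.ofReal (1 / (1 + ‖ξ‖ ^ 2)) ∂μ ≠ ⊤) (φ ψ : TestFunction d) :
    ((∫ ω, W φ ω * W ψ ω ∂P : ℝ) : ℂ) =
      ∫ p, φ.fourier p.1 p.2 * (starRingEnd ℂ) (ψ.fourier p.1 p.2) ∂(noiseMeasure μ) := by
  rw [hW.covariance, noiseMeasure, integral_prod]
  exact (φ.memLp_fourier hμ).integrable_mul (ψ.memLp_fourier hμ).star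

/-- Linearity of W is not part of the definition of the noise. The isometry for differences is
obtained by expanding both squares and matching the four covariances. -/
theorem IsHomogeneousNoise.eLpNorm_sub [SFinite μ] (hW : IsHomogeneousNoise P μ W)
    (hμ : ∫⁻ ξ, ENNReal.ofReal (1 / (1 + ‖ξ‖ ^ 2)) ∂μ ≠ ⊤) (φ ψ : TestFunction d) :
    eLpNorm (fun ω => W φ ω - W ψ ω) 2 P =
      eLpNorm (fun p => φ.fourier p.1 p.2 - ψ.fourier p.1 p.2) 2 (noiseMeasure μ) := by
  have h1 := hW.memLp φ
  have h2 := hW.memLp ψ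
  have f1 := φ.memLp_fourier hμ
  have f2 := ψ.memLp_fourier hμ
  have i1 : ∀ φ ψ : TestFunction d, Integrable (fun ω => W φ ω * W ψ ω) P := fun φ ψ =>
    (hW.memLp φ).integrable_mul (hW.memLp ψ)
  have i2 : ∀ φ ψ : TestFunction d, Integrable (fun p : ℝ × E d => φ.fourier p.1 p.2 *
      (starRingEnd ℂ) (ψ.fourier p.1 p.2)) (noiseMeasure μ) := fun φ ψ =>
    (φ.memLp_fourier hμ).integrable_mul (ψ.memLp_fourier hμ).star
  have key : ((∫ ω, (W φ ω - W ψ ω) ^ 2 ∂P : ℝ) : ℂ) =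
      ((∫ p, ‖φ.fourier p.1 p.2 - ψ.fourier p.1 p.2‖ ^ 2 ∂(noiseMeasure μ) : ℝ) : ℂ) := by
    have e1 : ∀ ω, (W φ ω - W ψ ω) ^ 2 =
        (W φ ω * W φ ω - W φ ω * W ψ ω) - (W ψ ω * W φ ω - W ψ ω * W ψ ω) := fun ω => by ring
    have e2 : ∀ p : ℝ × E d, ((‖φ.fourier p.1 p.2 - ψ.fourier p.1 p.2‖ ^ 2 : ℝ) : ℂ) =
        (φ.fourier p.1 p.2 * (starRingEnd ℂ) (φ.fourier p.1 p.2) -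
          φ.fourier p.1 p.2 * (starRingEnd ℂ) (ψ.fourier p.1 p.2)) -
        (ψ.fourier p.1 p.2 * (starRingEnd ℂ) (φ.fourier p.1 p.2) -
          ψ.fourier p.1 p.2 * (starRingEnd ℂ) (ψ.fourier p.1 p.2)) := fun p => by
      rw [← Complex.normSq_eq_norm_sq, Complex.normSq_eq_conj_mul_self, map_sub]
      ring
    rw [← integral_complex_ofReal (f := fun p : ℝ × E d => ‖φ.fourier p.1 p.2 -
      ψ.fourier p.1 p.2‖ ^ 2)]
    simp only [e1, e2]
    rw [integral_sub_sub_sub (i1 φ φ) (i1 φ ψ) (i1 ψ φ) (i1 ψ ψ),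
      integral_sub_sub_sub (i2 φ φ) (i2 φ ψ) (i2 ψ φ) (i2 ψ ψ)]
    push_cast
    rw [hW.covariance_eq hμ, hW.covariance_eq hμ, hW.covariance_eq hμ, hW.covariance_eq hμ]
  have key' := Complex.ofReal_injective key
  have l1 : MemLp (fun ω => W φ ω - W ψ ω) 2 P := h1.sub h2
  have l2 : MemLp (fun p : ℝ × E d => φ.fourier p.1 p.2 - ψ.fourier p.1 p.2) 2 (noiseMeasure μ) :=
    f1.sub f2
  rw [l1.eLpNorm_eq_integral_rpow_norm (by norm_num) (by norm_num),
    l2.eLpNorm_eq_integral_rpow_norm (by norm_num) (by norm_num)]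
  simp only [ENNReal.toReal_ofNat, Real.rpow_ofNat, Real.norm_eq_abs, sq_abs]
  rw [key']

/-! ### Moments of Gaussian variables -/

/-- The absolute moment of order `m` of a standard Gaussian variable. -/
noncomputable def gaussianMoment (m : ℕ) : ENNReal := ∫⁻ x, ‖x‖ₑ ^ m ∂(gaussianReal 0 1)

theorem gaussianMoment_ne_top (m : ℕ) : gaussianMoment m ≠ ⊤ := by
  rcases Nat.eq_zero_or_pos m with rfl | hm
  · simp [gaussianMoment]
  · have h := memLp_id_gaussianReal (μ := 0) (v := 1) (m : NNReal)
    have h2 := eLpNorm_nnreal_pow_eq_lintegral (f := (id : ℝ → ℝ)) (μ := gaussianReal 0 1)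
      (p := (m : NNReal)) (by exact_mod_cast hm.ne')
    simp only [NNReal.coe_natCast, ENNReal.rpow_natCast, id] at h2
    rw [gaussianMoment, ← h2]
    exact ENNReal.pow_ne_top h.2.ne

/-- A centered Gaussian variable is its standard deviation times a standard one. This upgrades
variance estimates to moments of every order. -/
theorem lintegral_enorm_pow_of_hasGaussianLaw {Z : Ω → ℝ} (hZ : HasGaussianLaw Z P)
    (h0 : ∫ ω, Z ω ∂P = 0) (m : ℕ) :
    ∫⁻ ω, ‖Z ω‖ₑ ^ m ∂P = gaussianMoment m * eLpNorm Z 2 P ^ m := by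
  have := hZ.isProbabilityMeasure
  have hmap := hZ.map_eq_gaussianReal
  rw [h0] at hmap
  have hv : eLpNorm Z 2 P = ENNReal.ofReal √(Var[Z; P]) := by
    have h1 : eLpNorm Z 2 P ^ 2 = ENNReal.ofReal √(Var[Z; P]) ^ 2 := by
      rw [← ENNReal.ofReal_pow (Real.sqrt_nonneg _), Real.sq_sqrt (variance_nonneg _ _),
        hZ.memLp_two.ofReal_variance_eq, evariance, eLpNorm_two_sq, h0]
      simp
    exact (ENNReal.pow_right_strictMono two_ne_zero).injective h1
  have hscale : gaussianReal 0 Var[Z; P].toNNReal =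
      (gaussianReal 0 1).map (√(Var[Z; P]) * ·) := by
    rw [gaussianReal_map_const_mul, mul_zero, mul_one]
    congr 1
    ext
    simp [Real.sq_sqrt (variance_nonneg Z P), variance_nonneg Z P]
  have hm : Measurable fun x : ℝ => ‖x‖ₑ ^ m := by fun_prop
  calc ∫⁻ ω, ‖Z ω‖ₑ ^ m ∂P = ∫⁻ x, ‖x‖ₑ ^ m ∂(P.map Z) :=
        (lintegral_map' hm.aemeasurable hZ.aemeasurable).symm
    _ = ∫⁻ x, ‖√(Var[Z; P]) * x‖ₑ ^ m ∂(gaussianReal 0 1) := by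
        rw [hmap, hscale, lintegral_map hm (by fun_prop)]
    _ = _ := by
        simp only [enorm_mul, mul_pow]
        rw [lintegral_const_mul _ hm, hv, mul_comm, gaussianMoment,
          Real.enorm_of_nonneg (Real.sqrt_nonneg _)]

/-! ### Existence and moments of the stochastic convolution -/

theorem IsHomogeneousNoise.exists_isStochConv [SFinite μ] (hW : IsHomogeneousNoise P μ W)
    (hμ : ∫⁻ ξ, ENNReal.ofReal (1 / (1 + ‖ξ‖ ^ 2)) ∂μ ≠ ⊤) {eq : Equation}
    (hd : eq.AdmissibleDim d) {t : ℝ} {x : E d} (h : Approximable μ (eq.kernelFourier t x)) :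
    ∃ X, IsStochConv P eq μ W t x X := by
  set B : ℕ → ENNReal := fun n => (1 / 2) ^ n with hB
  have hBpos : ∀ n, 0 < B n := fun n => by rw [hB]; exact ENNReal.pow_pos (by simp) _
  have hBtop : ∀ n, B n ≠ ⊤ := fun n => by rw [hB]; exact ENNReal.pow_ne_top (by simp)
  have hBanti : ∀ m n, m ≤ n → B n ≤ B m := fun m n hmn =>
    pow_le_pow_right_of_le_one' (by simp [ENNReal.inv_le_one]) hmn
  -- A quarter of `B n`: two such errors add up to `B N / 2`, strictly below the `B N` required by
  -- the completeness criterion.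
  choose φ hφ using fun n => h (B n / 2 / 2) (ENNReal.half_pos (ENNReal.half_pos (hBpos n).ne').ne')
  have hm := (eq.measurable_kernelFourier t x).aestronglyMeasurable (μ := noiseMeasure μ)
  have hcau : ∀ N n m : ℕ, N ≤ n → N ≤ m →
      eLpNorm ((fun ω => W (φ n) ω) - fun ω => W (φ m) ω) 2 P < B N := by
    intro N n m hn hmN
    have e : (fun p : ℝ × E d => (φ n).fourier p.1 p.2 - (φ m).fourier p.1 p.2) =
        (fun p => (φ n).fourier p.1 p.2 - eq.kernelFourier t x p) -
          fun p => (φ m).fourier p.1 p.2 - eq.kernelFourier t x p := by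
      ext p; simp
    change eLpNorm (fun ω => W (φ n) ω - W (φ m) ω) 2 P < B N
    rw [hW.eLpNorm_sub hμ, e]
    refine (eLpNorm_sub_le ((φ n).measurable_fourier.aestronglyMeasurable.sub hm)
      ((φ m).measurable_fourier.aestronglyMeasurable.sub hm) (by norm_num)).trans_lt ?_
    calc _ ≤ B N / 2 / 2 + B N / 2 / 2 := by
          refine add_le_add ((hφ n).trans ?_) ((hφ m).trans ?_)
          · have := hBanti N n hn; gcongr
          · have := hBanti N m hmN; gcongr
      _ = B N / 2 := ENNReal.add_halves _
      _ < B N := ENNReal.half_lt_self (hBpos N).ne' (hBtop N)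
  have hsum : ∑' n, B n ≠ ⊤ := by
    rw [hB, ENNReal.tsum_geometric]
    simp
  obtain ⟨X, hX, hXlim⟩ := Lp.cauchy_complete_eLpNorm (by norm_num)
    (fun n => hW.memLp (φ n)) hsum hcau
  refine ⟨X, hX, φ, ?_, hXlim⟩
  have h0 : Tendsto (fun n => eLpNorm (fun p => (φ n).fourier p.1 p.2 - eq.kernelFourier t x p) 2
      (noiseMeasure μ)) atTop (𝓝 0) := by
    refine tendsto_of_tendsto_of_tendsto_of_le_of_le tendsto_const_nhds ?_ (fun _ => zero_le)
      (fun n => (hφ n).trans ?_) (h := B)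
    · exact ENNReal.tendsto_pow_atTop_nhds_zero_of_lt_one (by simp)
    · exact ENNReal.half_le_self.trans ENNReal.half_le_self
  simp only [noiseDistSq_eq_eLpNorm_sq hd]
  simpa [Function.comp_def] using ((ENNReal.continuous_pow 2).tendsto 0).comp h0

/-- The approximating differences `W (φ k) - W (ψ k)` are centered Gaussian, so their moments are
powers of their L² norms, which the isometry bounds by the kernel distance plus two vanishing
errors. Fatou's lemma along an almost surely convergent subsequence passes to X - Y without having
to show that this limit is Gaussian. -/
theorem IsHomogeneousNoise.lintegral_sub_pow_le [SFinite μ] (hW : IsHomogeneousNoise P μ W)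
    (hμ : ∫⁻ ξ, ENNReal.ofReal (1 / (1 + ‖ξ‖ ^ 2)) ∂μ ≠ ⊤) {eq : Equation}
    (hd : eq.AdmissibleDim d) {t s : ℝ} {x z : E d} {X Y : Ω → ℝ}
    (hX : IsStochConv P eq μ W t x X) (hY : IsStochConv P eq μ W s z Y) (m : ℕ) :
    ∫⁻ ω, ‖X ω - Y ω‖ₑ ^ m ∂P ≤ gaussianMoment m *
      eLpNorm (fun p => eq.kernelFourier t x p - eq.kernelFourier s z p) 2 (noiseMeasure μ) ^ m := by
  obtain ⟨hX2, φ, hφ, hφX⟩ := hX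
  obtain ⟨hY2, ψ, hψ, hψY⟩ := hY
  simp only [noiseDistSq_eq_eLpNorm_sq hd, eLpNorm_two_sq] at hφ hψ
  rw [← tendsto_eLpNorm_two_iff] at hφ hψ
  have hmt := (eq.measurable_kernelFourier t x).aestronglyMeasurable (μ := noiseMeasure μ)
  have hms := (eq.measurable_kernelFourier s z).aestronglyMeasurable (μ := noiseMeasure μ)
  set Z : ℕ → Ω → ℝ := fun k ω => W (φ k) ω - W (ψ k) ω with hZ
  have hZm : ∀ k, AEStronglyMeasurable (Z k) P := fun k =>
    (hW.memLp (φ k)).1.sub (hW.memLp (ψ k)).1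
  have hlim : Tendsto (fun k => eLpNorm (Z k - fun ω => X ω - Y ω) 2 P) atTop (𝓝 0) := by
    refine tendsto_of_tendsto_of_tendsto_of_le_of_le tendsto_const_nhds
      (by simpa using hφX.add hψY) (fun _ => zero_le) fun k => ?_
    have e : (Z k - fun ω => X ω - Y ω) =
        (fun ω => W (φ k) ω - X ω) - fun ω => W (ψ k) ω - Y ω := by
      ext ω; simp only [hZ, Pi.sub_apply]; ring
    rw [e]
    exact eLpNorm_sub_le ((hW.memLp (φ k)).1.sub hX2.1) ((hW.memLp (ψ k)).1.sub hY2.1) (by norm_num)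
  obtain ⟨ns, hns, hae⟩ := (tendstoInMeasure_of_tendsto_eLpNorm (by norm_num) hZm
    (hX2.1.sub hY2.1) hlim).exists_seq_tendsto_ae
  set δ : ENNReal := eLpNorm (fun p => eq.kernelFourier t x p - eq.kernelFourier s z p) 2
    (noiseMeasure μ) with hδ
  set b : ℕ → ENNReal := fun k =>
    eLpNorm (fun p => (φ k).fourier p.1 p.2 - eq.kernelFourier t x p) 2 (noiseMeasure μ) + δ +
      eLpNorm (fun p => (ψ k).fourier p.1 p.2 - eq.kernelFourier s z p) 2 (noiseMeasure μ) with hb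
  have hblim : Tendsto b atTop (𝓝 δ) := by
    simpa using (hφ.add tendsto_const_nhds).add hψ
  have hZb : ∀ k, ∫⁻ ω, ‖Z k ω‖ₑ ^ m ∂P ≤ gaussianMoment m * b k ^ m := by
    intro k
    have h0 : ∫ ω, Z k ω ∂P = 0 := by
      have := hW.gaussian.isProbabilityMeasure
      rw [hZ, integral_sub ((hW.memLp (φ k)).integrable (by norm_num))
        ((hW.memLp (ψ k)).integrable (by norm_num)), hW.centered, hW.centered, sub_zero]
    rw [lintegral_enorm_pow_of_hasGaussianLaw hW.gaussian.hasGaussianLaw_fun_sub h0,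
      hW.eLpNorm_sub hμ]
    gcongr
    have e : (fun p : ℝ × E d => (φ k).fourier p.1 p.2 - (ψ k).fourier p.1 p.2) =
        ((fun p => (φ k).fourier p.1 p.2 - eq.kernelFourier t x p) +
          fun p => eq.kernelFourier t x p - eq.kernelFourier s z p) -
          fun p => (ψ k).fourier p.1 p.2 - eq.kernelFourier s z p := by
      ext p; simp only [Pi.sub_apply, Pi.add_apply]; ring
    have m1 := (φ k).measurable_fourier.aestronglyMeasurable.sub hmt
    have m2 := hmt.sub hms
    have m3 := (ψ k).measurable_fourier.aestronglyMeasurable.sub hms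
    rw [e]
    refine (eLpNorm_sub_le (m1.add m2) m3 (by norm_num)).trans ?_
    exact add_le_add (eLpNorm_add_le m1 m2 (by norm_num)) le_rfl
  calc ∫⁻ ω, ‖X ω - Y ω‖ₑ ^ m ∂P
      = ∫⁻ ω, liminf (fun k => ‖Z (ns k) ω‖ₑ ^ m) atTop ∂P := by
        refine lintegral_congr_ae ?_
        filter_upwards [hae] with ω hω
        exact (((ENNReal.continuous_pow m).tendsto _).comp hω.enorm).liminf_eq.symm
    _ ≤ liminf (fun k => ∫⁻ ω, ‖Z (ns k) ω‖ₑ ^ m ∂P) atTop :=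
        lintegral_liminf_le' fun k => (hZm (ns k)).enorm.pow_const m
    _ ≤ liminf (fun k => gaussianMoment m * b (ns k) ^ m) atTop :=
        liminf_le_liminf (Eventually.of_forall fun k => hZb (ns k))
    _ = gaussianMoment m * δ ^ m := by
        refine Tendsto.liminf_eq ?_
        refine ENNReal.Tendsto.const_mul ?_ (Or.inr (gaussianMoment_ne_top m))
        exact ((ENNReal.continuous_pow m).tendsto _).comp (hblim.comp hns.tendsto_atTop)

end Isometry

/-! ### Elementary inequalities -/

theorem rpow_mul_one_add_rpow_le {q ρ : ℝ} (hq0 : 0 < q) (hq2 : q < 2) (hρ : 0 ≤ ρ) :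
    ρ ^ (2 - q) * (1 + ρ ^ q) ≤ 2 * (1 + ρ ^ 2) := by
  have h1 : ρ ^ (2 - q) * ρ ^ q = ρ ^ 2 := by
    rw [← Real.rpow_add_of_nonneg hρ (by linarith) hq0.le, sub_add_cancel, Real.rpow_two]
  have h2 : ρ ^ (2 - q) ≤ 1 + ρ ^ 2 := by
    rcases le_total ρ 1 with h | h
    · have := Real.rpow_le_one hρ h (by linarith : 0 ≤ 2 - q)
      nlinarith [sq_nonneg ρ]
    · have := Real.rpow_le_rpow_of_exponent_le h (by linarith : 2 - q ≤ 2)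
      rw [Real.rpow_two] at this
      linarith
  rw [mul_add, h1]
  linarith

theorem rpow_div_one_add_sq_le {q ρ : ℝ} (hq0 : 0 < q) (hq2 : q < 2) (hρ : 0 ≤ ρ) :
    ρ ^ (2 - q) / (1 + ρ ^ 2) ≤ 2 * (1 / (1 + ρ ^ q)) := by
  have : 0 ≤ ρ ^ q := Real.rpow_nonneg hρ q
  rw [mul_one_div, div_le_div_iff₀ (by positivity) (by positivity)]
  exact rpow_mul_one_add_rpow_le hq0 hq2 hρ

theorem one_div_one_add_sq_le {q ρ : ℝ} (hq0 : 0 < q) (hq2 : q < 2) (hρ : 0 ≤ ρ) :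
    1 / (1 + ρ ^ 2) ≤ 2 * (1 / (1 + ρ ^ q)) := by
  have h0 : 0 ≤ ρ ^ q := Real.rpow_nonneg hρ q
  rw [mul_one_div, div_le_div_iff₀ (by positivity) (by positivity)]
  rcases le_total ρ 1 with h | h
  · have := Real.rpow_le_one hρ h hq0.le
    nlinarith [sq_nonneg ρ]
  · have := Real.rpow_le_rpow_of_exponent_le h hq2.le
    rw [Real.rpow_two] at this
    linarith [sq_nonneg ρ]

/-- Interpolation between u² for small u and 1 for large u; it is used with θ = 2 - q for the phases
and θ = 1 - q/2 for the heat semigroup. -/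
theorem min_sq_le_rpow {u θ : ℝ} (hu : 0 ≤ u) (hθ0 : 0 ≤ θ) (hθ2 : θ ≤ 2) :
    (min u 1) ^ 2 ≤ u ^ θ := by
  rcases le_total u 1 with h | h
  · rw [min_eq_left h, ← Real.rpow_two]
    rcases hu.eq_or_lt with rfl | hu
    · rw [Real.zero_rpow two_ne_zero]
      exact Real.rpow_nonneg le_rfl _
    · exact Real.rpow_le_rpow_of_exponent_ge hu h hθ2
  · rw [min_eq_right h, one_pow]
    exact Real.one_le_rpow h hθ0

theorem norm_exp_sub_exp_le (a b : ℝ) :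
    ‖Complex.exp (-(Complex.I * (a : ℂ))) - Complex.exp (-(Complex.I * (b : ℂ)))‖ ≤
      2 * min |a - b| 1 := by
  rcases le_total |a - b| 1 with h | h
  · have h1 : ‖Complex.exp (Complex.I * ((b - a : ℝ) : ℂ)) - 1‖ ≤ ‖b - a‖ :=
      Real.norm_exp_I_mul_ofReal_sub_one_le
    have h2 : Complex.exp (-(Complex.I * (a : ℂ))) - Complex.exp (-(Complex.I * (b : ℂ))) =
        Complex.exp (-(Complex.I * (b : ℂ))) * (Complex.exp (Complex.I * ((b - a : ℝ) : ℂ)) - 1) := by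
      rw [mul_sub, ← Complex.exp_add, mul_one]
      congr 2
      push_cast
      ring
    rw [h2, norm_mul, norm_exp_neg_I_mul_ofReal, one_mul, min_eq_left h]
    rw [Real.norm_eq_abs, abs_sub_comm] at h1
    linarith [abs_nonneg (a - b)]
  · rw [min_eq_right h]
    refine (norm_sub_le _ _).trans ?_
    rw [norm_exp_neg_I_mul_ofReal, norm_exp_neg_I_mul_ofReal]
    norm_num

/-! ### Estimates on the symbols -/

/-- Since τρ sinc(τρ) = sin(τρ), multiplying the square by 1 + ρ² gives τ² sinc² + sin². -/
theorem symbol_wave_sq_le {τ T ρ : ℝ} (hτ : 0 ≤ τ) (hT : τ ≤ T) :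
    Equation.wave.symbol τ ρ ^ 2 ≤ (T ^ 2 + 1) / (1 + ρ ^ 2) := by
  rw [le_div_iff₀ (by positivity), Equation.symbol]
  have h1 : (τ * ρ) * Real.sinc (τ * ρ) = Real.sin (τ * ρ) := by
    rcases eq_or_ne (τ * ρ) 0 with h | h
    · simp [h]
    · rw [Real.sinc_of_ne_zero h, ← mul_div_assoc, mul_div_cancel_left₀ _ h]
  have h2 : (τ * Real.sinc (τ * ρ)) ^ 2 * (1 + ρ ^ 2) =
      τ ^ 2 * Real.sinc (τ * ρ) ^ 2 + Real.sin (τ * ρ) ^ 2 := by rw [← h1]; ring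
  have h3 : Real.sinc (τ * ρ) ^ 2 ≤ 1 := (sq_le_one_iff_abs_le_one _).2 (Real.abs_sinc_le_one _)
  have h4 : τ ^ 2 * Real.sinc (τ * ρ) ^ 2 ≤ T ^ 2 * 1 := by gcongr
  rw [h2]
  linarith [Real.sin_sq_le_one (τ * ρ)]

theorem abs_symbol_wave_sub_le (a b : ℝ) {ρ : ℝ} (hρ : 0 ≤ ρ) :
    |Equation.wave.symbol a ρ - Equation.wave.symbol b ρ| ≤ |a - b| ∧
    |Equation.wave.symbol a ρ - Equation.wave.symbol b ρ| * ρ ≤ 2 := by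
  have h1 : ∀ c, Equation.wave.symbol c ρ * ρ = Real.sin (c * ρ) := by
    intro c
    rw [Equation.symbol]
    rcases eq_or_ne (c * ρ) 0 with h | h
    · rw [mul_right_comm, h]; simp
    · rw [Real.sinc_of_ne_zero h, mul_right_comm, ← mul_div_assoc, mul_div_cancel_left₀ _ h]
  have h2 : |Equation.wave.symbol a ρ - Equation.wave.symbol b ρ| * ρ =
      |Real.sin (a * ρ) - Real.sin (b * ρ)| := by
    rw [← h1, ← h1, ← sub_mul, abs_mul, abs_of_nonneg hρ]
  constructor
  · rcases hρ.eq_or_lt with rfl | hρ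
    · simp [Equation.symbol]
    · refine le_of_mul_le_mul_right ?_ hρ
      rw [h2]
      have h3 : |Real.sin (a * ρ) - Real.sin (b * ρ)| ≤ |a * ρ - b * ρ| := by
        have := Real.lipschitzWith_sin.dist_le_mul (a * ρ) (b * ρ)
        simpa [Real.dist_eq] using this
      rwa [← sub_mul, abs_mul, abs_of_pos hρ] at h3
  · rw [h2]
    have h3 := Real.abs_sin_le_one (a * ρ)
    have h4 := Real.abs_sin_le_one (b * ρ)
    exact (abs_sub _ _).trans (by linarith)

theorem one_le_mul_one_div_one_add_rpow {q ρ : ℝ} (hq0 : 0 < q) (hρ : 0 ≤ ρ) (h : ρ ≤ 1) :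
    1 ≤ 2 * (1 / (1 + ρ ^ q)) := by
  have h1 := Real.rpow_le_one hρ h hq0.le
  have h0 : 0 ≤ ρ ^ q := Real.rpow_nonneg hρ q
  rw [mul_one_div, le_div_iff₀ (by positivity)]
  linarith

theorem one_div_rpow_le {q ρ : ℝ} (hq0 : 0 < q) (h : 1 ≤ ρ) :
    1 / ρ ^ q ≤ 2 * (1 / (1 + ρ ^ q)) := by
  have h1 := Real.one_le_rpow h hq0.le
  rw [mul_one_div, div_le_div_iff₀ (by positivity) (by positivity)]
  linarith

/-- Write D² = D^{2-q} D^q. The first factor uses D ≤ |a - b| and yields the time exponent; the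
second uses D ≤ 2/ρ when ρ ≥ 1, or D ≤ T when ρ ≤ 1, and yields the weight of (H1). -/
theorem symbol_wave_sub_sq_le {q T a b ρ : ℝ} (hq0 : 0 < q) (hq2 : q < 2) (hρ : 0 ≤ ρ)
    (hab : |a - b| ≤ T) :
    (Equation.wave.symbol a ρ - Equation.wave.symbol b ρ) ^ 2 ≤
      (2 * T ^ q + 8) * |a - b| ^ (2 - q) * (1 / (1 + ρ ^ q)) := by
  obtain ⟨h1, h2⟩ := abs_symbol_wave_sub_le a b hρ
  set D := |Equation.wave.symbol a ρ - Equation.wave.symbol b ρ| with hD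
  have hD0 : 0 ≤ D := abs_nonneg _
  have hw : 0 ≤ 1 / (1 + ρ ^ q) := by
    have := Real.rpow_nonneg hρ q
    positivity
  have hsplit : D ^ 2 = D ^ (2 - q) * D ^ q := by
    rw [← Real.rpow_add_of_nonneg hD0 (by linarith) hq0.le, sub_add_cancel, Real.rpow_two]
  have hpow : D ^ (2 - q) ≤ |a - b| ^ (2 - q) := Real.rpow_le_rpow hD0 h1 (by linarith)
  have hδ0 : 0 ≤ |a - b| ^ (2 - q) := Real.rpow_nonneg (abs_nonneg _) _
  have hT0 : 0 ≤ T := (abs_nonneg _).trans hab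
  have hTq : 0 ≤ T ^ q := Real.rpow_nonneg hT0 q
  rw [← sq_abs, ← hD, hsplit]
  rcases le_total ρ 1 with h | h
  · have h3 : D ^ q ≤ T ^ q := Real.rpow_le_rpow hD0 (h1.trans hab) hq0.le
    have h4 := one_le_mul_one_div_one_add_rpow hq0 hρ h
    calc D ^ (2 - q) * D ^ q ≤ |a - b| ^ (2 - q) * T ^ q := by gcongr
      _ ≤ |a - b| ^ (2 - q) * T ^ q * (2 * (1 / (1 + ρ ^ q))) :=
        le_mul_of_one_le_right (by positivity) h4
      _ = (2 * T ^ q) * |a - b| ^ (2 - q) * (1 / (1 + ρ ^ q)) := by ring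
      _ ≤ _ := by gcongr; linarith
  · have hρ0 : 0 < ρ := by linarith
    have h3 : D ^ q ≤ 4 * (1 / ρ ^ q) := by
      have h4 : D ≤ 2 / ρ := by rwa [le_div_iff₀ hρ0]
      have h5 : D ^ q ≤ (2 / ρ) ^ q := Real.rpow_le_rpow hD0 h4 hq0.le
      rw [Real.div_rpow (by norm_num) hρ0.le] at h5
      have h6 : (2 : ℝ) ^ q ≤ 4 := by
        have := Real.rpow_le_rpow_of_exponent_le (x := 2) (by norm_num) hq2.le
        rw [Real.rpow_two] at this
        linarith
      refine h5.trans ?_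
      rw [mul_one_div]
      gcongr
    have h4 := one_div_rpow_le hq0 h
    calc D ^ (2 - q) * D ^ q ≤ |a - b| ^ (2 - q) * (4 * (2 * (1 / (1 + ρ ^ q)))) := by
          have := h3.trans (mul_le_mul_of_nonneg_left h4 (by norm_num : (0 : ℝ) ≤ 4))
          gcongr
      _ = 8 * |a - b| ^ (2 - q) * (1 / (1 + ρ ^ q)) := by ring
      _ ≤ _ := by gcongr; linarith

theorem lintegral_exp_le {a b c : ℝ} (hc : 0 ≤ c) :
    ∫⁻ r in Set.Ico a b, ENNReal.ofReal (Real.exp (-((b - r) * c))) ≤ ENNReal.ofReal (b - a) := by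
  calc ∫⁻ r in Set.Ico a b, ENNReal.ofReal (Real.exp (-((b - r) * c)))
      ≤ ∫⁻ _ in Set.Ico a b, 1 := by
        refine setLIntegral_mono measurable_const fun r hr => ?_
        rw [← ENNReal.ofReal_one]
        refine ENNReal.ofReal_le_ofReal ?_
        rw [Real.exp_le_one_iff, neg_nonpos]
        exact mul_nonneg (by linarith [hr.2]) hc
    _ = _ := by simp

theorem mul_lintegral_exp_le {a b c : ℝ} (hab : a ≤ b) (hc : 0 ≤ c) :
    ENNReal.ofReal c * ∫⁻ r in Set.Ico a b, ENNReal.ofReal (Real.exp (-((b - r) * c))) ≤ 1 := by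
  have hderiv : ∀ r : ℝ, HasDerivAt (fun r => Real.exp (-((b - r) * c)))
      (c * Real.exp (-((b - r) * c))) r := by
    intro r
    have h1 : HasDerivAt (fun r : ℝ => -((b - r) * c)) c r := by
      have := (((hasDerivAt_id r).const_sub b).mul_const c).neg
      convert! this using 1
      simp
    convert! h1.exp using 1
    ring
  have hval := intervalIntegral.integral_eq_sub_of_hasDerivAt (a := a) (b := b)
    (fun r _ => hderiv r) (Continuous.intervalIntegrable (by fun_prop) _ _)
  have hint : IntegrableOn (fun r => c * Real.exp (-((b - r) * c))) (Set.Ico a b) :=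
    ((Continuous.continuousOn (by fun_prop)).integrableOn_compact isCompact_Icc).mono_set
      Set.Ico_subset_Icc_self
  rw [← lintegral_const_mul' _ _ ENNReal.ofReal_ne_top]
  simp only [← ENNReal.ofReal_mul hc]
  rw [← ofReal_integral_eq_lintegral_ofReal hint (ae_of_all _ fun r => by positivity),
    integral_Ico_eq_integral_Ioo, ← integral_Ioc_eq_integral_Ioo,
    ← intervalIntegral.integral_of_le hab, hval, ← ENNReal.ofReal_one]
  refine ENNReal.ofReal_le_ofReal ?_
  have := Real.exp_pos (-((b - a) * c))
  simp
  linarith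

theorem ENNReal_le_ofReal_div {a : ENNReal} {B c : ℝ} (hc : 0 < c)
    (h : ENNReal.ofReal c * a ≤ ENNReal.ofReal B) : a ≤ ENNReal.ofReal (B / c) := by
  rw [ENNReal.ofReal_div_of_pos hc, ENNReal.le_div_iff_mul_le
    (Or.inl (by simpa using hc)) (Or.inl ENNReal.ofReal_ne_top), mul_comm]
  exact h

theorem symbol_heat_sq (τ ρ : ℝ) : Equation.heat.symbol τ ρ ^ 2 = Real.exp (-(τ * ρ ^ 2)) := by
  rw [Equation.symbol, ← Real.exp_nat_mul]
  congr 1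
  push_cast
  ring

/-- For waves the decay in ρ already holds at each time. For heat it appears only after integration:
the integral of e^{-(t-r)ρ²} is at most t, and at most 1 after multiplication by ρ², whence the
constant T + 1. -/
theorem Equation.lintegral_symbol_sq_le (eq : Equation) {T : ℝ} (hT : 0 ≤ T) : ∃ C : ℝ, 0 ≤ C ∧
    ∀ t ∈ Set.Icc 0 T, ∀ ρ : ℝ, 0 ≤ ρ →
      ∫⁻ r in Set.Ico 0 t, ENNReal.ofReal (eq.symbol (t - r) ρ ^ 2) ≤
        ENNReal.ofReal (C / (1 + ρ ^ 2)) := by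
  cases eq
  · refine ⟨T * (T ^ 2 + 1), by positivity, fun t ht ρ hρ => ?_⟩
    calc ∫⁻ r in Set.Ico 0 t, ENNReal.ofReal (Equation.wave.symbol (t - r) ρ ^ 2)
        ≤ ∫⁻ r in Set.Ico 0 t, ENNReal.ofReal ((T ^ 2 + 1) / (1 + ρ ^ 2)) := by
          refine setLIntegral_mono measurable_const fun r hr => ENNReal.ofReal_le_ofReal ?_
          exact symbol_wave_sq_le (by linarith [hr.2]) (by linarith [hr.1, ht.2])
      _ = ENNReal.ofReal ((T ^ 2 + 1) / (1 + ρ ^ 2) * t) := by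
          rw [setLIntegral_const, Real.volume_Ico, sub_zero, ← ENNReal.ofReal_mul (by positivity)]
      _ ≤ _ := by
          refine ENNReal.ofReal_le_ofReal ?_
          rw [mul_div_assoc, mul_comm]
          gcongr
          exact ht.2
  · refine ⟨T + 1, by positivity, fun t ht ρ hρ => ENNReal_le_ofReal_div (by positivity) ?_⟩
    simp only [symbol_heat_sq]
    have h1 := lintegral_exp_le (a := 0) (b := t) (c := ρ ^ 2) (by positivity)
    have h2 := mul_lintegral_exp_le (a := 0) (b := t) (c := ρ ^ 2) ht.1 (by positivity)
    rw [ENNReal.ofReal_add zero_le_one (by positivity), add_mul, ENNReal.ofReal_one, one_mul,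
      ENNReal.ofReal_add hT zero_le_one, ENNReal.ofReal_one]
    refine add_le_add (h1.trans (ENNReal.ofReal_le_ofReal ?_)) h2
    linarith [ht.2]

/-! ### Increments of the kernel -/

/-- Tonelli with the time integral inside: a bound at each frequency is enough, and μ enters only
through the integral of (H1). -/
theorem eLpNorm_two_sq_noiseMeasure_le {d : ℕ} {μ : Measure (E d)} [SFinite μ]
    {k : ℝ × E d → ℂ} (hk : Measurable k) {A q : ℝ} (hA : 0 ≤ A)
    (h : ∀ ξ, ∫⁻ r in Set.Ici (0 : ℝ), ‖k (r, ξ)‖ₑ ^ 2 ≤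
      ENNReal.ofReal (A * (1 / (1 + ‖ξ‖ ^ q)))) :
    eLpNorm k 2 (noiseMeasure μ) ^ 2 ≤
      ENNReal.ofReal A * ∫⁻ ξ, ENNReal.ofReal (1 / (1 + ‖ξ‖ ^ q)) ∂μ := by
  have hm : Measurable fun p => ‖k p‖ₑ ^ 2 := hk.enorm.pow_const 2
  rw [eLpNorm_two_sq, noiseMeasure, lintegral_prod_symm _ hm.aemeasurable,
    ← lintegral_const_mul' _ _ ENNReal.ofReal_ne_top]
  refine lintegral_mono fun ξ => (h ξ).trans ?_
  rw [ENNReal.ofReal_mul hA]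

theorem enorm_sq_eq_ofReal {F : Type*} [NormedAddCommGroup F] (x : F) :
    ‖x‖ₑ ^ 2 = ENNReal.ofReal (‖x‖ ^ 2) := by
  rw [← ofReal_norm, ENNReal.ofReal_pow (norm_nonneg _)]

theorem Equation.eLpNorm_kernelFourier_sq_le (eq : Equation) {d : ℕ} {T q : ℝ} (hT : 0 ≤ T)
    (hq0 : 0 < q) (hq2 : q < 2) : ∃ C : ℝ, 0 ≤ C ∧ ∀ (μ : Measure (E d)) [SFinite μ],
      ∀ t ∈ Set.Icc 0 T, ∀ x : E d,
        eLpNorm (eq.kernelFourier t x) 2 (noiseMeasure μ) ^ 2 ≤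
          ENNReal.ofReal C * ∫⁻ ξ, ENNReal.ofReal (1 / (1 + ‖ξ‖ ^ q)) ∂μ := by
  obtain ⟨C, hC0, hC⟩ := eq.lintegral_symbol_sq_le hT
  refine ⟨2 * C, by positivity, fun μ _ t ht x => ?_⟩
  refine eLpNorm_two_sq_noiseMeasure_le (eq.measurable_kernelFourier t x) (by positivity)
    fun ξ => ?_
  calc ∫⁻ r in Set.Ici (0 : ℝ), ‖eq.kernelFourier t x (r, ξ)‖ₑ ^ 2
      = ∫⁻ r in Set.Ici (0 : ℝ), (Set.Iio t).indicator
          (fun r => ENNReal.ofReal (eq.symbol (t - r) ‖ξ‖ ^ 2)) r := by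
        refine lintegral_congr fun r => ?_
        rw [enorm_sq_eq_ofReal, eq.norm_kernelFourier]
        by_cases h : r < t <;> simp [h, sq_abs]
    _ = ∫⁻ r in Set.Ico 0 t, ENNReal.ofReal (eq.symbol (t - r) ‖ξ‖ ^ 2) := by
        rw [setLIntegral_indicator measurableSet_Iio, Set.Iio_inter_Ici]
    _ ≤ ENNReal.ofReal (C / (1 + ‖ξ‖ ^ 2)) := hC t ht _ (norm_nonneg _)
    _ ≤ _ := by
        refine ENNReal.ofReal_le_ofReal ?_
        have := one_div_one_add_sq_le hq0 hq2 (norm_nonneg ξ)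
        calc C / (1 + ‖ξ‖ ^ 2) = C * (1 / (1 + ‖ξ‖ ^ 2)) := by ring
          _ ≤ C * (2 * (1 / (1 + ‖ξ‖ ^ q))) := by gcongr
          _ = _ := by ring

theorem Equation.eLpNorm_kernelFourier_sub_space_sq_le (eq : Equation) {d : ℕ} {T q : ℝ}
    (hT : 0 ≤ T) (hq0 : 0 < q) (hq2 : q < 2) : ∃ C : ℝ, 0 ≤ C ∧
      ∀ (μ : Measure (E d)) [SFinite μ], ∀ t ∈ Set.Icc 0 T, ∀ x z : E d,
        eLpNorm (fun p => eq.kernelFourier t x p - eq.kernelFourier t z p) 2 (noiseMeasure μ) ^ 2 ≤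
          ENNReal.ofReal (C * ‖x - z‖ ^ (2 - q)) *
            ∫⁻ ξ, ENNReal.ofReal (1 / (1 + ‖ξ‖ ^ q)) ∂μ := by
  obtain ⟨C, hC0, hC⟩ := eq.lintegral_symbol_sq_le hT
  refine ⟨8 * C, by positivity, fun μ _ t ht x z => ?_⟩
  refine eLpNorm_two_sq_noiseMeasure_le ((eq.measurable_kernelFourier t x).sub
    (eq.measurable_kernelFourier t z)) (by positivity) fun ξ => ?_
  -- The difference of phases is at most 2 min(|ξ||x-z|, 1); interpolation of its square at exponent
  -- 2 - q gives K. The surplus |ξ|^{2-q} is absorbed by the decay 1/(1+|ξ|²).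
  set K : ℝ := 4 * (‖ξ‖ ^ (2 - q) * ‖x - z‖ ^ (2 - q)) with hK
  have hK0 : 0 ≤ K := by positivity
  have hexp : ‖Complex.exp (-(Complex.I * ((inner ℝ ξ x : ℝ) : ℂ))) -
      Complex.exp (-(Complex.I * ((inner ℝ ξ z : ℝ) : ℂ)))‖ ^ 2 ≤ K := by
    have h1 := norm_exp_sub_exp_le (inner ℝ ξ x) (inner ℝ ξ z)
    have h2 : |inner ℝ ξ x - inner ℝ ξ z| ≤ ‖ξ‖ * ‖x - z‖ := by
      rw [← inner_sub_right]; exact abs_real_inner_le_norm _ _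
    have h3 := min_sq_le_rpow (u := ‖ξ‖ * ‖x - z‖) (θ := 2 - q) (by positivity) (by linarith)
      (by linarith)
    rw [Real.mul_rpow (norm_nonneg _) (norm_nonneg _)] at h3
    calc _ ≤ (2 * min (‖ξ‖ * ‖x - z‖) 1) ^ 2 := by
          gcongr
          exact h1.trans (by gcongr)
      _ = 4 * (min (‖ξ‖ * ‖x - z‖) 1) ^ 2 := by ring
      _ ≤ K := by rw [hK]; gcongr
  calc ∫⁻ r in Set.Ici (0 : ℝ), ‖eq.kernelFourier t x (r, ξ) - eq.kernelFourier t z (r, ξ)‖ₑ ^ 2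
      ≤ ∫⁻ r in Set.Ici (0 : ℝ), (Set.Iio t).indicator
          (fun r => ENNReal.ofReal K * ENNReal.ofReal (eq.symbol (t - r) ‖ξ‖ ^ 2)) r := by
        refine lintegral_mono fun r => ?_
        rw [enorm_sq_eq_ofReal]
        by_cases h : r < t
        · simp only [Equation.kernelFourier, h, if_true, Set.indicator_of_mem (Set.mem_Iio.2 h)]
          rw [← ENNReal.ofReal_mul hK0, ← sub_mul, norm_mul, mul_pow, Complex.norm_real,
            Real.norm_eq_abs, sq_abs]
          gcongr
        · simp [Equation.kernelFourier, h]
    _ = ENNReal.ofReal K * ∫⁻ r in Set.Ico 0 t, ENNReal.ofReal (eq.symbol (t - r) ‖ξ‖ ^ 2) := by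
        rw [setLIntegral_indicator measurableSet_Iio, Set.Iio_inter_Ici,
          lintegral_const_mul' _ _ ENNReal.ofReal_ne_top]
    _ ≤ ENNReal.ofReal K * ENNReal.ofReal (C / (1 + ‖ξ‖ ^ 2)) := by
        gcongr
        exact hC t ht _ (norm_nonneg _)
    _ ≤ _ := by
        rw [← ENNReal.ofReal_mul hK0]
        refine ENNReal.ofReal_le_ofReal ?_
        have := rpow_div_one_add_sq_le hq0 hq2 (norm_nonneg ξ)
        calc K * (C / (1 + ‖ξ‖ ^ 2)) =
            4 * C * ‖x - z‖ ^ (2 - q) * (‖ξ‖ ^ (2 - q) / (1 + ‖ξ‖ ^ 2)) := by rw [hK]; ring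
          _ ≤ 4 * C * ‖x - z‖ ^ (2 - q) * (2 * (1 / (1 + ‖ξ‖ ^ q))) := by gcongr
          _ = _ := by ring

theorem Equation.norm_kernelFourier_sub_time (eq : Equation) {d : ℕ} (t s : ℝ) (x : E d)
    (p : ℝ × E d) : ‖eq.kernelFourier t x p - eq.kernelFourier s x p‖ =
      |(if p.1 < t then eq.symbol (t - p.1) ‖p.2‖ else 0) -
        (if p.1 < s then eq.symbol (s - p.1) ‖p.2‖ else 0)| := by
  have h : ∀ t, eq.kernelFourier t x p = Complex.exp (-(Complex.I * ((inner ℝ p.2 x : ℝ) : ℂ))) *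
      (((if p.1 < t then eq.symbol (t - p.1) ‖p.2‖ else 0 : ℝ)) : ℂ) := by
    intro t
    unfold Equation.kernelFourier
    split_ifs <;> simp
  rw [h, h, ← mul_sub, norm_mul, norm_exp_neg_I_mul_ofReal, one_mul, ← Complex.ofReal_sub,
    Complex.norm_real, Real.norm_eq_abs]

theorem lintegral_kernelFourier_wave_sub_time_le {d : ℕ} {T q : ℝ} (hq0 : 0 < q) (hq2 : q < 2)
    {s t : ℝ} (hs : 0 ≤ s) (hst : s ≤ t) (htT : t ≤ T) (x ξ : E d) :
    ∫⁻ r in Set.Ici (0 : ℝ),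
      ‖Equation.wave.kernelFourier t x (r, ξ) - Equation.wave.kernelFourier s x (r, ξ)‖ₑ ^ 2 ≤
      ENNReal.ofReal (T * (2 * T ^ q + 8) * (t - s) ^ (2 - q) * (1 / (1 + ‖ξ‖ ^ q))) := by
  set K : ℝ := (2 * T ^ q + 8) * (t - s) ^ (2 - q) * (1 / (1 + ‖ξ‖ ^ q)) with hK
  have hT : 0 ≤ T := by linarith
  have hts : 0 ≤ t - s := by linarith
  have hK0 : 0 ≤ K := by positivity
  -- The wave symbol vanishes at time 0, so the cutoff r < t is the same as taking the positive part
  -- of t - r. Being 1-Lipschitz, the positive part makes one estimate cover both r < s and s ≤ r <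
  -- t.
  have hS : ∀ t r : ℝ, (if r < t then Equation.wave.symbol (t - r) ‖ξ‖ else 0) =
      Equation.wave.symbol (max (t - r) 0) ‖ξ‖ := by
    intro t r
    split_ifs with h
    · rw [max_eq_left (by linarith)]
    · rw [max_eq_right (by linarith)]; simp [Equation.symbol]
  calc ∫⁻ r in Set.Ici (0 : ℝ),
      ‖Equation.wave.kernelFourier t x (r, ξ) - Equation.wave.kernelFourier s x (r, ξ)‖ₑ ^ 2
      ≤ ∫⁻ r in Set.Ici (0 : ℝ), (Set.Iio T).indicator (fun _ => ENNReal.ofReal K) r := by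
        refine lintegral_mono fun r => ?_
        rw [enorm_sq_eq_ofReal, Equation.norm_kernelFourier_sub_time, sq_abs]
        by_cases h : r < T
        · rw [Set.indicator_of_mem (Set.mem_Iio.2 h)]
          refine ENNReal.ofReal_le_ofReal ?_
          simp only [hS]
          have hmax : |max (t - r) 0 - max (s - r) 0| ≤ t - s := by
            have := abs_max_sub_max_le_abs (t - r) (s - r) 0
            rw [show t - r - (s - r) = t - s by ring, abs_of_nonneg hts] at this
            exact this
          refine (symbol_wave_sub_sq_le hq0 hq2 (norm_nonneg ξ) (hmax.trans
            (by linarith : t - s ≤ T))).trans ?_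
          rw [hK]
          gcongr
        · have h1 : ¬ r < t := fun h' => h (h'.trans_le htT)
          have h2 : ¬ r < s := fun h' => h1 (h'.trans_le hst)
          simp [h1, h2]
    _ = ENNReal.ofReal (K * T) := by
        rw [lintegral_indicator measurableSet_Iio, Measure.restrict_restrict measurableSet_Iio,
          Set.Iio_inter_Ici, setLIntegral_const, Real.volume_Ico, sub_zero,
          ← ENNReal.ofReal_mul hK0]
    _ = _ := by rw [hK]; congr 1; ring

/-- For r < s the increment is the earlier symbol times 1 - e^{-δρ²/2}, whose square is at most
(δρ²)^{1-q/2}. On [s,t) there is no cancellation, but the integral is at most min(δ, 1/ρ²), hence at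
most δ^{1-q/2} ρ^{-q}. Parabolic scaling is what halves the exponent. -/
theorem lintegral_kernelFourier_heat_sub_time_le {d : ℕ} {T q : ℝ} (hq0 : 0 < q) (hq2 : q < 2)
    {s t : ℝ} (hs : 0 ≤ s) (hst : s ≤ t) (htT : t ≤ T) {C : ℝ} (hC0 : 0 ≤ C)
    (hC : ∀ t ∈ Set.Icc 0 T, ∀ ρ : ℝ, 0 ≤ ρ →
      ∫⁻ r in Set.Ico 0 t, ENNReal.ofReal (Equation.heat.symbol (t - r) ρ ^ 2) ≤
        ENNReal.ofReal (C / (1 + ρ ^ 2))) (x ξ : E d) :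
    ∫⁻ r in Set.Ici (0 : ℝ),
      ‖Equation.heat.kernelFourier t x (r, ξ) - Equation.heat.kernelFourier s x (r, ξ)‖ₑ ^ 2 ≤
      ENNReal.ofReal ((2 * C + (2 * T ^ (q / 2) + 2)) * (t - s) ^ (1 - q / 2) *
        (1 / (1 + ‖ξ‖ ^ q))) := by
  set ρ := ‖ξ‖ with hρdef
  have hρ : 0 ≤ ρ := norm_nonneg ξ
  set δ := t - s with hδdef
  have hδ : 0 ≤ δ := by linarith
  have hδT : δ ≤ T := by linarith
  have hT : 0 ≤ T := by linarith
  set K : ℝ := δ ^ (1 - q / 2) * ρ ^ (2 - q) with hK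
  have hK0 : 0 ≤ K := by positivity
  have hsq : (1 - Real.exp (-(δ * ρ ^ 2 / 2))) ^ 2 ≤ K := by
    set y := δ * ρ ^ 2 / 2 with hy
    have hy0 : 0 ≤ y := by positivity
    have h1 : 0 ≤ 1 - Real.exp (-y) := by
      have : Real.exp (-y) ≤ 1 := by rw [Real.exp_le_one_iff]; linarith
      linarith
    have h2 : 1 - Real.exp (-y) ≤ min (δ * ρ ^ 2) 1 := by
      refine le_min ?_ (by linarith [Real.exp_pos (-y)])
      have := Real.add_one_le_exp (-y)
      have h3 : y ≤ δ * ρ ^ 2 := half_le_self (by positivity)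
      linarith
    calc (1 - Real.exp (-y)) ^ 2 ≤ (min (δ * ρ ^ 2) 1) ^ 2 := by gcongr
      _ ≤ (δ * ρ ^ 2) ^ (1 - q / 2) := min_sq_le_rpow (by positivity) (by linarith) (by linarith)
      _ = K := by
        rw [Real.mul_rpow hδ (by positivity), ← Real.rpow_natCast_mul hρ]
        congr 2
        push_cast
        ring
  have hpt : ∀ r, ‖Equation.heat.kernelFourier t x (r, ξ) -
      Equation.heat.kernelFourier s x (r, ξ)‖ₑ ^ 2 ≤
      (Set.Iio s).indicator (fun r => ENNReal.ofReal K *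
        ENNReal.ofReal (Equation.heat.symbol (s - r) ρ ^ 2)) r +
      (Set.Ico s t).indicator (fun r => ENNReal.ofReal (Real.exp (-((t - r) * ρ ^ 2)))) r := by
    intro r
    rw [enorm_sq_eq_ofReal, Equation.norm_kernelFourier_sub_time, sq_abs]
    by_cases h1 : r < s
    · have h2 : r < t := h1.trans_le hst
      rw [Set.indicator_of_mem (Set.mem_Iio.2 h1),
        Set.indicator_of_notMem (fun h => absurd h.1 (not_le.2 h1)), add_zero,
        ← ENNReal.ofReal_mul hK0]
      simp only [h1, h2, if_true]
      refine ENNReal.ofReal_le_ofReal ?_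
      have h3 : Equation.heat.symbol (t - r) ‖ξ‖ =
          Equation.heat.symbol (s - r) ρ * Real.exp (-(δ * ρ ^ 2 / 2)) := by
        simp only [Equation.symbol, ← Real.exp_add]
        congr 1
        ring
      rw [h3]
      calc (Equation.heat.symbol (s - r) ρ * Real.exp (-(δ * ρ ^ 2 / 2)) -
          Equation.heat.symbol (s - r) ρ) ^ 2
          = (1 - Real.exp (-(δ * ρ ^ 2 / 2))) ^ 2 * Equation.heat.symbol (s - r) ρ ^ 2 := by ring
        _ ≤ _ := by gcongr
    · rw [Set.indicator_of_notMem (by simpa using h1), zero_add]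
      by_cases h2 : r < t
      · rw [Set.indicator_of_mem (show r ∈ Set.Ico s t from ⟨not_lt.1 h1, h2⟩)]
        simp only [h1, h2, if_true, if_false, sub_zero]
        rw [symbol_heat_sq]
      · simp [h1, h2]
  have hsecond : ∫⁻ r in Set.Ico s t, ENNReal.ofReal (Real.exp (-((t - r) * ρ ^ 2))) ≤
      ENNReal.ofReal ((2 * T ^ (q / 2) + 2) * δ ^ (1 - q / 2) * (1 / (1 + ρ ^ q))) := by
    have e1 := lintegral_exp_le (a := s) (b := t) (sq_nonneg ρ)
    have e2 := mul_lintegral_exp_le hst (sq_nonneg ρ)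
    have hθ : δ = δ ^ (1 - q / 2) * δ ^ (q / 2) := by
      rw [← Real.rpow_add_of_nonneg hδ (by linarith) (by linarith)]
      simp
    rcases le_total ρ 1 with h | h
    · refine e1.trans (ENNReal.ofReal_le_ofReal ?_)
      have h4 := one_le_mul_one_div_one_add_rpow hq0 hρ h
      calc t - s = δ ^ (1 - q / 2) * δ ^ (q / 2) := hθ
        _ ≤ δ ^ (1 - q / 2) * T ^ (q / 2) := by gcongr
        _ ≤ δ ^ (1 - q / 2) * T ^ (q / 2) * (2 * (1 / (1 + ρ ^ q))) :=
          le_mul_of_one_le_right (by positivity) h4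
        _ = 2 * T ^ (q / 2) * δ ^ (1 - q / 2) * (1 / (1 + ρ ^ q)) := by ring
        _ ≤ _ := by gcongr; linarith
    · have hρ0 : 0 < ρ := by linarith
      have e3 := ENNReal_le_ofReal_div (B := 1) (by positivity : 0 < ρ ^ 2) (by simpa using e2)
      have h5 := one_div_rpow_le hq0 h
      have hfin : min δ (1 / ρ ^ 2) ≤ δ ^ (1 - q / 2) * (1 / ρ ^ q) := by
        have hm0 : 0 ≤ min δ (1 / ρ ^ 2) := le_min hδ (by positivity)
        have hθ' : min δ (1 / ρ ^ 2) = min δ (1 / ρ ^ 2) ^ (1 - q / 2) *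
            min δ (1 / ρ ^ 2) ^ (q / 2) := by
          rw [← Real.rpow_add_of_nonneg hm0 (by linarith) (by linarith)]
          simp
        have h6 : (1 / ρ ^ 2) ^ (q / 2) = 1 / ρ ^ q := by
          rw [Real.div_rpow zero_le_one (by positivity), Real.one_rpow,
            ← Real.rpow_natCast_mul hρ]
          congr 2
          push_cast
          ring
        rw [hθ', ← h6]
        have h7 : (0 : ℝ) ≤ 1 - q / 2 := by linarith
        gcongr
        · exact min_le_left _ _
        · exact min_le_right _ _
      have hmin : ∫⁻ r in Set.Ico s t, ENNReal.ofReal (Real.exp (-((t - r) * ρ ^ 2))) ≤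
          ENNReal.ofReal (min δ (1 / ρ ^ 2)) := by
        rw [ENNReal.ofReal_min]
        exact le_min e1 e3
      refine hmin.trans (ENNReal.ofReal_le_ofReal (hfin.trans ?_))
      calc δ ^ (1 - q / 2) * (1 / ρ ^ q) ≤ δ ^ (1 - q / 2) * (2 * (1 / (1 + ρ ^ q))) := by gcongr
        _ = 2 * δ ^ (1 - q / 2) * (1 / (1 + ρ ^ q)) := by ring
        _ ≤ _ := by
          have : 0 ≤ T ^ (q / 2) := by positivity
          gcongr; linarith
  calc ∫⁻ r in Set.Ici (0 : ℝ),
      ‖Equation.heat.kernelFourier t x (r, ξ) - Equation.heat.kernelFourier s x (r, ξ)‖ₑ ^ 2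
      ≤ ∫⁻ r in Set.Ici (0 : ℝ), ((Set.Iio s).indicator (fun r => ENNReal.ofReal K *
        ENNReal.ofReal (Equation.heat.symbol (s - r) ρ ^ 2)) r +
      (Set.Ico s t).indicator (fun r => ENNReal.ofReal (Real.exp (-((t - r) * ρ ^ 2)))) r) :=
        lintegral_mono hpt
    _ = (ENNReal.ofReal K * ∫⁻ r in Set.Ico 0 s,
          ENNReal.ofReal (Equation.heat.symbol (s - r) ρ ^ 2)) +
        ∫⁻ r in Set.Ico s t, ENNReal.ofReal (Real.exp (-((t - r) * ρ ^ 2))) := by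
        rw [lintegral_add_right _ (Measurable.indicator (by fun_prop) measurableSet_Ico),
          setLIntegral_indicator measurableSet_Iio, Set.Iio_inter_Ici,
          setLIntegral_indicator measurableSet_Ico, lintegral_const_mul' _ _ ENNReal.ofReal_ne_top,
          Set.inter_eq_left.2 (Set.Ico_subset_Ici_self.trans (Set.Ici_subset_Ici.2 hs))]
    _ ≤ ENNReal.ofReal K * ENNReal.ofReal (C / (1 + ρ ^ 2)) +
        ENNReal.ofReal ((2 * T ^ (q / 2) + 2) * δ ^ (1 - q / 2) * (1 / (1 + ρ ^ q))) := by
        gcongr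
        exact hC s ⟨hs, hst.trans htT⟩ ρ hρ
    _ ≤ _ := by
        rw [← ENNReal.ofReal_mul hK0, ← ENNReal.ofReal_add (by positivity) (by positivity)]
        refine ENNReal.ofReal_le_ofReal ?_
        have := rpow_div_one_add_sq_le hq0 hq2 hρ
        have h8 : K * (C / (1 + ρ ^ 2)) ≤ 2 * C * δ ^ (1 - q / 2) * (1 / (1 + ρ ^ q)) := by
          calc K * (C / (1 + ρ ^ 2)) = C * δ ^ (1 - q / 2) * (ρ ^ (2 - q) / (1 + ρ ^ 2)) := by
                rw [hK]; ring
            _ ≤ C * δ ^ (1 - q / 2) * (2 * (1 / (1 + ρ ^ q))) := by gcongr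
            _ = _ := by ring
        calc _ ≤ 2 * C * δ ^ (1 - q / 2) * (1 / (1 + ρ ^ q)) +
            (2 * T ^ (q / 2) + 2) * δ ^ (1 - q / 2) * (1 / (1 + ρ ^ q)) := by gcongr
          _ = _ := by ring

theorem Equation.eLpNorm_kernelFourier_sub_time_sq_le (eq : Equation) {d : ℕ} {T q : ℝ}
    (hT : 0 ≤ T) (hq0 : 0 < q) (hq2 : q < 2) : ∃ C : ℝ, 0 ≤ C ∧
      ∀ (μ : Measure (E d)) [SFinite μ], ∀ s ∈ Set.Icc 0 T, ∀ t ∈ Set.Icc 0 T, ∀ x : E d,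
        eLpNorm (fun p => eq.kernelFourier t x p - eq.kernelFourier s x p) 2 (noiseMeasure μ) ^ 2 ≤
          ENNReal.ofReal (C * |t - s| ^ eq.timeExponent q) *
            ∫⁻ ξ, ENNReal.ofReal (1 / (1 + ‖ξ‖ ^ q)) ∂μ := by
  suffices h : ∃ C : ℝ, 0 ≤ C ∧
      ∀ (μ : Measure (E d)) [SFinite μ], ∀ s ∈ Set.Icc 0 T, ∀ t ∈ Set.Icc 0 T, s ≤ t → ∀ x : E d,
        eLpNorm (fun p => eq.kernelFourier t x p - eq.kernelFourier s x p) 2 (noiseMeasure μ) ^ 2 ≤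
          ENNReal.ofReal (C * |t - s| ^ eq.timeExponent q) *
            ∫⁻ ξ, ENNReal.ofReal (1 / (1 + ‖ξ‖ ^ q)) ∂μ by
    obtain ⟨C, hC0, hC⟩ := h
    refine ⟨C, hC0, fun μ _ s hs t ht x => ?_⟩
    rcases le_total s t with hst | hst
    · exact hC μ s hs t ht hst x
    · rw [abs_sub_comm]
      have := hC μ t ht s hs hst x
      change eLpNorm (eq.kernelFourier t x - eq.kernelFourier s x) 2 (noiseMeasure μ) ^ 2 ≤ _
      rw [eLpNorm_sub_comm]
      exact this
  obtain ⟨C, hC0, hC⟩ := eq.lintegral_symbol_sq_le hT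
  cases eq
  · refine ⟨T * (2 * T ^ q + 8), by positivity, fun μ _ s hs t ht hst x => ?_⟩
    refine eLpNorm_two_sq_noiseMeasure_le ((Equation.measurable_kernelFourier _ t x).sub
      (Equation.measurable_kernelFourier _ s x)) (by positivity) fun ξ => ?_
    rw [abs_of_nonneg (by linarith), Equation.timeExponent]
    exact lintegral_kernelFourier_wave_sub_time_le hq0 hq2 hs.1 hst ht.2 x ξ
  · refine ⟨2 * C + (2 * T ^ (q / 2) + 2), by positivity, fun μ _ s hs t ht hst x => ?_⟩
    refine eLpNorm_two_sq_noiseMeasure_le ((Equation.measurable_kernelFourier _ t x).sub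
      (Equation.measurable_kernelFourier _ s x)) (by positivity) fun ξ => ?_
    rw [abs_of_nonneg (by linarith), Equation.timeExponent]
    exact lintegral_kernelFourier_heat_sub_time_le hq0 hq2 hs.1 hst ht.2 hC0 hC x ξ

/-! ### Chaining along dyadic points -/

section Chaining

variable {ι : Type*} [Fintype ι]

/-- The dyadic point `j / 2 ^ k`. -/
noncomputable def dyadic (k : ℕ) (j : ι → ℤ) : ι → ℝ := fun i => (j i : ℝ) / 2 ^ k

/-- Coordinatewise integer part of `2 ^ k * p`. -/
noncomputable def dyadicFloor (k : ℕ) (p : ι → ℝ) : ι → ℤ := fun i => ⌊2 ^ k * p i⌋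

/-- Neighbouring dyadic points of level `k` in the cube `[-N, N] ^ ι`. -/
def IsNeighbour (N k : ℕ) (j j' : ι → ℤ) : Prop :=
  ∀ i, |j i| ≤ N * 2 ^ k ∧ |j' i| ≤ N * 2 ^ k ∧ |j i - j' i| ≤ 1

/-- The increments of `f` between neighbouring dyadic points of the cube `[-N, N] ^ ι` are bounded
by `c * r ^ k` at level `k`. -/
def DyadicBound (r : ℝ) (N : ℕ) (c : ℝ) (f : (ι → ℝ) → ℝ) : Prop :=
  ∀ k j j', IsNeighbour N k j j' → |f (dyadic k j) - f (dyadic k j')| ≤ c * r ^ k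

theorem abs_dyadicFloor_le {N k : ℕ} {p : ι → ℝ} (hp : ‖p‖ ≤ N) (i : ι) :
    |dyadicFloor k p i| ≤ N * 2 ^ k := by
  have h := abs_le.1 ((norm_le_pi_norm p i).trans hp)
  have h2 : (0 : ℝ) < 2 ^ k := by positivity
  rw [abs_le]
  constructor
  · refine Int.le_floor.2 ?_
    push_cast
    nlinarith [h.1]
  · have : (dyadicFloor k p i : ℝ) ≤ N * 2 ^ k :=
      (Int.floor_le _).trans (by nlinarith [h.2])
    exact_mod_cast this

theorem isNeighbour_dyadicFloor {N k : ℕ} {p p' : ι → ℝ} (hp : ‖p‖ ≤ N) (hp' : ‖p'‖ ≤ N)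
    (h : dist p p' ≤ (1 / 2) ^ k) : IsNeighbour N k (dyadicFloor k p) (dyadicFloor k p') := by
  refine fun i => ⟨abs_dyadicFloor_le hp i, abs_dyadicFloor_le hp' i, ?_⟩
  have h2 : (0 : ℝ) < 2 ^ k := by positivity
  have h1 : |p i - p' i| ≤ (1 / 2) ^ k := by
    rw [← Real.dist_eq]; exact (dist_le_pi_dist p p' i).trans h
  have h3 : |2 ^ k * p i - 2 ^ k * p' i| ≤ 1 := by
    rw [← mul_sub, abs_mul, abs_of_pos h2]
    calc 2 ^ k * |p i - p' i| ≤ 2 ^ k * (1 / 2) ^ k := by gcongr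
      _ = 1 := by rw [← mul_pow]; norm_num
  have ha := abs_le.1 h3
  have f1 := Int.floor_le (2 ^ k * p i)
  have f2 := Int.lt_floor_add_one (2 ^ k * p i)
  have f3 := Int.floor_le (2 ^ k * p' i)
  have f4 := Int.lt_floor_add_one (2 ^ k * p' i)
  have l1 : (dyadicFloor k p i : ℝ) - dyadicFloor k p' i < 2 := by
    simp only [dyadicFloor]; linarith [ha.2]
  have l2 : (dyadicFloor k p' i : ℝ) - dyadicFloor k p i < 2 := by
    simp only [dyadicFloor]; linarith [ha.1]
  have l1' : dyadicFloor k p i - dyadicFloor k p' i < 2 := by exact_mod_cast l1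
  have l2' : dyadicFloor k p' i - dyadicFloor k p i < 2 := by exact_mod_cast l2
  rw [abs_le]; omega

/-- The integer part of 2y is either 2⌊y⌋ or 2⌊y⌋ + 1. So the level k approximation, read at level k
+ 1, neighbours the next one. -/
theorem isNeighbour_dyadicFloor_succ {N k : ℕ} {p : ι → ℝ} (hp : ‖p‖ ≤ N) :
    IsNeighbour N (k + 1) (fun i => 2 * dyadicFloor k p i) (dyadicFloor (k + 1) p) := by
  refine fun i => ⟨?_, abs_dyadicFloor_le hp i, ?_⟩
  · have := abs_dyadicFloor_le (k := k) hp i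
    rw [abs_mul, abs_two, pow_succ]; linarith
  · have h1 := Int.floor_le (2 ^ k * p i)
    have h2 := Int.lt_floor_add_one (2 ^ k * p i)
    have h3 : 2 * dyadicFloor k p i ≤ dyadicFloor (k + 1) p i := by
      refine Int.le_floor.2 ?_
      simp only [dyadicFloor]
      push_cast
      rw [pow_succ]; linarith
    have h4 : dyadicFloor (k + 1) p i < 2 * dyadicFloor k p i + 2 := by
      refine Int.floor_lt.2 ?_
      simp only [dyadicFloor]
      push_cast
      rw [pow_succ]; linarith
    rw [abs_le]; dsimp only; omega

theorem dyadic_two_mul (k : ℕ) (j : ι → ℤ) : dyadic (k + 1) (fun i => 2 * j i) = dyadic k j := by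
  funext i
  simp only [dyadic]
  push_cast
  rw [pow_succ']
  field_simp

theorem dist_dyadic_le {N k : ℕ} {j j' : ι → ℤ} (h : IsNeighbour N k j j') :
    dist (dyadic k j) (dyadic k j') ≤ (1 / 2) ^ k := by
  refine (dist_pi_le_iff (by positivity)).2 fun i => ?_
  have h1 : |(j i : ℝ) - j' i| ≤ 1 := by exact_mod_cast (h i).2.2
  rw [Real.dist_eq]
  simp only [dyadic]
  rw [← sub_div, abs_div, abs_of_pos (by positivity : (0 : ℝ) < 2 ^ k), one_div, inv_pow,
    div_eq_mul_inv]
  exact mul_le_of_le_one_left (by positivity) h1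

theorem dist_dyadic_dyadicFloor_le (k : ℕ) (p : ι → ℝ) :
    dist (dyadic k (dyadicFloor k p)) p ≤ (1 / 2) ^ k := by
  refine (dist_pi_le_iff (by positivity)).2 fun i => ?_
  have h2 : (0 : ℝ) < 2 ^ k := by positivity
  have h3 := Int.floor_le (2 ^ k * p i)
  have h4 := Int.lt_floor_add_one (2 ^ k * p i)
  rw [Real.dist_eq]
  simp only [dyadic, dyadicFloor]
  have : (⌊2 ^ k * p i⌋ : ℝ) / 2 ^ k - p i = (⌊2 ^ k * p i⌋ - 2 ^ k * p i) / 2 ^ k := by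
    field_simp
  rw [this, abs_div, abs_of_pos h2, one_div, inv_pow, div_eq_mul_inv]
  refine mul_le_of_le_one_left (by positivity) ?_
  rw [abs_le]; constructor <;> linarith

theorem tendsto_dyadic_dyadicFloor (p : ι → ℝ) :
    Tendsto (fun k => dyadic k (dyadicFloor k p)) atTop (𝓝 p) := by
  rw [tendsto_iff_dist_tendsto_zero]
  exact squeeze_zero (fun _ => dist_nonneg) (fun k => dist_dyadic_dyadicFloor_le k p)
    (tendsto_pow_atTop_nhds_zero_of_lt_one (by norm_num) (by norm_num))

namespace DyadicBound

variable {r c : ℝ} {N : ℕ} {f : (ι → ℝ) → ℝ}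

theorem dist_succ_le (h : DyadicBound r N c f) {p : ι → ℝ} (hp : ‖p‖ ≤ N) (k : ℕ) :
    dist (f (dyadic k (dyadicFloor k p))) (f (dyadic (k + 1) (dyadicFloor (k + 1) p))) ≤
      c * r * r ^ k := by
  rw [Real.dist_eq, ← dyadic_two_mul]
  exact (h _ _ _ (isNeighbour_dyadicFloor_succ hp)).trans_eq (by ring)

theorem exists_tendsto (h : DyadicBound r N c f) (hr : r < 1) {p : ι → ℝ} (hp : ‖p‖ ≤ N) :
    ∃ a, Tendsto (fun k => f (dyadic k (dyadicFloor k p))) atTop (𝓝 a) :=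
  cauchySeq_tendsto_of_complete (cauchySeq_of_le_geometric r _ hr (h.dist_succ_le hp))

/-- Chaining: the limits of `f` along dyadic points inherit a modulus of continuity. -/
theorem abs_sub_le (h : DyadicBound r N c f) (hr0 : 0 ≤ r) (hr : r < 1) (hc : 0 ≤ c)
    {p p' : ι → ℝ} (hp : ‖p‖ ≤ N) (hp' : ‖p'‖ ≤ N) {k : ℕ} (hd : dist p p' ≤ (1 / 2) ^ k)
    {a a' : ℝ} (ha : Tendsto (fun k => f (dyadic k (dyadicFloor k p))) atTop (𝓝 a))
    (ha' : Tendsto (fun k => f (dyadic k (dyadicFloor k p'))) atTop (𝓝 a')) :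
    |a - a'| ≤ 2 * c / (1 - r) * r ^ k := by
  -- Three legs: down from p to its level k approximation, across to a neighbour, and up to p'. The
  -- outer two are geometric tails.
  have h1 := dist_le_of_le_geometric_of_tendsto r _ hr (h.dist_succ_le hp) ha k
  have h2 := dist_le_of_le_geometric_of_tendsto r _ hr (h.dist_succ_le hp') ha' k
  have h3 := h k _ _ (isNeighbour_dyadicFloor hp hp' hd)
  rw [← Real.dist_eq] at h3 ⊢
  have hr' : 0 < 1 - r := by linarith
  calc dist a a' ≤ dist (f (dyadic k (dyadicFloor k p))) a +
        dist (f (dyadic k (dyadicFloor k p))) (f (dyadic k (dyadicFloor k p'))) +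
        dist (f (dyadic k (dyadicFloor k p'))) a' := by
          rw [dist_comm _ a]; exact dist_triangle4 _ _ _ _
    _ ≤ c * r * r ^ k / (1 - r) + c * r ^ k + c * r * r ^ k / (1 - r) := by gcongr
    _ = (c * (1 + r)) * r ^ k / (1 - r) := by field_simp; ring
    _ ≤ (c * 2) * r ^ k / (1 - r) := by gcongr; linarith
    _ = _ := by ring

end DyadicBound

/-- The number of pairs of neighbours is at most `(3 (2N+1) 2^k)^card ι`. -/
theorem exists_finset_isNeighbour (N k : ℕ) : ∃ S : Finset ((ι → ℤ) × (ι → ℤ)),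
    (∀ j j', IsNeighbour N k j j' → (j, j') ∈ S) ∧ (∀ x ∈ S, IsNeighbour N k x.1 x.2) ∧
      S.card ≤ (3 * (2 * N + 1)) ^ Fintype.card ι * (2 ^ Fintype.card ι) ^ k := by
  classical
  let A : Finset (ι → ℤ) := Fintype.piFinset fun _ => Finset.Icc (-(N * 2 ^ k : ℤ)) (N * 2 ^ k)
  let B : Finset (ι → ℤ) := Fintype.piFinset fun _ => Finset.Icc (-1 : ℤ) 1
  -- A pair is encoded by its first point and a difference in {-1, 0, 1}^ι, so that the count grows
  -- like (2^k)^card ι and not its square.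
  let S := ((A ×ˢ B).image fun x => (x.1, x.1 - x.2)).filter fun x => IsNeighbour N k x.1 x.2
  refine ⟨S, fun j j' h => ?_, fun x hx => (Finset.mem_filter.1 hx).2, ?_⟩
  · refine Finset.mem_filter.2 ⟨Finset.mem_image.2 ⟨(j, j - j'), ?_, by simp⟩, h⟩
    simp only [Finset.mem_product, Fintype.mem_piFinset, Finset.mem_Icc, A, B, Pi.sub_apply]
    exact ⟨fun i => abs_le.1 (h i).1, fun i => abs_le.1 (h i).2.2⟩
  · refine (Finset.card_filter_le _ _).trans (Finset.card_image_le.trans ?_)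
    rw [Finset.card_product, Fintype.card_piFinset, Fintype.card_piFinset]
    simp only [Int.card_Icc, Finset.prod_const, Finset.card_univ]
    have h1 : ((1 : ℤ) + 1 - -1).toNat = 3 := rfl
    have h2 : ((N * 2 ^ k : ℤ) + 1 - -(N * 2 ^ k)).toNat = 2 * N * 2 ^ k + 1 := by
      have : ((N * 2 ^ k : ℤ) + 1 - -(N * 2 ^ k)) = ((2 * N * 2 ^ k + 1 : ℕ) : ℤ) := by
        push_cast; ring
      rw [this, Int.toNat_natCast]
    rw [h1, h2, ← mul_pow, ← pow_mul, mul_comm (Fintype.card ι) k, pow_mul, ← mul_pow]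
    refine Nat.pow_le_pow_left ?_ _
    have : 1 ≤ 2 ^ k := Nat.one_le_two_pow
    nlinarith

end Chaining

/-! ### Union bound over dyadic increments -/

section Probability

variable {ι : Type*} [Fintype ι] {Ω : Type*} [MeasurableSpace Ω] {P : Measure Ω}

open scoped ENNReal

/-- Markov's inequality gives C s^k / (c r^k)^m for each pair of neighbours at level k, and there
are at most a constant times (2^card ι)^k pairs. The union bound is a geometric series. -/
theorem measure_not_dyadicBound_le {u : (ι → ℝ) → Ω → ℝ} {m : ℕ} {C s : ℝ≥0∞} {r : ℝ}
    (hr : 0 < r) (hu : ∀ p, AEStronglyMeasurable (u p) P)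
    (hC : ∀ k p p', dist p p' ≤ (1 / 2) ^ k → ∫⁻ ω, ‖u p ω - u p' ω‖ₑ ^ m ∂P ≤ C * s ^ k)
    (N : ℕ) {c : ℝ} (hc : 0 < c) :
    P {ω | ¬ DyadicBound r N c (fun p => u p ω)} ≤
      (3 * (2 * N + 1)) ^ Fintype.card ι * C * (∑' k : ℕ, (2 ^ Fintype.card ι * s /
        ENNReal.ofReal r ^ m) ^ k) / ENNReal.ofReal c ^ m := by
  classical
  choose S hS1 hS2 hS3 using fun k => exists_finset_isNeighbour (ι := ι) N k
  have hsub : {ω | ¬ DyadicBound r N c (fun p => u p ω)} ⊆ ⋃ k, ⋃ x ∈ S k,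
      {ω | ENNReal.ofReal (c * r ^ k) ^ m ≤
        ‖u (dyadic k x.1) ω - u (dyadic k x.2) ω‖ₑ ^ m} := by
    intro ω hω
    simp only [DyadicBound, Set.mem_ofPred_eq, not_forall, not_le] at hω
    obtain ⟨k, j, j', hn, hlt⟩ := hω
    refine Set.mem_iUnion.2 ⟨k, Set.mem_iUnion₂.2 ⟨(j, j'), hS1 k _ _ hn, ?_⟩⟩
    simp only [Set.mem_ofPred_eq]
    gcongr
    rw [← ofReal_norm, Real.norm_eq_abs]
    exact ENNReal.ofReal_le_ofReal hlt.le
  refine (measure_mono hsub).trans ((measure_iUnion_le _).trans ?_)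
  have hterm : ∀ k, P (⋃ x ∈ S k, {ω | ENNReal.ofReal (c * r ^ k) ^ m ≤
        ‖u (dyadic k x.1) ω - u (dyadic k x.2) ω‖ₑ ^ m}) ≤
      ((3 * (2 * N + 1)) ^ Fintype.card ι * C / ENNReal.ofReal c ^ m) *
        (2 ^ Fintype.card ι * s / ENNReal.ofReal r ^ m) ^ k := by
    intro k
    have hpos : ENNReal.ofReal (c * r ^ k) ^ m ≠ 0 :=
      pow_ne_zero _ (ENNReal.ofReal_pos.2 (by positivity)).ne'
    have htop : ENNReal.ofReal (c * r ^ k) ^ m ≠ ∞ := ENNReal.pow_ne_top ENNReal.ofReal_ne_top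
    refine (measure_biUnion_finset_le _ _).trans ?_
    have hone : ∀ x ∈ S k, P {ω | ENNReal.ofReal (c * r ^ k) ^ m ≤
        ‖u (dyadic k x.1) ω - u (dyadic k x.2) ω‖ₑ ^ m} ≤
        C * s ^ k / ENNReal.ofReal (c * r ^ k) ^ m := by
      intro x hx
      rw [ENNReal.le_div_iff_mul_le (Or.inl hpos) (Or.inl htop), mul_comm]
      refine (mul_meas_ge_le_lintegral₀ (((hu _).sub (hu _)).enorm.pow_const m) _).trans ?_
      exact hC k _ _ (dist_dyadic_le (hS2 k x hx))
    refine (Finset.sum_le_sum hone).trans ?_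
    rw [Finset.sum_const, nsmul_eq_mul]
    calc ((S k).card : ℝ≥0∞) * (C * s ^ k / ENNReal.ofReal (c * r ^ k) ^ m)
        ≤ (((3 * (2 * N + 1)) ^ Fintype.card ι * (2 ^ Fintype.card ι) ^ k : ℕ) : ℝ≥0∞) *
          (C * s ^ k / ENNReal.ofReal (c * r ^ k) ^ m) := by
          gcongr; exact hS3 k
      _ = _ := by
          have hinv : (ENNReal.ofReal (c * r ^ k) ^ m)⁻¹ =
              (ENNReal.ofReal c ^ m)⁻¹ * ((ENNReal.ofReal r ^ m)⁻¹) ^ k := by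
            rw [ENNReal.ofReal_mul hc.le, ENNReal.ofReal_pow hr.le, mul_pow,
              ENNReal.mul_inv (Or.inr (by finiteness)) (Or.inl (by finiteness)), ← pow_mul,
              mul_comm k m, pow_mul, ENNReal.inv_pow (n := k)]
          simp only [div_eq_mul_inv]
          rw [hinv]
          push_cast
          ring
  refine (ENNReal.tsum_le_tsum hterm).trans_eq ?_
  rw [ENNReal.tsum_mul_left]
  simp only [div_eq_mul_inv]
  ring

theorem tsum_geometric_ne_top {θ : ℝ≥0∞} (hθ : θ < 1) : ∑' k : ℕ, θ ^ k ≠ ∞ := by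
  rw [ENNReal.tsum_geometric]
  exact ENNReal.inv_ne_top.2 (tsub_pos_of_lt hθ).ne'

/-- Uniformly over all processes with the given moment bounds, the dyadic bounds hold with high
probability for large constants. -/
theorem exists_measure_not_dyadicBound_le {m : ℕ} (hm : m ≠ 0) {C s : ℝ≥0∞} {r : ℝ} (hr : 0 < r)
    (hC : C ≠ ∞) (hs : 2 ^ Fintype.card ι * s / ENNReal.ofReal r ^ m < 1) (N : ℕ) {ε : ℝ≥0∞}
    (hε : ε ≠ 0) :
    ∃ c : ℝ, 0 < c ∧ ∀ u : (ι → ℝ) → Ω → ℝ, (∀ p, AEStronglyMeasurable (u p) P) →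
      (∀ k p p', dist p p' ≤ (1 / 2) ^ k → ∫⁻ ω, ‖u p ω - u p' ω‖ₑ ^ m ∂P ≤ C * s ^ k) →
      P {ω | ¬ DyadicBound r N c (fun p => u p ω)} ≤ ε := by
  set D : ℝ≥0∞ := (3 * (2 * N + 1)) ^ Fintype.card ι * C * (∑' k : ℕ, (2 ^ Fintype.card ι * s /
        ENNReal.ofReal r ^ m) ^ k) with hD
  have hDtop : D ≠ ∞ := by
    refine ENNReal.mul_ne_top (ENNReal.mul_ne_top ?_ hC) (tsum_geometric_ne_top hs)
    finiteness
  rcases eq_or_ne ε ∞ with rfl | hεt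
  · exact ⟨1, one_pos, fun _ _ _ => le_top⟩
  -- D depends neither on u nor on c. With c = n + 1 and n > D/ε, dividing by c^m ≥ n brings the
  -- bound below ε.
  obtain ⟨n, hn⟩ := ENNReal.exists_nat_gt (ENNReal.div_ne_top hDtop hε)
  refine ⟨n + 1, by positivity, fun u hu h =>
    (measure_not_dyadicBound_le hr hu h N (by positivity)).trans ?_⟩
  rw [← hD]
  have h1 : ENNReal.ofReal ((n : ℝ) + 1) = n + 1 := by
    rw [ENNReal.ofReal_add (by positivity) zero_le_one]; simp
  rw [h1]
  refine ENNReal.div_le_of_le_mul ?_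
  have h2 : D ≤ n * ε := by
    rw [← ENNReal.div_le_iff_le_mul (Or.inl hε) (Or.inl hεt)]; exact hn.le
  refine h2.trans ?_
  rw [mul_comm]
  gcongr
  calc (n : ℝ≥0∞) ≤ n + 1 := le_self_add
    _ = (n + 1) ^ 1 := (pow_one _).symm
    _ ≤ (n + 1) ^ m := pow_le_pow_right₀ le_add_self (Nat.one_le_iff_ne_zero.2 hm)

end Probability

/-! ### Borel measurability of random continuous functions -/

open scoped ENNReal

/-- Random elements of `C(X, ℝ)` are measurable for the Borel σ-algebra as soon as all evaluations
are. -/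
theorem measurable_of_measurable_eval {Ω X : Type*} [MeasurableSpace Ω] [TopologicalSpace X]
    [SecondCountableTopology X] [LocallyCompactSpace X] [MeasurableSpace C(X, ℝ)]
    [BorelSpace C(X, ℝ)] {V : Ω → C(X, ℝ)} (hV : ∀ x, Measurable fun ω => V ω x) :
    Measurable V := by
  have hb : ‹MeasurableSpace C(X, ℝ)› = _ := (BorelSpace.measurable_eq (α := C(X, ℝ))).trans
    (borel_eq_generateFrom_of_subbasis ContinuousMap.compactOpen_eq)
  rw [hb]
  refine measurable_generateFrom ?_
  rintro _ ⟨K, hK, U, hU, rfl⟩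
  rw [Set.mem_ofPred_eq] at hK hU
  -- The distance to the empty set is 0 by convention, so U = univ is treated apart.
  by_cases hUne : (Uᶜ).Nonempty
  swap
  · have : U = Set.univ := by simpa [Set.not_nonempty_iff_eq_empty] using hUne
    simp [this, Set.mapsTo_univ]
  obtain ⟨D, hDc, hDd⟩ := TopologicalSpace.exists_countable_dense K
  -- By compactness, mapping K into U means keeping a uniform positive distance from the complement,
  -- and by continuity this can be checked on a countable dense subset.
  have key : V ⁻¹' {f | Set.MapsTo f K U} =
      ⋃ n : ℕ, ⋂ x ∈ D, {ω | 1 / ((n : ℝ) + 1) ≤ Metric.infDist (V ω x) Uᶜ} := by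
    ext ω
    have hcont : Continuous fun x : K => Metric.infDist (V ω x) Uᶜ :=
      (Metric.continuous_infDist_pt _).comp ((V ω).continuous.comp continuous_subtype_val)
    simp only [Set.mem_preimage, Set.mem_ofPred_eq, Set.mem_iUnion, Set.mem_iInter]
    constructor
    · intro h
      rcases K.eq_empty_or_nonempty with rfl | hKne
      · exact ⟨0, fun x => absurd x.2 (Set.notMem_empty _)⟩
      have : CompactSpace K := isCompact_iff_compactSpace.1 hK
      have : Nonempty K := hKne.to_subtype
      obtain ⟨x0, -, hx0⟩ := isCompact_univ.exists_isMinOn (Set.univ_nonempty (α := K))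
        hcont.continuousOn
      have hpos : 0 < Metric.infDist (V ω x0) Uᶜ :=
        (hU.isClosed_compl.notMem_iff_infDist_pos hUne).1 (by simpa using h x0.2)
      obtain ⟨n, hn⟩ := exists_nat_one_div_lt hpos
      exact ⟨n, fun x _ => hn.le.trans (hx0 (Set.mem_univ x))⟩
    · rintro ⟨n, hn⟩ x hx
      have hcl : IsClosed {x : K | 1 / ((n : ℝ) + 1) ≤ Metric.infDist (V ω x) Uᶜ} :=
        isClosed_le continuous_const hcont
      have hall := hcl.closure_subset_iff.2 (fun x hx => hn x hx : D ⊆ _) (hDd ⟨x, hx⟩)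
      have : V ω x ∉ Uᶜ := (hU.isClosed_compl.notMem_iff_infDist_pos hUne).2
        (lt_of_lt_of_le (by positivity) hall)
      simpa using this
  rw [key]
  refine MeasurableSet.iUnion fun n => MeasurableSet.biInter hDc fun x _ => ?_
  exact measurableSet_le measurable_const
    ((Metric.continuous_infDist_pt _).measurable.comp (hV x))

/-! ### Moduli of continuity and compact sets of paths -/

section Modulus

variable {ι : Type*} [Fintype ι]

/-- A Hölder type modulus of continuity on each cube `[-N, N] ^ ι`. -/
def HasModulus (r : ℝ) (R : ℕ → ℝ) (g : (ι → ℝ) → ℝ) : Prop :=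
  ∀ (N k : ℕ) p p', ‖p‖ ≤ N → ‖p'‖ ≤ N → dist p p' ≤ (1 / 2) ^ k → |g p - g p'| ≤ R N * r ^ k

variable {r : ℝ} {R : ℕ → ℝ}

theorem equicontinuous_of_hasModulus {κ : Type*} {F : κ → (ι → ℝ) → ℝ} (hr0 : 0 ≤ r) (hr : r < 1)
    (hF : ∀ a, HasModulus r R (F a)) : Equicontinuous F := by
  intro p
  rw [Metric.equicontinuousAt_iff]
  intro ε hε
  obtain ⟨N, hN⟩ := exists_nat_ge (‖p‖ + 1)
  have ht : Tendsto (fun k => R N * r ^ k) atTop (𝓝 0) := by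
    simpa using (tendsto_pow_atTop_nhds_zero_of_lt_one hr0 hr).const_mul (R N)
  obtain ⟨k, hk⟩ := (ht.eventually (gt_mem_nhds hε)).exists
  refine ⟨(1 / 2) ^ k, by positivity, fun x hx a => ?_⟩
  rw [Real.dist_eq]
  refine (hF a N k p x (by linarith) ?_ (by rw [dist_comm]; exact hx.le)).trans_lt hk
  have h1 : dist x p ≤ 1 := hx.le.trans (pow_le_one₀ (by norm_num) (by norm_num))
  have h2 : ‖x‖ ≤ ‖x - p‖ + ‖p‖ := by simpa using norm_add_le (x - p) p
  rw [dist_eq_norm] at h1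
  linarith

theorem HasModulus.continuous {g : (ι → ℝ) → ℝ} (hr0 : 0 ≤ r) (hr : r < 1)
    (h : HasModulus r R g) : Continuous g :=
  (equicontinuous_of_hasModulus (F := fun _ : Unit => g) hr0 hr fun _ => h).continuous ()

/-- Walk from 0 to p in N steps of length at most 1; each costs `R N`, the modulus at k = 0. -/
theorem HasModulus.abs_le {g : (ι → ℝ) → ℝ} (h : HasModulus r R g) (h0 : g 0 = 0) {N : ℕ}
    (hN : N ≠ 0) {p : ι → ℝ} (hp : ‖p‖ ≤ N) : |g p| ≤ N * R N := by
  have hN' : (0 : ℝ) < N := by positivity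
  have hstep : ∀ {i : ℕ}, i < N →
      dist (g (((i : ℝ) / N) • p)) (g ((((i + 1 : ℕ) : ℝ) / N) • p)) ≤ R N := by
    intro i hi
    rw [Real.dist_eq]
    have hb : ∀ j : ℕ, j ≤ N → ‖((j : ℝ) / N) • p‖ ≤ N := by
      intro j hj
      rw [norm_smul, Real.norm_of_nonneg (by positivity)]
      have : (j : ℝ) / N ≤ 1 := by rw [div_le_one hN']; exact_mod_cast hj
      calc (j : ℝ) / N * ‖p‖ ≤ 1 * ‖p‖ := by gcongr
        _ ≤ N := by linarith
    refine (h N 0 _ _ (hb i hi.le) (hb (i + 1) hi) ?_).trans_eq (by simp)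
    rw [pow_zero, dist_eq_norm, ← sub_smul, norm_smul, ← sub_div]
    push_cast
    rw [show (i : ℝ) - (i + 1) = -1 by ring, norm_div, norm_neg, norm_one,
      Real.norm_of_nonneg hN'.le, div_mul_eq_mul_div, one_mul, div_le_one hN']
    exact hp
  have := dist_le_range_sum_of_dist_le (f := fun i : ℕ => g (((i : ℝ) / N) • p)) N hstep
  simpa [h0, hN, Real.dist_eq] using this

/-- Arzelà–Ascoli: the family is equicontinuous, and its set of underlying functions is closed for
pointwise convergence and contained in a product of compact intervals. It consists of all functions
with the modulus, since the modulus itself implies continuity. -/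
theorem isCompact_hasModulus (hr0 : 0 ≤ r) (hr : r < 1) :
    IsCompact {g : C(ι → ℝ, ℝ) | g 0 = 0 ∧ HasModulus r R g} := by
  refine ArzelaAscoli.isCompact_of_equicontinuous _ ?_
    (equicontinuous_of_hasModulus hr0 hr fun g => g.2.2)
  have himage : ContinuousMap.toFun '' {g : C(ι → ℝ, ℝ) | g 0 = 0 ∧ HasModulus r R g} =
      {g : (ι → ℝ) → ℝ | g 0 = 0 ∧ HasModulus r R g} := by
    ext g
    constructor
    · rintro ⟨g, hg, rfl⟩; exact hg
    · rintro hg; exact ⟨⟨g, hg.2.continuous hr0 hr⟩, hg, rfl⟩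
  rw [himage]
  have hB : ∀ p : ι → ℝ, ∃ B : ℝ, ∀ g : (ι → ℝ) → ℝ, g 0 = 0 → HasModulus r R g →
      |g p| ≤ B := fun p => by
    obtain ⟨N, hN⟩ := exists_nat_ge ‖p‖
    exact ⟨_, fun g h0 h => h.abs_le h0 (Nat.succ_ne_zero N) (hN.trans (by simp))⟩
  choose B hB using hB
  refine (isCompact_univ_pi fun p => isCompact_Icc (a := -B p) (b := B p)).of_isClosed_subset ?_
    fun g hg p _ => abs_le.1 (hB p g hg.1 hg.2)
  simp only [HasModulus, Set.ofPred_and, Set.ofPred_forall]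
  refine (isClosed_eq (continuous_apply _) continuous_const).inter ?_
  refine isClosed_iInter fun N => isClosed_iInter fun k => isClosed_iInter fun p =>
    isClosed_iInter fun p' => isClosed_iInter fun _ => isClosed_iInter fun _ =>
    isClosed_iInter fun _ => isClosed_le ?_ continuous_const
  exact ((continuous_apply p).sub (continuous_apply p')).abs

theorem isClosed_hasModulus (hr0 : 0 ≤ r) (hr : r < 1) :
    IsClosed {g : C(ι → ℝ, ℝ) | g 0 = 0 ∧ HasModulus r R g} :=
  (isCompact_hasModulus hr0 hr).isClosed

end Modulus

/-! ### Kolmogorov's continuity theorem and tightness criterion -/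

section Kolmogorov

variable {ι : Type*} [Fintype ι] {Ω : Type*} [MeasurableSpace Ω] {P : Measure Ω}

/-- **Kolmogorov's continuity theorem** on `ℝ ^ ι`. -/
theorem exists_continuous_version {m : ℕ} (hm : m ≠ 0) {C s : ℝ≥0∞} {r : ℝ} (hr : 0 < r)
    (hr1 : r < 1) (hC : C ≠ ∞) (hs : 2 ^ Fintype.card ι * s / ENNReal.ofReal r ^ m < 1)
    {u : (ι → ℝ) → Ω → ℝ} (hu : ∀ p, AEStronglyMeasurable (u p) P)
    (hmom : ∀ k p p', dist p p' ≤ (1 / 2) ^ k → ∫⁻ ω, ‖u p ω - u p' ω‖ₑ ^ m ∂P ≤ C * s ^ k) :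
    ∃ V : Ω → C(ι → ℝ, ℝ), (∀ p, Measurable fun ω => V ω p) ∧ ∀ p, ∀ᵐ ω ∂P, V ω p = u p ω := by
  classical
  -- Measurable representatives, so that the event G below is measurable.
  set u' : (ι → ℝ) → Ω → ℝ := fun p => (hu p).mk with hu'
  have hmeas : ∀ p, Measurable (u' p) := fun p => (hu p).stronglyMeasurable_mk.measurable
  have hae : ∀ p, ∀ᵐ ω ∂P, u p ω = u' p ω := fun p => (hu p).ae_eq_mk
  have hmom' : ∀ k p p', dist p p' ≤ (1 / 2) ^ k →
      ∫⁻ ω, ‖u' p ω - u' p' ω‖ₑ ^ m ∂P ≤ C * s ^ k := by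
    intro k p p' h
    refine le_of_eq_of_le (lintegral_congr_ae ?_) (hmom k p p' h)
    filter_upwards [hae p, hae p'] with ω h1 h2
    rw [h1, h2]
  -- As r < 1, the entropy condition already forces s < 1; hence the moments along dyadic
  -- approximations of a point are summable.
  have hs1 : s < 1 := by
    by_contra! h
    have hr' : ENNReal.ofReal r ^ m ≤ 1 := pow_le_one₀ (by simp) (by simpa using hr1.le)
    have : 1 ≤ 2 ^ Fintype.card ι * s / ENNReal.ofReal r ^ m := by
      rw [ENNReal.le_div_iff_mul_le (Or.inl (pow_ne_zero _ (by simpa using hr)))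
        (Or.inl (by finiteness)), one_mul]
      calc ENNReal.ofReal r ^ m ≤ 1 * 1 := by simpa using hr'
        _ ≤ 2 ^ Fintype.card ι * s := by
          gcongr; exact one_le_pow₀ (by norm_num)
    exact absurd hs this.not_gt
  -- On G every cube has a finite chaining constant. There the version is the limit along dyadic
  -- points; off G it is set to 0.
  let G : Set Ω := ⋂ N : ℕ, ⋃ c : ℕ, {ω | DyadicBound r N c (fun p => u' p ω)}
  have hGmeas : MeasurableSet G := by
    refine MeasurableSet.iInter fun N => MeasurableSet.iUnion fun c => ?_
    simp only [DyadicBound, Set.ofPred_forall]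
    refine MeasurableSet.iInter fun k => MeasurableSet.iInter fun j => MeasurableSet.iInter
      fun j' => MeasurableSet.iInter fun _ => ?_
    exact measurableSet_le (((hmeas _).sub (hmeas _)).abs) measurable_const
  have hGae : ∀ᵐ ω ∂P, ω ∈ G := by
    simp only [G, Set.mem_iInter, Set.mem_iUnion, Set.mem_ofPred_eq]
    rw [ae_all_iff]
    intro N
    rw [ae_iff]
    refine le_antisymm (le_of_forall_pos_le_add fun ε hε => ?_) zero_le
    obtain ⟨c, hc, h⟩ := exists_measure_not_dyadicBound_le (P := P) hm hr hC hs N hε.ne'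
    obtain ⟨n, hn⟩ := exists_nat_ge c
    rw [zero_add]
    refine (measure_mono fun ω hω => ?_).trans
      (h u' (fun p => (hmeas p).aestronglyMeasurable) hmom')
    intro h'
    refine hω ⟨n, fun k j j' hn' => (h' k j j' hn').trans ?_⟩
    gcongr
  have hlim : ∀ ω ∈ G, ∀ p, ∃ a,
      Tendsto (fun k => u' (dyadic k (dyadicFloor k p)) ω) atTop (𝓝 a) := by
    intro ω hω p
    obtain ⟨N, hN⟩ := exists_nat_ge ‖p‖
    obtain ⟨c, hc⟩ := Set.mem_iUnion.1 (Set.mem_iInter.1 hω N)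
    exact DyadicBound.exists_tendsto (f := fun p => u' p ω) hc hr1 hN
  choose! g hg using hlim
  have hcont : ∀ ω ∈ G, Continuous (g ω) := by
    intro ω hω
    choose c hc using fun N => Set.mem_iUnion.1 (Set.mem_iInter.1 hω N)
    refine HasModulus.continuous (r := r) (R := fun N => 2 * c N / (1 - r)) hr.le hr1 ?_
    intro N k p p' hp hp' hd
    exact DyadicBound.abs_sub_le (f := fun p => u' p ω) (hc N) hr.le hr1 (by positivity) hp hp' hd
      (hg ω hω p) (hg ω hω p')
  refine ⟨fun ω => if h : ω ∈ G then ⟨g ω, hcont ω h⟩ else 0, fun p => ?_, fun p => ?_⟩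
  · refine measurable_of_tendsto_metrizable
      (f := fun k => G.indicator (u' (dyadic k (dyadicFloor k p))))
      (fun k => (hmeas _).indicator hGmeas) (tendsto_pi_nhds.2 fun ω => ?_)
    by_cases h : ω ∈ G
    · simpa [h] using hg ω h p
    · simp [h]
  -- Summable moments force almost sure convergence of u' along the dyadic approximations of p to u'
  -- p, which identifies the limit defining the version.
  · have hsum : ∑' k : ℕ, ∫⁻ ω, ‖u' (dyadic k (dyadicFloor k p)) ω - u' p ω‖ₑ ^ m ∂P ≠ ∞ := by
      refine ne_top_of_le_ne_top ?_ (ENNReal.tsum_le_tsum fun k =>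
        hmom' k _ _ (dist_dyadic_dyadicFloor_le k p))
      rw [ENNReal.tsum_mul_left]
      exact ENNReal.mul_ne_top hC (tsum_geometric_ne_top hs1)
    have hm' : ∀ k : ℕ, Measurable fun ω => ‖u' (dyadic k (dyadicFloor k p)) ω - u' p ω‖ₑ ^ m :=
      fun k => ((hmeas _).sub (hmeas _)).enorm.pow_const m
    rw [← lintegral_tsum fun k => (hm' k).aemeasurable] at hsum
    filter_upwards [ae_lt_top (Measurable.tsum hm') hsum, hae p, hGae] with ω h1 h2 h3
    rw [h2]
    simp only [h3, dif_pos, ContinuousMap.coe_mk]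
    refine tendsto_nhds_unique (hg ω h3 p) ?_
    have h4 := ENNReal.tendsto_atTop_zero_of_tsum_ne_top h1.ne
    rw [tendsto_iff_edist_tendsto_0]
    simp only [edist_eq_enorm_sub]
    have h5 := h4.ennrpow_const (1 / m : ℝ)
    have hm0 : (0 : ℝ) < (m : ℝ)⁻¹ := by positivity
    simpa [← ENNReal.rpow_natCast, ← ENNReal.rpow_mul, hm, ENNReal.zero_rpow_of_pos hm0] using h5

/-- **Kolmogorov's tightness criterion** on `ℝ ^ ι`, for random fields vanishing at the origin. -/
theorem isTightMeasureSet_range_map [MeasurableSpace C(ι → ℝ, ℝ)] [BorelSpace C(ι → ℝ, ℝ)]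
    {κ : Type*} {m : ℕ} (hm : m ≠ 0) {C s : ℝ≥0∞} {r : ℝ} (hr : 0 < r)
    (hr1 : r < 1) (hC : C ≠ ∞) (hs : 2 ^ Fintype.card ι * s / ENNReal.ofReal r ^ m < 1)
    {V : κ → Ω → C(ι → ℝ, ℝ)} (hV : ∀ a, Measurable (V a)) (h0 : ∀ a, ∀ᵐ ω ∂P, V a ω 0 = 0)
    (hmom : ∀ a k p p', dist p p' ≤ (1 / 2) ^ k →
      ∫⁻ ω, ‖V a ω p - V a ω p'‖ₑ ^ m ∂P ≤ C * s ^ k) :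
    IsTightMeasureSet (Set.range fun a => P.map (V a)) := by
  rw [isTightMeasureSet_iff_exists_isCompact_measure_compl_le]
  intro ε hε
  -- The allowed failure probability ε is shared among the cubes [-N, N]^ι, each having its own
  -- chaining constant.
  obtain ⟨δ, hδ, hδε⟩ := ENNReal.exists_pos_sum_of_countable' hε.ne' ℕ
  choose c hc h using fun N => exists_measure_not_dyadicBound_le (P := P) hm hr hC hs N (hδ N).ne'
  have hcl := isClosed_hasModulus (ι := ι) (R := fun N => 2 * c N / (1 - r)) hr.le hr1
  refine ⟨_, isCompact_hasModulus (R := fun N => 2 * c N / (1 - r)) hr.le hr1, ?_⟩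
  rintro _ ⟨a, rfl⟩
  rw [Measure.map_apply (hV a) hcl.measurableSet.compl]
  have hev : ∀ p, Measurable fun ω => V a ω p := fun p =>
    (continuous_eval_const p).measurable.comp (hV a)
  have hsub : V a ⁻¹' {g | g 0 = 0 ∧ HasModulus r (fun N => 2 * c N / (1 - r)) g}ᶜ ⊆
      {ω | ¬ V a ω 0 = 0} ∪ ⋃ N : ℕ, {ω | ¬ DyadicBound r N (c N) (fun p => V a ω p)} := by
    intro ω hω
    by_contra hcon
    simp only [Set.mem_union, Set.mem_iUnion, Set.mem_ofPred_eq, not_or, not_exists, not_not]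
      at hcon
    refine hω ⟨hcon.1, fun N k p p' hp hp' hd => ?_⟩
    have ht : ∀ p, Tendsto (fun k => V a ω (dyadic k (dyadicFloor k p))) atTop (𝓝 (V a ω p)) :=
      fun p => ((V a ω).continuous.tendsto p).comp (tendsto_dyadic_dyadicFloor p)
    exact DyadicBound.abs_sub_le (hcon.2 N) hr.le hr1 (hc N).le hp hp' hd (ht p) (ht p')
  refine (measure_mono hsub).trans ((measure_union_le _ _).trans ?_)
  rw [ae_iff.1 (h0 a), zero_add]
  refine (measure_iUnion_le _).trans ((ENNReal.tsum_le_tsum fun N => ?_).trans hδε.le)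
  exact h N (fun p ω => V a ω p) (fun p => (hev p).aestronglyMeasurable) (hmom a)

end Kolmogorov

/-! ### Vanishing at time zero and real-valued second moments -/

section Increments

variable {Ω : Type*} [MeasurableSpace Ω] {P : Measure Ω} {d : ℕ} {eq : Equation}
  {μ : Measure (E d)} {W : TestFunction d → Ω → ℝ}

/-- The zero test function. -/
noncomputable def TestFunction.zero (d : ℕ) : TestFunction d where
  toFun := 0
  smooth := contDiffOn_const
  compact_support := HasCompactSupport.zero
  eq_zero _ _ _ := rfl

theorem TestFunction.fourier_zero (t : ℝ) (ξ : E d) : (TestFunction.zero d).fourier t ξ = 0 := by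
  simp [TestFunction.fourier, fourierFun, TestFunction.zero]

/-- Without linearity of W, this comes from the vanishing variance. -/
theorem IsHomogeneousNoise.ae_zero (hW : IsHomogeneousNoise P μ W) :
    ∀ᵐ ω ∂P, W (TestFunction.zero d) ω = 0 := by
  have h := hW.covariance (TestFunction.zero d) (TestFunction.zero d)
  simp only [TestFunction.fourier_zero, zero_mul, integral_zero, Complex.ofReal_eq_zero] at h
  have h2 := (integral_eq_zero_iff_of_nonneg (fun ω => mul_self_nonneg _)
    ((hW.memLp _).integrable_mul (hW.memLp _))).1 h
  filter_upwards [h2] with ω hω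
  simpa using hω

theorem eLpNorm_kernelFourier_zero [SFinite μ] (x : E d) :
    eLpNorm (eq.kernelFourier 0 x) 2 (noiseMeasure μ) = 0 := by
  have h := eLpNorm_two_sq_noiseMeasure_le (μ := μ) (q := 1) (eq.measurable_kernelFourier 0 x)
    le_rfl fun ξ => ?_
  · simpa using h
  · refine le_of_eq_of_le (setLIntegral_congr_fun (g := 0) measurableSet_Ici fun r hr => ?_) ?_
    · have : ¬ r < 0 := not_lt.2 hr
      simp [Equation.kernelFourier, this]
    · simp

/-- At time 0 the kernel vanishes on s ≥ 0, so the noise of the zero test function is a stochastic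
convolution too, and any two agree almost surely. This fixes the value at the origin needed for
tightness. -/
theorem IsStochConv.ae_eq_zero [SFinite μ] (hW : IsHomogeneousNoise P μ W)
    (hμ : ∫⁻ ξ, ENNReal.ofReal (1 / (1 + ‖ξ‖ ^ 2)) ∂μ ≠ ⊤) (hd : eq.AdmissibleDim d) {x : E d}
    {X : Ω → ℝ} (hX : IsStochConv P eq μ W 0 x X) : ∀ᵐ ω ∂P, X ω = 0 := by
  have hY : IsStochConv P eq μ W 0 x (W (TestFunction.zero d)) := by
    refine ⟨hW.memLp _, fun _ => TestFunction.zero d, ?_, by simp⟩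
    simp only [noiseDistSq_eq_eLpNorm_sq hd, TestFunction.fourier_zero, zero_sub]
    have h := eLpNorm_kernelFourier_zero (μ := μ) (eq := eq) x
    rw [← eLpNorm_neg] at h
    have h' : eLpNorm (fun p => -eq.kernelFourier 0 x p) 2 (noiseMeasure μ) = 0 := h
    simp [h']
  have h := hW.lintegral_sub_pow_le hμ hd hX hY 2
  simp only [sub_self, eLpNorm_zero', ne_eq, OfNat.ofNat_ne_zero, not_false_eq_true, zero_pow,
    mul_zero, nonpos_iff_eq_zero] at h
  have hm : AEMeasurable (fun ω => ‖X ω - W (TestFunction.zero d) ω‖ₑ ^ 2) P :=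
    (hX.1.1.sub hY.1.1).enorm.pow_const 2
  rw [lintegral_eq_zero_iff' hm] at h
  filter_upwards [h, hW.ae_zero] with ω h1 h2
  simpa [h2] using h1

theorem integral_sq_abs_sub_le {X Y : Ω → ℝ} (hX : AEStronglyMeasurable X P)
    (hY : AEStronglyMeasurable Y P) {a : ℝ} (ha : 0 ≤ a)
    (h : ∫⁻ ω, ‖X ω - Y ω‖ₑ ^ 2 ∂P ≤ ENNReal.ofReal a) : ∫ ω, |X ω - Y ω| ^ 2 ∂P ≤ a := by
  have hm : AEStronglyMeasurable (fun ω => |X ω - Y ω| ^ 2) P := (hX.sub hY).norm.pow 2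
  rw [integral_eq_lintegral_of_nonneg_ae (ae_of_all _ fun ω => by positivity) hm]
  refine ENNReal.toReal_le_of_le_ofReal ha (le_of_eq_of_le (lintegral_congr fun ω => ?_) h)
  rw [ENNReal.ofReal_pow (abs_nonneg _), ← Real.norm_eq_abs, ofReal_norm]

theorem lintegral_one_div_sq_ne_top {q : ℝ} (hq0 : 0 < q) (hq2 : q < 2)
    (h : ∫⁻ ξ, ENNReal.ofReal (1 / (1 + ‖ξ‖ ^ q)) ∂μ ≠ ⊤) :
    ∫⁻ ξ, ENNReal.ofReal (1 / (1 + ‖ξ‖ ^ 2)) ∂μ ≠ ⊤ := by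
  refine ne_top_of_le_ne_top (ENNReal.mul_ne_top ENNReal.ofReal_ne_top h)
    ((lintegral_mono fun ξ => ?_).trans_eq
      (lintegral_const_mul' (ENNReal.ofReal 2) _ ENNReal.ofReal_ne_top))
  rw [← ENNReal.ofReal_mul zero_le_two]
  exact ENNReal.ofReal_le_ofReal (one_div_one_add_sq_le hq0 hq2 (norm_nonneg ξ))

end Increments

/-! ### Passage between [0,T] × ℝ^d and ℝ^{d+1} -/

section Retraction

variable {d : ℕ} {T : ℝ}

/-- The identification of `ℝ ^ d` with Euclidean space. -/
noncomputable def euclid (d : ℕ) : (Fin d → ℝ) ≃L[ℝ] E d := (EuclideanSpace.equiv (Fin d) ℝ).symm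

/-- The map from `ℝ^(1+d)` onto `[0,T] × ℝ^d` clamping the time coordinate. -/
noncomputable def clampTime (d : ℕ) (hT : 0 ≤ T) :
    C(Fin (d + 1) → ℝ, Set.Icc (0 : ℝ) T × E d) where
  toFun p := (Set.projIcc 0 T hT (p 0), euclid d (fun i => p i.succ))
  continuous_toFun := by
    refine (continuous_projIcc.comp (continuous_apply 0)).prodMk
      ((euclid d).continuous.comp (by fun_prop))

/-- The inclusion of `[0,T] × ℝ^d` in `ℝ^(1+d)`. -/
noncomputable def timeSpaceInclusion (d : ℕ) (T : ℝ) :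
    C(Set.Icc (0 : ℝ) T × E d, Fin (d + 1) → ℝ) where
  toFun p := Fin.cons p.1 ((euclid d).symm p.2)
  continuous_toFun := by
    refine continuous_pi fun i => ?_
    refine Fin.cases ?_ (fun i => ?_) i
    · exact continuous_subtype_val.comp continuous_fst
    · exact (continuous_apply i).comp ((euclid d).symm.continuous.comp continuous_snd)

/-- Makes [0,T] × ℝ^d a retract of ℝ^{d+1}, so that results on path spaces transfer by
precomposition. -/
theorem clampTime_inclusion (hT : 0 ≤ T) (p : Set.Icc (0 : ℝ) T × E d) :
    clampTime d hT (timeSpaceInclusion d T p) = p := by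
  obtain ⟨t, x⟩ := p
  simp [clampTime, timeSpaceInclusion]

theorem clampTime_zero (hT : 0 ≤ T) : ((clampTime d hT 0).1 : ℝ) = 0 := by
  simp [clampTime]

theorem abs_clampTime_sub_le (hT : 0 ≤ T) (p p' : Fin (d + 1) → ℝ) :
    |((clampTime d hT p).1 : ℝ) - (clampTime d hT p').1| ≤ dist p p' := by
  refine le_trans ?_ (dist_le_pi_dist p p' 0)
  rw [Real.dist_eq]
  exact Set.abs_projIcc_sub_projIcc hT

theorem norm_clampTime_sub_le (hT : 0 ≤ T) (p p' : Fin (d + 1) → ℝ) :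
    ‖(clampTime d hT p).2 - (clampTime d hT p').2‖ ≤
      ‖(euclid d : (Fin d → ℝ) →L[ℝ] E d)‖ * dist p p' := by
  have h : (clampTime d hT p).2 - (clampTime d hT p').2 =
      (euclid d : (Fin d → ℝ) →L[ℝ] E d) (fun i => p i.succ - p' i.succ) := by
    simp only [clampTime, ContinuousMap.coe_mk, ContinuousLinearEquiv.coe_coe, ← map_sub]
    rfl
  rw [h]
  refine (ContinuousLinearMap.le_opNorm _ _).trans ?_
  gcongr
  refine (pi_norm_le_iff_of_nonneg dist_nonneg).2 fun i => ?_
  rw [← dist_eq_norm]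
  exact dist_le_pi_dist p p' i.succ

end Retraction

/-! ### Moment bounds in the form required by Kolmogorov's criterion -/

section Assembly

variable {Ω : Type*} [MeasurableSpace Ω] {P : Measure Ω} {d : ℕ} {eq : Equation} {T q : ℝ}

theorem one_sub_half_le_timeExponent (eq : Equation) (hq2 : q < 2) :
    1 - q / 2 ≤ eq.timeExponent q := by
  cases eq <;> simp only [Equation.timeExponent] <;> linarith

/-- Hölder continuity of the integrands in `L²`, in the coordinates of `clampTime`. -/
theorem Equation.exists_eLpNorm_clampTime_sub_sq_le (eq : Equation) (d : ℕ) (hT : 0 ≤ T)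
    (hq0 : 0 < q) (hq2 : q < 2) : ∃ A : ℝ, ∀ (μ : Measure (E d)) [SFinite μ],
      ∀ p p' : Fin (d + 1) → ℝ, ∀ δ : ℝ, dist p p' ≤ δ → δ ≤ 1 →
        eLpNorm (fun y => eq.kernelFourier (clampTime d hT p).1 (clampTime d hT p).2 y -
          eq.kernelFourier (clampTime d hT p').1 (clampTime d hT p').2 y) 2 (noiseMeasure μ) ^ 2 ≤
        ENNReal.ofReal (A * δ ^ (1 - q / 2)) * ∫⁻ ξ, ENNReal.ofReal (1 / (1 + ‖ξ‖ ^ q)) ∂μ := by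
  obtain ⟨C₁, h₁0, h₁⟩ := eq.eLpNorm_kernelFourier_sub_space_sq_le (d := d) hT hq0 hq2
  obtain ⟨C₂, h₂0, h₂⟩ := eq.eLpNorm_kernelFourier_sub_time_sq_le (d := d) hT hq0 hq2
  set L : ℝ := ‖(euclid d : (Fin d → ℝ) →L[ℝ] E d)‖ with hL
  have hL0 : 0 ≤ L := norm_nonneg _
  refine ⟨2 * (C₁ * L ^ (2 - q) + C₂), fun μ _ p p' δ hδ hδ1 => ?_⟩
  have hδ0 : 0 ≤ δ := dist_nonneg.trans hδ
  set t := (clampTime d hT p).1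
  set x := (clampTime d hT p).2 with hx
  set s := (clampTime d hT p').1
  set z := (clampTime d hT p').2 with hz
  set J := ∫⁻ ξ, ENNReal.ofReal (1 / (1 + ‖ξ‖ ^ q)) ∂μ with hJ
  -- For δ ≤ 1 the space and time exponents may all be lowered to 1 - q/2.
  have hbase : ∀ a : ℝ, 1 - q / 2 ≤ a → δ ^ a ≤ δ ^ (1 - q / 2) := fun a ha =>
    Real.rpow_le_rpow_of_exponent_ge' hδ0 hδ1 (by linarith) ha
  have e₁ : C₁ * ‖x - z‖ ^ (2 - q) ≤ C₁ * L ^ (2 - q) * δ ^ (1 - q / 2) := by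
    have hxz : ‖x - z‖ ≤ L * δ := (norm_clampTime_sub_le hT p p').trans (by gcongr)
    have : ‖x - z‖ ^ (2 - q) ≤ (L * δ) ^ (2 - q) :=
      Real.rpow_le_rpow (norm_nonneg _) hxz (by linarith)
    rw [Real.mul_rpow hL0 hδ0] at this
    rw [mul_assoc]
    refine mul_le_mul_of_nonneg_left (this.trans ?_) h₁0
    exact mul_le_mul_of_nonneg_left (hbase (2 - q) (by linarith)) (by positivity)
  have e₂ : C₂ * |(t : ℝ) - s| ^ eq.timeExponent q ≤ C₂ * δ ^ (1 - q / 2) := by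
    have hexp := one_sub_half_le_timeExponent eq hq2
    refine mul_le_mul_of_nonneg_left ((Real.rpow_le_rpow (abs_nonneg _)
      ((abs_clampTime_sub_le hT p p').trans hδ) (by linarith)).trans (hbase _ hexp)) h₂0
  -- Move first in space at time t, then in time at the point z.
  have hsplit : (fun y => eq.kernelFourier t x y - eq.kernelFourier s z y) =
      (fun y => eq.kernelFourier t x y - eq.kernelFourier t z y) +
        fun y => eq.kernelFourier t z y - eq.kernelFourier s z y := by
    ext y; simp
  have hm : ∀ (t : ℝ) (x : E d), AEStronglyMeasurable (eq.kernelFourier t x) (noiseMeasure μ) :=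
    fun t x => (eq.measurable_kernelFourier t x).aestronglyMeasurable
  rw [hsplit]
  calc _ ≤ (eLpNorm (fun y => eq.kernelFourier t x y - eq.kernelFourier t z y) 2 (noiseMeasure μ) +
        eLpNorm (fun y => eq.kernelFourier t z y - eq.kernelFourier s z y) 2
          (noiseMeasure μ)) ^ 2 := by
        gcongr
        exact eLpNorm_add_le ((hm _ _).sub (hm _ _)) ((hm _ _).sub (hm _ _)) (by norm_num)
    _ ≤ 2 ^ (2 - 1) * (eLpNorm (fun y => eq.kernelFourier t x y - eq.kernelFourier t z y) 2
          (noiseMeasure μ) ^ 2 + eLpNorm (fun y => eq.kernelFourier t z y -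
            eq.kernelFourier s z y) 2 (noiseMeasure μ) ^ 2) := by
        have := ENNReal.rpow_add_le_mul_rpow_add_rpow
          (eLpNorm (fun y => eq.kernelFourier t x y - eq.kernelFourier t z y) 2 (noiseMeasure μ))
          (eLpNorm (fun y => eq.kernelFourier t z y - eq.kernelFourier s z y) 2 (noiseMeasure μ))
          (p := 2) (by norm_num)
        norm_num at this ⊢
        exact this
    _ ≤ 2 * (ENNReal.ofReal (C₁ * L ^ (2 - q) * δ ^ (1 - q / 2)) * J +
          ENNReal.ofReal (C₂ * δ ^ (1 - q / 2)) * J) := by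
        norm_num only [pow_one]
        gcongr
        · exact (h₁ μ t t.2 x z).trans (by gcongr)
        · exact (h₂ μ s s.2 t t.2 z).trans (by gcongr)
    _ = _ := by
        have hp : 0 ≤ δ ^ (1 - q / 2) := by positivity
        have hp' : 0 ≤ L ^ (2 - q) := by positivity
        rw [← add_mul, ← ENNReal.ofReal_add (by positivity) (by positivity), ← mul_assoc,
          show (2 : ℝ≥0∞) = ENNReal.ofReal 2 by simp, ← ENNReal.ofReal_mul zero_le_two]
        congr 2
        ring

/-- The data needed for Kolmogorov's criterion: moments of a large even order, with a geometric
decay that beats the entropy of the dyadic points. -/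
theorem Equation.exists_moment_bound (eq : Equation) (d : ℕ) (hd : eq.AdmissibleDim d)
    (hT : 0 ≤ T) (hq0 : 0 < q) (hq2 : q < 2) {B : ℝ≥0∞} (hB : B ≠ ∞) :
    ∃ (m : ℕ) (C s : ℝ≥0∞) (r : ℝ), m ≠ 0 ∧ C ≠ ∞ ∧ 0 < r ∧ r < 1 ∧
      2 ^ Fintype.card (Fin (d + 1)) * s / ENNReal.ofReal r ^ m < 1 ∧
      ∀ (μ : Measure (E d)) (W : TestFunction d → Ω → ℝ), IsHomogeneousNoise P μ W →
        ∫⁻ ξ, ENNReal.ofReal (1 / (1 + ‖ξ‖ ^ q)) ∂μ ≤ B → ∀ v : ℝ → E d → Ω → ℝ,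
        (∀ t ∈ Set.Icc (0 : ℝ) T, ∀ x, IsStochConv P eq μ W t x (v t x)) →
        ∀ k p p', dist p p' ≤ (1 / 2) ^ k →
          ∫⁻ ω, ‖v (clampTime d hT p).1 (clampTime d hT p).2 ω -
            v (clampTime d hT p').1 (clampTime d hT p').2 ω‖ₑ ^ m ∂P ≤ C * s ^ k := by
  obtain ⟨A, hA⟩ := eq.exists_eLpNorm_clampTime_sub_sq_le d hT hq0 hq2
  -- At scale 2^{-k} the variance is of order b^{4k}, so the moment of order 2l decays with ratio s
  -- = b^{4l}. Taking r = b leaves s / r^{2l} = b^{2l}, which beats the entropy 2^{d+1} once l is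
  -- large.
  set b : ℝ := (1 / 2) ^ ((1 - q / 2) / 4) with hb
  have hb0 : 0 < b := by positivity
  have hb1 : b < 1 := Real.rpow_lt_one (by norm_num) (by norm_num) (by linarith)
  have hb4 : b ^ 4 = (1 / 2) ^ (1 - q / 2) := by
    rw [hb, ← Real.rpow_natCast, ← Real.rpow_mul (by norm_num)]
    congr 1; push_cast; ring
  have hlim : Tendsto (fun l : ℕ => 2 ^ Fintype.card (Fin (d + 1)) * (b ^ 2) ^ l) atTop (𝓝 0) := by
    simpa using (tendsto_pow_atTop_nhds_zero_of_lt_one (by positivity)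
      (pow_lt_one₀ hb0.le hb1 two_ne_zero)).const_mul ((2 : ℝ) ^ Fintype.card (Fin (d + 1)))
  obtain ⟨l, hl, hl0⟩ := ((hlim.eventually (gt_mem_nhds one_pos)).and
    (eventually_ne_atTop 0)).exists
  refine ⟨2 * l, gaussianMoment (2 * l) * (ENNReal.ofReal A * B) ^ l, ENNReal.ofReal ((b ^ 4) ^ l),
    b, by positivity, ?_, hb0, hb1, ?_, ?_⟩
  · exact ENNReal.mul_ne_top (gaussianMoment_ne_top _)
      (ENNReal.pow_ne_top (ENNReal.mul_ne_top ENNReal.ofReal_ne_top hB))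
  · rw [← ENNReal.ofReal_pow hb0.le, show (2 : ℝ≥0∞) = ENNReal.ofReal 2 by simp,
      ← ENNReal.ofReal_pow zero_le_two, ← ENNReal.ofReal_mul (by positivity),
      ← ENNReal.ofReal_div_of_pos (by positivity), ENNReal.ofReal_lt_one]
    refine lt_of_eq_of_lt ?_ hl
    rw [pow_mul, div_eq_iff (by positivity), mul_assoc, ← mul_pow]
    ring
  · intro μ W hW hJ v hv k p p' hdist
    have hμ := lintegral_one_div_sq_ne_top hq0 hq2 (ne_top_of_le_ne_top hB hJ)
    have := isFiniteMeasureOnCompacts_of_lintegral_ne_top hμ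
    refine (hW.lintegral_sub_pow_le hμ hd (hv _ (clampTime d hT p).1.2 _)
      (hv _ (clampTime d hT p').1.2 _) _).trans ?_
    rw [mul_assoc, pow_mul]
    gcongr
    have h := hA μ p p' _ hdist (pow_le_one₀ (by norm_num) (by norm_num))
    have hk : ((1 / 2 : ℝ) ^ k) ^ (1 - q / 2) = (b ^ 4) ^ k := by
      rw [hb4, ← Real.rpow_natCast, ← Real.rpow_mul (by norm_num), mul_comm,
        Real.rpow_mul (by norm_num), Real.rpow_natCast]
    rw [hk, ENNReal.ofReal_mul' (by positivity), ENNReal.ofReal_pow (by positivity)] at h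
    calc _ ≤ (ENNReal.ofReal A * ENNReal.ofReal (b ^ 4) ^ k * B) ^ l := by
          gcongr; exact h.trans (by gcongr)
      _ = _ := by
          rw [ENNReal.ofReal_pow (by positivity) l]
          ring

end Assembly

end SPDE

/-! ### The proposition -/

theorem proposition3p3 {Ω : Type*} [MeasurableSpace Ω] (P : Measure Ω) [IsProbabilityMeasure P]
    (eq : SPDE.Equation) (d : ℕ) (hd : eq.AdmissibleDim d) (T : ℝ) (hT : 0 < T)
    (μ : ℕ → Measure (SPDE.E d)) (W : ℕ → SPDE.TestFunction d → Ω → ℝ)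
    (hW : ∀ n, SPDE.IsHomogeneousNoise P (μ n) (W n))
    (q : ℝ) (hq0 : 0 < q) (hq2 : q < 2)
    (hH1 : (⨆ n, ∫⁻ ξ, ENNReal.ofReal (1 / (1 + ‖ξ‖ ^ q)) ∂(μ n)) < ⊤) :
    -- the stochastic convolutions are well defined
    (∀ n, ∀ t ∈ Set.Icc (0 : ℝ) T, ∀ x, ∃ X, SPDE.IsStochConv P eq (μ n) (W n) t x X) ∧
    ∀ v : ℕ → ℝ → SPDE.E d → Ω → ℝ,
      (∀ n, ∀ t ∈ Set.Icc (0 : ℝ) T, ∀ x, SPDE.IsStochConv P eq (μ n) (W n) t x (v n t x)) →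
      -- space increments
      (∀ K : Set (SPDE.E d), IsCompact K → ∃ C : ℝ, 0 < C ∧ ∀ x ∈ K, ∀ z ∈ K,
        ∀ n, ∀ t ∈ Set.Icc (0 : ℝ) T,
          ∫ ω, |v n t x ω - v n t z ω| ^ 2 ∂P ≤ C * ‖x - z‖ ^ (2 - q)) ∧
      -- time increments
      (∃ C : ℝ, 0 < C ∧ ∀ s ∈ Set.Icc (0 : ℝ) T, ∀ t ∈ Set.Icc (0 : ℝ) T, ∀ n x,
          ∫ ω, |v n t x ω - v n s x ω| ^ 2 ∂P ≤ C * |t - s| ^ eq.timeExponent q) ∧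
      -- continuous versions and tightness of their laws
      (∀ n, ∃ V : Ω → SPDE.PathSpace d T, SPDE.IsContinuousVersion P (v n) V) ∧
      (∀ V : ℕ → Ω → SPDE.PathSpace d T, (∀ n, SPDE.IsContinuousVersion P (v n) (V n)) →
        IsTightMeasureSet (Set.range fun n => P.map (V n))) := by
  set B := ⨆ n, ∫⁻ ξ, ENNReal.ofReal (1 / (1 + ‖ξ‖ ^ q)) ∂(μ n) with hBdef
  have hB : B ≠ ⊤ := hH1.ne
  have hJ : ∀ n, ∫⁻ ξ, ENNReal.ofReal (1 / (1 + ‖ξ‖ ^ q)) ∂(μ n) ≤ B := fun n =>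
    le_iSup (fun n => ∫⁻ ξ, ENNReal.ofReal (1 / (1 + ‖ξ‖ ^ q)) ∂(μ n)) n
  have hμ : ∀ n, ∫⁻ ξ, ENNReal.ofReal (1 / (1 + ‖ξ‖ ^ 2)) ∂(μ n) ≠ ⊤ := fun n =>
    SPDE.lintegral_one_div_sq_ne_top hq0 hq2 (ne_top_of_le_ne_top hB (hJ n))
  have hfin : ∀ n, IsFiniteMeasureOnCompacts (μ n) := fun n =>
    SPDE.isFiniteMeasureOnCompacts_of_lintegral_ne_top (hμ n)
  -- Here h stands for the squared L² distance of two kernels; the uniform bound B replaces the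
  -- integral for each n.
  have hreal : ∀ (A : ℝ) (X Y : Ω → ℝ) (n : ℕ) (h : ENNReal), 0 ≤ A → MemLp X 2 P → MemLp Y 2 P →
      ∫⁻ ω, ‖X ω - Y ω‖ₑ ^ 2 ∂P ≤ SPDE.gaussianMoment 2 * h →
      h ≤ ENNReal.ofReal A * ∫⁻ ξ, ENNReal.ofReal (1 / (1 + ‖ξ‖ ^ q)) ∂(μ n) →
      ∫ ω, |X ω - Y ω| ^ 2 ∂P ≤ (SPDE.gaussianMoment 2).toReal * B.toReal * A := by
    intro A X Y n h hA hX hY h1 h2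
    refine SPDE.integral_sq_abs_sub_le hX.1 hY.1 (by positivity) (h1.trans ?_)
    rw [ENNReal.ofReal_mul (by positivity), ENNReal.ofReal_mul (by positivity),
      ENNReal.ofReal_toReal (SPDE.gaussianMoment_ne_top 2), ENNReal.ofReal_toReal hB, mul_assoc]
    gcongr
    rw [mul_comm]
    exact h2.trans (by gcongr; exact hJ n)
  refine ⟨fun n t ht x => ?_, fun v hv => ⟨fun K _ => ?_, ?_, ?_, ?_⟩⟩
  · obtain ⟨C, hC0, hC⟩ := eq.eLpNorm_kernelFourier_sq_le (d := d) hT.le hq0 hq2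
    refine (hW n).exists_isStochConv (hμ n) hd (SPDE.approximable_kernelFourier hd (hμ n) ?_)
    have h := ne_top_of_le_ne_top (ENNReal.mul_ne_top ENNReal.ofReal_ne_top
      (ne_top_of_le_ne_top hB (hJ n))) (hC (μ n) t ht x)
    exact fun h' => h (by simp [h'])
  · obtain ⟨C, hC0, hC⟩ := eq.eLpNorm_kernelFourier_sub_space_sq_le (d := d) hT.le hq0 hq2
    -- The added 1 only makes the constant strictly positive.
    refine ⟨(SPDE.gaussianMoment 2).toReal * B.toReal * C + 1, by positivity,
      fun x _ z _ n t ht => ?_⟩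
    refine (hreal _ _ _ n _ (by positivity) (hv n t ht x).1 (hv n t ht z).1
      ((hW n).lintegral_sub_pow_le (hμ n) hd (hv n t ht x) (hv n t ht z) 2)
      (hC (μ n) t ht x z)).trans ?_
    have : 0 ≤ ‖x - z‖ ^ (2 - q) := by positivity
    linarith
  · obtain ⟨C, hC0, hC⟩ := eq.eLpNorm_kernelFourier_sub_time_sq_le (d := d) hT.le hq0 hq2
    refine ⟨(SPDE.gaussianMoment 2).toReal * B.toReal * C + 1, by positivity,
      fun s hs t ht n x => ?_⟩
    refine (hreal _ _ _ n _ (by positivity) (hv n t ht x).1 (hv n s hs x).1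
      ((hW n).lintegral_sub_pow_le (hμ n) hd (hv n t ht x) (hv n s hs x) 2)
      (hC (μ n) s hs t ht x)).trans ?_
    have : 0 ≤ |t - s| ^ eq.timeExponent q := by positivity
    linarith
  · intro n
    obtain ⟨m, C, s, r, hm, hC, hr, hr1, hs, hmom⟩ :=
      eq.exists_moment_bound (P := P) d hd hT.le hq0 hq2 hB
    obtain ⟨U, hUm, hU⟩ := SPDE.exists_continuous_version hm hr hr1 hC hs
      (u := fun p => v n (SPDE.clampTime d hT.le p).1 (SPDE.clampTime d hT.le p).2)
      (fun p => (hv n _ (SPDE.clampTime d hT.le p).1.2 _).1.1)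
      (hmom (μ n) (W n) (hW n) (hJ n) (v n) (hv n))
    refine ⟨fun ω => (U ω).comp (SPDE.timeSpaceInclusion d T),
      SPDE.measurable_of_measurable_eval fun p => hUm _, fun p => ?_⟩
    filter_upwards [hU (SPDE.timeSpaceInclusion d T p)] with ω hω
    simpa [SPDE.clampTime_inclusion] using hω
  · intro V hV
    obtain ⟨m, C, s, r, hm, hC, hr, hr1, hs, hmom⟩ :=
      eq.exists_moment_bound (P := P) d hd hT.le hq0 hq2 hB
    borelize C(Fin (d + 1) → ℝ, ℝ)
    have hVm : ∀ n, Measurable fun ω => (V n ω).comp (SPDE.clampTime d hT.le) := fun n =>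
      (ContinuousMap.continuous_precomp (SPDE.clampTime d hT.le)).measurable.comp (hV n).1
    have hincl := ContinuousMap.continuous_precomp (Z := ℝ) (SPDE.timeSpaceInclusion d T)
    have htight := SPDE.isTightMeasureSet_range_map (P := P) hm hr hr1 hC hs hVm (fun n => ?_) ?_
    -- Each `V n` is recovered from its time-clamped extension by restriction, a continuous map, and
    -- continuous images of tight families are tight.
    · refine (htight.map hincl).subset ?_
      rintro _ ⟨n, rfl⟩
      refine ⟨_, ⟨n, rfl⟩, ?_⟩
      rw [Measure.map_map hincl.measurable (hVm n)]
      congr 1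
      ext ω p
      simp [SPDE.clampTime_inclusion]
    -- The origin of ℝ^{d+1} is clamped to time 0, where the convolution vanishes almost surely.
    · have h0 := (hv n 0 (Set.left_mem_Icc.2 hT.le) (SPDE.clampTime d hT.le 0).2).ae_eq_zero
        (hW n) (hμ n) hd
      filter_upwards [h0, (hV n).2 (SPDE.clampTime d hT.le 0)] with ω h1 h2
      rw [SPDE.clampTime_zero] at h2
      simpa [h1] using h2
    · intro n k p p' hdist
      refine le_of_eq_of_le (lintegral_congr_ae ?_)
        (hmom (μ n) (W n) (hW n) (hJ n) (v n) (hv n) k p p' hdist)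
      filter_upwards [(hV n).2 (SPDE.clampTime d hT.le p),
        (hV n).2 (SPDE.clampTime d hT.le p')] with ω h1 h2
      simp only [ContinuousMap.comp_apply, h1, h2]
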